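/- Let $(\mathcal X,\mathfrak S,\mu)$ be a $\sigma$-finite measure space with an increasing sequence of $\sigma$-algebras $\mathfrak S_n\subset\mathfrak S$, $n\in\mathbb Z$, each of which is atomic: there is a countable disjoint collection $\mathscr D_n\subset\mathfrak S_n$ of sets of positive finite measure such that every $A\in\mathfrak S_n$ is a union of sets from $\mathscr D_n$. No homogeneity is assumed. Put $\mathscr D=\bigcup_n\mathscr D_n$, $|I|=\mu(I)$, $dx=d\mu(x)$, $\langle f\rangle_I=|I|^{-1}\int_I f\,dx$, $\mathbb E_If=\langle f\rangle_I\mathbf 1_I$; all functions are real valued. For $I\in\mathscr D$ the set $\mathrm{ch}(I)$ of its children consists of the $J\in\mathscr D_{n+1}$ with $J\subset I$, where $n$ is the largest integer with $I\in\mathscr D_n$; if $I\in\mathscr D_n$ for all large $n$, then $\mathrm{ch}(I)=\{I\}$. Put $\Delta_If=\sum_{J\in\mathrm{ch}(I)}\mathbb E_Jf-\mathbb E_If$ and $D_I=\Delta_IL^2(\mu)$. Consider operators of the following three kinds. 1. A Haar shift of complexity $1$: $Tf=\sum_{I\in\mathscr D}T_I(\Delta_If)$, where each $T_I$ is a linear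 operator on $D_I$ such that $(T_If,g)_{L^2}\le|I|^{-1}\|f\|_1\|g\|_1$ for all $f,g\in D_I$. (If $\Delta_If$ is only in $L^1$, then $T_I$ is extended by $L^1$-continuity, i.e. $T_I(\Delta_If)=\sum_{J\in\mathrm{ch}(I)}\langle f\rangle_JT_I(\Delta_I\mathbf 1_J)$.) 2. A sparse operator: $Tf=\sum_{I\in\mathcal Q}\langle f\rangle_I\mathbf 1_I$, where $\mathcal Q\subset\mathscr D$ satisfies $\bigl|\bigcup_{I\in\mathcal Q,\,I\subsetneq I_0}I\bigr|\le\frac12|I_0|$ for all $I_0\in\mathcal Q$. 3. A paraproduct: $Tf=\sum_{I\in\mathscr D}\langle f\rangle_Ib_I$, where $b_I\in D_I$ and $\sup_{I\in\mathscr D}|I|^{-1}\sum_{J\in\mathscr D,\,J\subset I}\|b_J\|_\infty^2|J|\le1$. Let $u,v\ge0$ be weights, i.e. measurable functions that are integrable over every $I\in\mathscr D$. Write $\mathbf u_I=\langle u\rangle_I$, and let $\mathbf u^*_I$ be the $L\log L$ norm of $u$ on $I$, namely $$\mathbf u_I^*=\int_0^\infty\psi_0\bigl(|I|^{-1}|\{x\in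 I:u(x)>t\}|\bigr)\,dt,\qquad \psi_0(s)=s\ln(e/s),\quad \psi_0(0)=0;$$ similarly for $v$. Let $\alpha:[1,\infty)\to(0,\infty)$ be such that $t\mapsto t\alpha(t)$ is increasing (not necessarily strictly) and $$C_\alpha:=\frac1{\alpha(1)}+\int_1^\infty\frac{dt}{t\alpha(t)}<\infty .$$ Suppose that $$\sup_{I\in\mathscr D}\ \alpha\bigl(\mathbf u_I^*/\mathbf u_I\bigr)\,\mathbf u_I^*\;\alpha\bigl(\mathbf v_I^*/\mathbf v_I\bigr)\,\mathbf v_I^*\le A<\infty ,$$ where the product is read as $0$ if $\mathbf u_I=0$ or $\mathbf v_I=0$. Then for each such operator $T$ and every $f\in L^2(u)$ the series defining $T(fu)$ converges unconditionally in $L^2(v)$, and $$\int_{\mathcal X}|T(fu)|^2v\,dx\le C\int_{\mathcal X}|f|^2u\,dx,\qquad C=K\,A\,C_\alpha^2,$$ with an absolute constant $K$. In particular $f\mapsto T(fu)$ is bounded from $L^2(u)$ to $L^2(v)$. -/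

import Mathlib

open MeasureTheory Filter Topology Set
open scoped ENNReal NNReal

noncomputable section

/-- A filtration `𝔖 n`, `n ∈ ℤ`, of atomic `σ`-algebras on a measure space: `atoms n` is a countable
disjoint collection of `𝔖 n`-measurable sets of positive (and finite) measure, and every set of
`𝔖 n` is a union of members of `atoms n`. No homogeneity is assumed. -/
structure AtomicFiltration {X : Type*} [mX : MeasurableSpace X] (μ : Measure X) where
  /-- the increasing sequence of `σ`-algebras -/
  sigma : Filtration ℤ mX
  /-- the atoms of generation `n` -/
  atoms : ℤ → Set (Set X)
  countable_atoms : ∀ n, (atoms n).Countable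
  disjoint_atoms : ∀ n, (atoms n).PairwiseDisjoint id
  measurable_atoms : ∀ n, ∀ I ∈ atoms n, MeasurableSet[sigma n] I
  measure_pos : ∀ n, ∀ I ∈ atoms n, 0 < μ I
  measure_lt_top : ∀ n, ∀ I ∈ atoms n, μ I < ∞
  atomic : ∀ n, ∀ A : Set X, MeasurableSet[sigma n] A → ∃ S ⊆ atoms n, A = ⋃₀ S

namespace AtomicFiltration

variable {X : Type*} [mX : MeasurableSpace X] {μ : Measure X} (F : AtomicFiltration μ)

/-- The collection of the atoms of all generations. -/
def lattice : Set (Set X) := ⋃ n : ℤ, F.atoms n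

/-- The children of `I`: the atoms of generation `n + 1` inside `I`, where `n` is the largest
integer such that `I` is an atom of generation `n`; if `I` is an atom of all sufficiently large
generations, its only child is `I`. -/
def children (I : Set X) : Set (Set X) :=
  {J | ∃ n : ℤ, IsGreatest {k : ℤ | I ∈ F.atoms k} n ∧ J ∈ F.atoms (n + 1) ∧ J ⊆ I} ∪
  {J | J = I ∧ ∀ᶠ n : ℤ in atTop, I ∈ F.atoms n}

theorem measurableSet_of_mem_lattice {I : Set X} (hI : I ∈ F.lattice) : MeasurableSet I := by
  obtain ⟨n, hn⟩ := mem_iUnion.1 hI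
  exact F.sigma.le n I (F.measurable_atoms n I hn)

theorem measure_lt_top_of_mem_lattice {I : Set X} (hI : I ∈ F.lattice) : μ I < ∞ := by
  obtain ⟨n, hn⟩ := mem_iUnion.1 hI
  exact F.measure_lt_top n I hn

theorem mem_lattice_of_mem_children {I J : Set X} (hJ : J ∈ F.children I) : J ∈ F.lattice := by
  rcases hJ with ⟨n, -, h, -⟩ | ⟨rfl, h⟩
  · exact mem_iUnion.2 ⟨n + 1, h⟩
  · obtain ⟨n, hn⟩ := h.exists
    exact mem_iUnion.2 ⟨n, hn⟩

theorem disjoint_children {I J K : Set X} (hJ : J ∈ F.children I) (hK : K ∈ F.children I)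
    (h : J ≠ K) : Disjoint J K := by
  rcases hJ with ⟨n, hn, hJ, -⟩ | ⟨rfl, hJ⟩ <;> rcases hK with ⟨m, hm, hK, -⟩ | ⟨rfl, hK⟩
  · obtain rfl := hn.unique hm
    exact F.disjoint_atoms _ hJ hK h
  · obtain ⟨k, hk, hk'⟩ := (hK.and (eventually_gt_atTop n)).exists
    exact absurd (hn.2 hk) (not_le.2 hk')
  · obtain ⟨k, hk, hk'⟩ := (hJ.and (eventually_gt_atTop m)).exists
    exact absurd (hm.2 hk) (not_le.2 hk')
  · exact absurd rfl h

/-- The averaging operator `𝔼_I f = ⟨f⟩_I 1_I`. -/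
def expect (_F : AtomicFiltration μ) (I : Set X) (f : X → ℝ) : X → ℝ :=
  I.indicator fun _ => ⨍ y in I, f y ∂μ

/-- The martingale difference `Δ_I f = ∑_{J ∈ ch(I)} 𝔼_J f - 𝔼_I f`. The children are disjoint, so
at each point at most one term of the sum is nonzero. -/
def mdiff (I : Set X) (f : X → ℝ) : X → ℝ := fun x =>
  (∑' J : F.children I, F.expect J f x) - F.expect I f x

theorem summable_expect (I : Set X) (f : X → ℝ) (x : X) :
    Summable fun J : F.children I => F.expect (J : Set X) f x := by
  apply summable_of_hasFiniteSupport
  apply Set.Subsingleton.finite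
  intro J hJ K hK
  by_contra h
  have hJx : x ∈ (J : Set X) := by
    by_contra hx
    exact hJ (indicator_of_notMem hx _)
  have hKx : x ∈ (K : Set X) := by
    by_contra hx
    exact hK (indicator_of_notMem hx _)
  exact Set.disjoint_left.1
    (F.disjoint_children J.2 K.2 fun h' => h (Subtype.ext h')) hJx hKx

theorem expect_add {I : Set X} (hI : I ∈ F.lattice) {f g : X → ℝ}
    (hf : MemLp f 2 μ) (hg : MemLp g 2 μ) :
    F.expect I (f + g) = F.expect I f + F.expect I g := by
  have : IsFiniteMeasure (μ.restrict I) :=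
    ⟨by simpa using F.measure_lt_top_of_mem_lattice hI⟩
  have hf' : Integrable f (μ.restrict I) := (hf.restrict I).integrable (by norm_num)
  have hg' : Integrable g (μ.restrict I) := (hg.restrict I).integrable (by norm_num)
  funext x
  by_cases hx : x ∈ I
  · simp only [expect, Pi.add_apply, indicator_of_mem hx, setAverage_eq]
    rw [integral_add hf' hg', smul_add]
  · simp [expect, hx]

theorem expect_smul (I : Set X) (c : ℝ) (f : X → ℝ) :
    F.expect I (c • f) = c • F.expect I f := by
  funext x
  by_cases hx : x ∈ I
  · simp only [expect, Pi.smul_apply, indicator_of_mem hx, setAverage_eq]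
    rw [integral_smul, smul_comm]
  · simp [expect, hx]

theorem mdiff_add {I : Set X} (hI : I ∈ F.lattice) {f g : X → ℝ}
    (hf : MemLp f 2 μ) (hg : MemLp g 2 μ) : F.mdiff I (f + g) = F.mdiff I f + F.mdiff I g := by
  funext x
  have h1 : (fun J : F.children I => F.expect (J : Set X) (f + g) x) =
      fun J : F.children I => F.expect (J : Set X) f x + F.expect (J : Set X) g x := by
    funext J
    rw [F.expect_add (F.mem_lattice_of_mem_children J.2) hf hg, Pi.add_apply]
  simp only [mdiff, Pi.add_apply]
  rw [h1, (F.summable_expect I f x).tsum_add (F.summable_expect I g x), F.expect_add hI hf hg,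
    Pi.add_apply]
  ring

theorem mdiff_smul (I : Set X) (c : ℝ) (f : X → ℝ) : F.mdiff I (c • f) = c • F.mdiff I f := by
  funext x
  simp only [mdiff, Pi.smul_apply, expect_smul, smul_eq_mul, tsum_mul_left]
  ring

/-- The space `D_I = Δ_I L²`. -/
def diffSpace (I : F.lattice) : Submodule ℝ (X → ℝ) where
  carrier := {h | ∃ f : X → ℝ, MemLp f 2 μ ∧ F.mdiff I f = h}
  add_mem' := by
    rintro _ _ ⟨f, hf, rfl⟩ ⟨g, hg, rfl⟩
    exact ⟨f + g, hf.add hg, F.mdiff_add I.2 hf hg⟩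
  zero_mem' := ⟨0, MemLp.zero, by simpa using F.mdiff_smul I 0 0⟩
  smul_mem' := by
    rintro c _ ⟨f, hf, rfl⟩
    exact ⟨c • f, hf.const_smul c, F.mdiff_smul I c f⟩

theorem mdiff_indicator_mem (I : F.lattice) {J : Set X} (hJ : J ∈ F.children I) :
    F.mdiff I (J.indicator fun _ => 1) ∈ F.diffSpace I :=
  ⟨_, memLp_indicator_const 2
    (F.measurableSet_of_mem_lattice (F.mem_lattice_of_mem_children hJ)) 1
    (Or.inr (F.measure_lt_top_of_mem_lattice (F.mem_lattice_of_mem_children hJ)).ne), rfl⟩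

/-- A Haar shift of complexity `1`: linear operators `T_I` on `D_I`, one for every atom `I`, with
`(T_I f, g) ≤ |I|⁻¹ ‖f‖₁ ‖g‖₁` for all `f, g ∈ D_I`. -/
structure HaarShift where
  /-- the operators `T_I` -/
  op : ∀ I : F.lattice, F.diffSpace I →ₗ[ℝ] F.diffSpace I
  bound : ∀ (I : F.lattice) (f g : F.diffSpace I),
    ∫ x, (op I f : X → ℝ) x * (g : X → ℝ) x ∂μ ≤
      (μ.real I)⁻¹ * (∫ x, |(f : X → ℝ) x| ∂μ) * ∫ x, |(g : X → ℝ) x| ∂μ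

open Classical in
/-- The term `T_I (Δ_I f)` of a Haar shift. If `f` is only integrable on `I` and `I` has infinitely
many children, `Δ_I f` need not be in `L²`. In that case `T_I` stands for its unique extension by
`L¹`-continuity: `Δ_I f = ∑_{J ∈ ch(I)} ⟨f⟩_J Δ_I 1_J` in `L¹`, hence
`T_I (Δ_I f) = ∑_{J ∈ ch(I)} ⟨f⟩_J T_I (Δ_I 1_J)`. -/
def HaarShift.term {F : AtomicFiltration μ} (T : F.HaarShift) (I : F.lattice) (f : X → ℝ) :
    X → ℝ :=
  if h : F.mdiff I f ∈ F.diffSpace I then T.op I ⟨F.mdiff I f, h⟩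
  else fun x => ∑' J : F.children I, (⨍ y in (J : Set X), f y ∂μ) *
    (T.op I ⟨F.mdiff I ((J : Set X).indicator fun _ => 1), F.mdiff_indicator_mem I J.2⟩ : X → ℝ) x

/-- A sparse family of atoms: the union of the members strictly inside a member `I₀` has
measure at most `|I₀| / 2`. -/
def IsSparse (Q : Set F.lattice) : Prop :=
  ∀ I₀ ∈ Q, μ (⋃ I ∈ {I ∈ Q | (I : Set X) ⊂ I₀}, (I : Set X)) ≤ μ (I₀ : Set X) / 2

/-- The term `⟨f⟩_I 1_I` of a sparse operator. -/
def sparseTerm (I : F.lattice) (f : X → ℝ) : X → ℝ := F.expect I f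

/-- The normalization `sup_I |I|⁻¹ ∑_{J ⊆ I} ‖b_J‖_∞² |J| ≤ 1` of a paraproduct. -/
def IsNormalizedPara (b : ∀ I : F.lattice, F.diffSpace I) : Prop :=
  ∀ I : F.lattice, (μ (I : Set X))⁻¹ * ∑' J : {J : F.lattice // (J : Set X) ⊆ I},
    eLpNorm (b J : X → ℝ) ∞ μ ^ 2 * μ (J : Set X) ≤ 1

/-- The term `⟨f⟩_I b_I` of the paraproduct with symbol `b`. -/
def paraTerm (b : ∀ I : F.lattice, F.diffSpace I) (I : F.lattice) (f : X → ℝ) : X → ℝ :=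
  fun x => (⨍ y in (I : Set X), f y ∂μ) * (b I : X → ℝ) x

/-- A weight: a nonnegative measurable function, integrable over every atom. -/
structure IsWeight (u : X → ℝ) : Prop where
  measurable : Measurable u
  nonneg : ∀ x, 0 ≤ u x
  integrableOn : ∀ I ∈ F.lattice, IntegrableOn u I μ

end AtomicFiltration

/-- The normalized distribution function `N_I(t) = |I|⁻¹ |{x ∈ I : u(x) > t}|`. -/
def distribFn {X : Type*} [MeasurableSpace X] (μ : Measure X) (I : Set X) (u : X → ℝ) (t : ℝ) : ℝ :=
  μ.real {x ∈ I | t < u x} / μ.real I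

/-- The function `ψ₀(s) = s ln(e/s)`, with `ψ₀(0) = 0`. -/
def psiZero (s : ℝ) : ℝ := s * Real.log (Real.exp 1 / s)

/-- The `L log L` norm of `u ≥ 0` on `I` with respect to the normalized measure `dx/|I|`, that is,
the norm of the Lorentz space `Λ_{ψ₀}`: `u*_I = ∫_0^∞ ψ₀(N_I(t)) dt`, possibly infinite. -/
def llogl {X : Type*} [MeasurableSpace X] (μ : Measure X) (I : Set X) (u : X → ℝ) : ℝ≥0∞ :=
  ∫⁻ t in Ioi (0 : ℝ), ENNReal.ofReal (psiZero (distribFn μ I u t))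

open Classical in
/-- The entropy bump `α(u*_I / u_I) u*_I`, where `u_I = ⟨u⟩_I`. It is `∞` if `u*_I = ∞`, and `0` if
`u = 0` almost everywhere on `I`. -/
def entropyBump {X : Type*} [MeasurableSpace X] (μ : Measure X) (α : ℝ → ℝ) (I : Set X)
    (u : X → ℝ) : ℝ≥0∞ :=
  if llogl μ I u = ∞ then ∞
  else ENNReal.ofReal (α ((llogl μ I u).toReal / ⨍ x in I, u x ∂μ)) * llogl μ I u

/-- `α : [1, ∞) → (0, ∞)` is such that `t ↦ t α(t)` is increasing and `∫_1^∞ dt / (t α(t)) < ∞`. -/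
structure IsPenalty (α : ℝ → ℝ) : Prop where
  pos : ∀ t, 1 ≤ t → 0 < α t
  mono : MonotoneOn (fun t => t * α t) (Ici 1)
  integrable : IntegrableOn (fun t => 1 / (t * α t)) (Ioi 1)

/-- `C_α = 1/α(1) + ∫_1^∞ dt / (t α(t))`. -/
def penaltyConst (α : ℝ → ℝ) : ℝ := 1 / α 1 + ∫ t in Ioi (1 : ℝ), 1 / (t * α t)

/-- The measure `u dμ`. -/
def weighted {X : Type*} [MeasurableSpace X] (μ : Measure X) (u : X → ℝ) : Measure X :=
  μ.withDensity fun x => ENNReal.ofReal (u x)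

/-- For the operator `T = ∑_{i ∈ ι} T_i` with terms `T_i = term i`: for every `f ∈ L²(u)` the series
`T(fu) = ∑ T_i(fu)` converges unconditionally in `L²(v)`, and its sum `g` satisfies
`∫ |g|² v dμ ≤ C ∫ |f|² u dμ`. -/
def TwoWeightBound {X : Type*} [MeasurableSpace X] (μ : Measure X) {ι : Type*}
    (term : ι → (X → ℝ) → X → ℝ) (u v : X → ℝ) (C : ℝ) : Prop :=
  ∀ f : X → ℝ, MemLp f 2 (weighted μ u) →
    ∃ g : X → ℝ, MemLp g 2 (weighted μ v) ∧
      (∀ i, MemLp (term i fun y => f y * u y) 2 (weighted μ v)) ∧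
      Tendsto (fun s : Finset ι =>
        eLpNorm (fun x => g x - ∑ i ∈ s, term i (fun y => f y * u y) x) 2 (weighted μ v))
        atTop (𝓝 0) ∧
      ∫ x, g x ^ 2 * v x ∂μ ≤ C * ∫ x, f x ^ 2 * u x ∂μ

end

/-!
Paired with a test function `h`, each term of `T f` is at most `P_I(f) R_I(h) / |I|` up to a
constant, where each of `P_I(f)` and `R_I(f)` is either `‖Δ_I f‖₁` or `|I| |⟨f⟩_I|` times the square
root of a Carleson coefficient relative to `|I|`. Inserting the entropy bumps and using
Cauchy–Schwarz, the bump condition splits the two-weight estimate into one-weight embeddings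
`∑_I P_I(fu)² / (|I| α(u*_I / u_I) u*_I) ≲ C_α ‖f‖²_{L²(u)}`, one for `u` and one for `v`.

With `⟨f⟩_{I,u}` the average with respect to `u dμ`, one has `⟨fu⟩_I = ⟨u⟩_I ⟨f⟩_{I,u}`, while
`‖Δ_I (fu)‖₁` is controlled by `|⟨f⟩_{I,u}| ‖Δ_I u‖₁` and the `u dμ`-martingale difference of `f`.
Split the atoms according to `u*_I / u_I ∼ 2^j`; the resulting sum of `1 / α(2^j)` is bounded
by `C_α`. At each level the martingale differences are orthogonal, and the remaining sums are
bounded by the Carleson embedding theorem for `u dμ`.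

The Carleson conditions read `∑_{J ⊆ I} ‖Δ_J u‖₁² / u(J) ≲ |I| u*_I` and, for Carleson coefficients
`c`, `∑_{J ⊆ I} c_J ⟨u⟩_J ≲ |I| u*_I`. Their left-hand sides are subadditive under the decomposition
of `u` into its level sets `{u > t}`, so it is enough to treat `u = 1_E`, with right-hand side
`|I| ψ₀(|I ∩ E| / |I|)`: for the differences, the entropy of the density of `E` gains at least a
Pinsker divergence in passing to the children. Integrating in `t` turns `ψ₀` into `u*_I`.
-/

noncomputable section

namespace AtomicFiltration

variable {X : Type*} [MeasurableSpace X] {μ : Measure X} (F : AtomicFiltration μ)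

section Lattice

theorem mem_lattice {I : Set X} : I ∈ F.lattice ↔ ∃ n, I ∈ F.atoms n := mem_iUnion

theorem measure_pos_of_mem_lattice {I : Set X} (hI : I ∈ F.lattice) : 0 < μ I := by
  obtain ⟨n, hn⟩ := F.mem_lattice.1 hI
  exact F.measure_pos n I hn

theorem nonempty_of_mem_lattice {I : Set X} (hI : I ∈ F.lattice) : I.Nonempty :=
  nonempty_of_measure_ne_zero (F.measure_pos_of_mem_lattice hI).ne'

theorem measureReal_pos_of_mem_lattice {I : Set X} (hI : I ∈ F.lattice) : 0 < μ.real I :=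
  ENNReal.toReal_pos (F.measure_pos_of_mem_lattice hI).ne' (F.measure_lt_top_of_mem_lattice hI).ne

theorem countable_lattice : F.lattice.Countable := countable_iUnion F.countable_atoms

instance : Countable F.lattice := F.countable_lattice.to_subtype

theorem exists_mem_atoms_mem (n : ℤ) (x : X) : ∃ I ∈ F.atoms n, x ∈ I := by
  obtain ⟨S, hS, h⟩ := F.atomic n univ MeasurableSet.univ
  obtain ⟨I, hI, hxI⟩ : x ∈ ⋃₀ S := h ▸ mem_univ x
  exact ⟨I, hS hI, hxI⟩

theorem subset_of_mem_atoms_of_le {m n : ℤ} (hnm : n ≤ m) {I J : Set X} (hI : I ∈ F.atoms n)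
    (hJ : J ∈ F.atoms m) (hIJ : (I ∩ J).Nonempty) : J ⊆ I := by
  obtain ⟨x, hxI, hxJ⟩ := hIJ
  obtain ⟨S, hS, h⟩ := F.atomic m I (F.sigma.mono hnm I (F.measurable_atoms n I hI))
  rw [h] at hxI ⊢
  obtain ⟨L, hL, hxL⟩ := hxI
  obtain rfl : L = J := (F.disjoint_atoms m).elim_set (hS hL) hJ x hxL hxJ
  exact subset_sUnion_of_mem hL

theorem subset_or_subset_of_inter_nonempty {I J : Set X} (hI : I ∈ F.lattice) (hJ : J ∈ F.lattice)
    (hIJ : (I ∩ J).Nonempty) : I ⊆ J ∨ J ⊆ I := by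
  obtain ⟨n, hn⟩ := F.mem_lattice.1 hI
  obtain ⟨m, hm⟩ := F.mem_lattice.1 hJ
  rcases le_total n m with h | h
  · exact Or.inr (F.subset_of_mem_atoms_of_le h hn hm hIJ)
  · exact Or.inl (F.subset_of_mem_atoms_of_le h hm hn (inter_comm I J ▸ hIJ))

theorem isGreatest_of_notMem_succ {n : ℤ} {I : Set X} (hI : I ∈ F.atoms n)
    (h : I ∉ F.atoms (n + 1)) : IsGreatest {k : ℤ | I ∈ F.atoms k} n := by
  refine ⟨hI, fun k hk => ?_⟩
  by_contra! hnk
  obtain ⟨x, hx⟩ := F.nonempty_of_mem_lattice (F.mem_lattice.2 ⟨n, hI⟩)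
  obtain ⟨L, hL, hxL⟩ := F.exists_mem_atoms_mem (n + 1) x
  have hLI : L ⊆ I := F.subset_of_mem_atoms_of_le (by lia) hI hL ⟨x, hx, hxL⟩
  have hIL : I ⊆ L := F.subset_of_mem_atoms_of_le (by lia) hL hk ⟨x, hxL, hx⟩
  exact h (hLI.antisymm hIL ▸ hL)

end Lattice

section Children

theorem subset_of_mem_children {I J : Set X} (hJ : J ∈ F.children I) : J ⊆ I := by
  rcases hJ with ⟨n, -, -, h⟩ | ⟨rfl, -⟩
  exacts [h, subset_rfl]

theorem exists_isGreatest_or_mem_children_self {I : Set X} (hI : I ∈ F.lattice) :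
    (∃ n, IsGreatest {k : ℤ | I ∈ F.atoms k} n) ∨ I ∈ F.children I := by
  by_cases h : ∃ n, IsGreatest {k : ℤ | I ∈ F.atoms k} n
  · exact Or.inl h
  · obtain ⟨n, hn⟩ := F.mem_lattice.1 hI
    refine Or.inr (Or.inr ⟨rfl, (eventually_ge_atTop n).mono fun k hk => ?_⟩)
    induction k, hk using Int.leInduction with
    | base => exact hn
    | succ k _ ih => exact by_contra fun h' => h ⟨k, F.isGreatest_of_notMem_succ ih h'⟩

theorem mem_atoms_succ_of_mem_children {I J : Set X} {n : ℤ}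
    (hn : IsGreatest {k : ℤ | I ∈ F.atoms k} n) (hJ : J ∈ F.children I) :
    J ∈ F.atoms (n + 1) := by
  rcases hJ with ⟨m, hm, hJ, -⟩ | ⟨rfl, hJ⟩
  · exact hm.unique hn ▸ hJ
  · obtain ⟨k, hk, hnk⟩ := (hJ.and (eventually_gt_atTop n)).exists
    exact absurd (hn.2 hk) (not_le.2 hnk)

theorem eq_of_subset_of_mem_children_self {I J : Set X} (hI : I ∈ F.children I)
    (hJ : J ∈ F.lattice) (hJI : J ⊆ I) : J = I := by
  rcases hI with ⟨n, hn, hI, -⟩ | ⟨-, hI⟩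
  · exact absurd (hn.2 hI) (by lia)
  · obtain ⟨m, hm⟩ := F.mem_lattice.1 hJ
    obtain ⟨k, hk, hmk⟩ := (hI.and (eventually_ge_atTop m)).exists
    obtain ⟨x, hx⟩ := F.nonempty_of_mem_lattice hJ
    exact hJI.antisymm (F.subset_of_mem_atoms_of_le hmk hm hk ⟨x, hx, hJI hx⟩)

theorem exists_mem_children_mem {I : Set X} (hI : I ∈ F.lattice) {x : X} (hx : x ∈ I) :
    ∃ J ∈ F.children I, x ∈ J := by
  rcases F.exists_isGreatest_or_mem_children_self hI with ⟨n, hn⟩ | h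
  · obtain ⟨L, hL, hxL⟩ := F.exists_mem_atoms_mem (n + 1) x
    exact ⟨L, Or.inl ⟨n, hn, hL,
      F.subset_of_mem_atoms_of_le (by lia) hn.1 hL ⟨x, hx, hxL⟩⟩, hxL⟩
  · exact ⟨I, h, hx⟩

theorem exists_mem_children_subset {I J : Set X} (hI : I ∈ F.lattice) (hJ : J ∈ F.lattice)
    (hJI : J ⊂ I) : ∃ K ∈ F.children I, J ⊆ K := by
  obtain ⟨x, hx⟩ := F.nonempty_of_mem_lattice hJ
  obtain ⟨K, hK, hxK⟩ := F.exists_mem_children_mem hI (hJI.1 hx)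
  refine ⟨K, hK, ?_⟩
  rcases F.exists_isGreatest_or_mem_children_self hI with ⟨n, hn⟩ | h
  · obtain ⟨m, hm⟩ := F.mem_lattice.1 hJ
    have hnm : n < m := by
      by_contra! hmn
      exact hJI.2 (F.subset_of_mem_atoms_of_le hmn hm hn.1 ⟨x, hx, hJI.1 hx⟩)
    exact F.subset_of_mem_atoms_of_le hnm (F.mem_atoms_succ_of_mem_children hn hK) hm ⟨x, hxK, hx⟩
  · exact absurd (F.eq_of_subset_of_mem_children_self h hJ hJI.1) hJI.ne

theorem iUnion_children {I : Set X} (hI : I ∈ F.lattice) :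
    ⋃ J : F.children I, (J : Set X) = I := by
  refine Subset.antisymm (iUnion_subset fun J => F.subset_of_mem_children J.2) fun x hx => ?_
  obtain ⟨J, hJ, hxJ⟩ := F.exists_mem_children_mem hI hx
  exact mem_iUnion.2 ⟨⟨J, hJ⟩, hxJ⟩

instance countable_children (I : Set X) : Countable (F.children I) :=
  (F.countable_lattice.mono fun _ hJ => F.mem_lattice_of_mem_children hJ).to_subtype

theorem pairwise_disjoint_children (I : Set X) :
    Pairwise (Function.onFun Disjoint fun J : F.children I => (J : Set X)) := fun J K h =>
  F.disjoint_children J.2 K.2 fun h' => h (Subtype.ext h')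

theorem measurableSet_child {I : Set X} (J : F.children I) : MeasurableSet (J : Set X) :=
  F.measurableSet_of_mem_lattice (F.mem_lattice_of_mem_children J.2)

theorem tsum_measure_children {I : Set X} (hI : I ∈ F.lattice) (ν : Measure X) :
    ∑' J : F.children I, ν (J : Set X) = ν I := by
  rw [← measure_iUnion (F.pairwise_disjoint_children I) F.measurableSet_child,
    F.iUnion_children hI]

theorem tsum_lintegral_children {I : Set X} (hI : I ∈ F.lattice) (ν : Measure X)
    (f : X → ℝ≥0∞) : ∑' J : F.children I, ∫⁻ x in (J : Set X), f x ∂ν = ∫⁻ x in I, f x ∂ν := by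
  rw [← lintegral_iUnion F.measurableSet_child (F.pairwise_disjoint_children I),
    F.iUnion_children hI]

theorem hasSum_integral_children {I : Set X} (hI : I ∈ F.lattice) {ν : Measure X} {f : X → ℝ}
    (hf : IntegrableOn f I ν) :
    HasSum (fun J : F.children I => ∫ x in (J : Set X), f x ∂ν) (∫ x in I, f x ∂ν) := by
  have h := hasSum_integral_iUnion F.measurableSet_child (F.pairwise_disjoint_children I)
    (by rwa [F.iUnion_children hI])
  rwa [F.iUnion_children hI] at h

end Children

section SumBelow

/-- The sum of `c J` over the atoms `J ⊆ I`. -/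
def sumBelow (c : F.lattice → ℝ≥0∞) (I : Set X) : ℝ≥0∞ :=
  ∑' J : {J : F.lattice // (J : Set X) ⊆ I}, c J

/-- The Carleson packing condition with majorant `B`: the sums of `c` over the atoms below `I` are
bounded by `B I`. The classical condition is the case `B = C • μ`. -/
def CarlesonBound (c : F.lattice → ℝ≥0∞) (B : Set X → ℝ≥0∞) : Prop :=
  ∀ I : F.lattice, F.sumBelow c I ≤ B I

variable {F}

theorem le_sumBelow (c : F.lattice → ℝ≥0∞) (I : F.lattice) : c I ≤ F.sumBelow c I :=
  ENNReal.le_tsum (f := fun J : {J : F.lattice // (J : Set X) ⊆ I} => c J) ⟨I, subset_rfl⟩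

theorem CarlesonBound.le {c : F.lattice → ℝ≥0∞} {B : Set X → ℝ≥0∞} (h : F.CarlesonBound c B)
    (I : F.lattice) : c I ≤ B I :=
  (le_sumBelow c I).trans (h I)

theorem sumBelow_eq_tsum_indicator (c : F.lattice → ℝ≥0∞) (I : Set X) :
    F.sumBelow c I = ∑' J : F.lattice, {J : F.lattice | (J : Set X) ⊆ I}.indicator c J :=
  tsum_subtype {J : F.lattice | (J : Set X) ⊆ I} c

theorem sumBelow_eq_of_forall_ssubset {c : F.lattice → ℝ≥0∞} {I : F.lattice}
    (h : ∀ J : F.lattice, (J : Set X) ⊂ I → c J = 0) : F.sumBelow c I = c I :=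
  tsum_eq_single (⟨I, subset_rfl⟩ : {J : F.lattice // (J : Set X) ⊆ I}) fun J hJ =>
    h J (J.2.ssubset_of_ne fun h' => hJ (Subtype.ext (Subtype.ext h')))

theorem sumBelow_eq_of_mem_children_self {I : F.lattice} (hI : (I : Set X) ∈ F.children I)
    (c : F.lattice → ℝ≥0∞) : F.sumBelow c I = c I :=
  sumBelow_eq_of_forall_ssubset fun J hJ =>
    absurd (F.eq_of_subset_of_mem_children_self hI J.2 hJ.1) hJ.ne

theorem sumBelow_eq_add_tsum_children {I : F.lattice} (hI : (I : Set X) ∉ F.children I)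
    (c : F.lattice → ℝ≥0∞) :
    F.sumBelow c I = c I + ∑' K : F.children I, F.sumBelow c K := by
  classical
  simp only [sumBelow_eq_tsum_indicator]
  rw [ENNReal.tsum_comm, ← tsum_ite_eq I fun _ => c I, ← ENNReal.tsum_add]
  refine tsum_congr fun J => ?_
  by_cases hJI : J ≤ I
  · rcases Set.eq_or_ssubset_of_subset hJI with h | h
    · obtain rfl : J = I := Subtype.ext h
      have hJK : ∀ K : F.children J, ¬(J : Set X) ⊆ K := fun K hJK =>
        hI (mem_of_eq_of_mem (hJK.antisymm (F.subset_of_mem_children K.2)) K.2)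
      simp [hJK]
    · have hne : J ≠ I := fun h' => h.ne (congrArg _ h')
      obtain ⟨K, hK, hJK⟩ := F.exists_mem_children_subset I.2 J.2 h
      rw [tsum_eq_single (⟨K, hK⟩ : F.children I)]
      · simp [indicator, hJI, hne, hJK]
      · refine fun L hL => indicator_of_notMem (fun hJL => ?_) c
        obtain ⟨x, hx⟩ := F.nonempty_of_mem_lattice J.2
        exact Set.disjoint_left.1 (F.pairwise_disjoint_children I hL) (hJL hx) (hJK hx)
  · have hne : J ≠ I := fun h => hJI h.le
    have hJK : ∀ K : F.children I, ¬(J : Set X) ⊆ K := fun K h =>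
      hJI (h.trans (F.subset_of_mem_children K.2))
    simp [indicator, hJI, hne, hJK]

theorem sumBelow_le_of_superadditive_of_bddAbove {c : F.lattice → ℝ≥0∞} {B : Set X → ℝ≥0∞}
    (hcB : ∀ I : F.lattice, c I ≤ B I)
    (h : ∀ I : F.lattice, (I : Set X) ∉ F.children I → c I + ∑' K : F.children I, B K ≤ B I)
    {N : ℤ} (hN : ∀ J : F.lattice, c J ≠ 0 → ∃ k ≤ N, (J : Set X) ∈ F.atoms k) (I : F.lattice) :
    F.sumBelow c I ≤ B I := by
  have key : ∀ (d : ℕ) (n : ℤ) (I : F.lattice), N ≤ n + d → (I : Set X) ∈ F.atoms n →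
      F.sumBelow c I ≤ B I := by
    intro d
    induction d with
    | zero =>
      intro n I hNn hI
      refine (sumBelow_eq_of_forall_ssubset fun J hJI => ?_).trans_le (hcB I)
      by_contra hJ
      obtain ⟨k, hk, hJk⟩ := hN J hJ
      obtain ⟨x, hx⟩ := F.nonempty_of_mem_lattice J.2
      exact hJI.2 (F.subset_of_mem_atoms_of_le (by lia) hJk hI ⟨x, hx, hJI.1 hx⟩)
    | succ d ih =>
      intro n I hNn hI
      by_cases hII : (I : Set X) ∈ F.children I
      · exact (sumBelow_eq_of_mem_children_self hII c).trans_le (hcB I)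
      · obtain ⟨m, hm⟩ := (F.exists_isGreatest_or_mem_children_self I.2).resolve_right hII
        have hnm : n ≤ m := hm.2 hI
        rw [sumBelow_eq_add_tsum_children hII]
        refine le_trans ?_ (h I hII)
        gcongr with K
        exact ih (m + 1) ⟨K, F.mem_lattice_of_mem_children K.2⟩ (by push_cast at hNn; lia)
          (F.mem_atoms_succ_of_mem_children hm K.2)
  obtain ⟨n, hn⟩ := F.mem_lattice.1 I.2
  exact key (N - n).toNat n I (by lia) hn

theorem carlesonBound_of_superadditive {c : F.lattice → ℝ≥0∞} {B : Set X → ℝ≥0∞}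
    (hcB : ∀ I : F.lattice, c I ≤ B I)
    (h : ∀ I : F.lattice, (I : Set X) ∉ F.children I → c I + ∑' K : F.children I, B K ≤ B I) :
    F.CarlesonBound c B := by
  intro I
  choose gen hgen using fun J : F.lattice => F.mem_lattice.1 J.2
  rw [sumBelow, ENNReal.tsum_eq_iSup_sum]
  refine iSup_le fun s => ?_
  obtain ⟨N, hN⟩ := (s.image fun J => gen J.1).bddAbove
  set t : Set F.lattice := Subtype.val '' (s : Set {J : F.lattice // (J : Set X) ⊆ I})
  have hct : ∀ J, t.indicator c J ≤ c J := indicator_le_self t c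
  calc ∑ J ∈ s, c J = ∑ J ∈ s, t.indicator c J := Finset.sum_congr rfl fun J hJ =>
        (indicator_of_mem (mem_image_of_mem _ hJ) c).symm
    _ ≤ F.sumBelow (t.indicator c) I := ENNReal.sum_le_tsum s
    _ ≤ B I := by
        refine sumBelow_le_of_superadditive_of_bddAbove (fun J => (hct J).trans (hcB J))
          (fun J hJ => le_trans (by gcongr; exact hct J) (h J hJ)) (N := N) (fun J hJ => ?_) I
        obtain ⟨L, hL, rfl⟩ := mem_of_indicator_ne_zero hJ
        exact ⟨gen L, hN (Finset.mem_image_of_mem _ hL), hgen L⟩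

theorem CarlesonBound.mono {c c' : F.lattice → ℝ≥0∞} {B B' : Set X → ℝ≥0∞}
    (h : F.CarlesonBound c B) (hc : ∀ J, c' J ≤ c J) (hB : ∀ I : F.lattice, B I ≤ B' I) :
    F.CarlesonBound c' B' := fun I =>
  (ENNReal.tsum_le_tsum fun J : {J : F.lattice // (J : Set X) ⊆ I} => hc J).trans
    ((h I).trans (hB I))

theorem CarlesonBound.lintegral {Y : Type*} [MeasurableSpace Y] {ρ : Measure Y}
    {c : Y → F.lattice → ℝ≥0∞} {B : Y → Set X → ℝ≥0∞} (hc : ∀ J, AEMeasurable (fun t => c t J) ρ)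
    (h : ∀ᵐ t ∂ρ, F.CarlesonBound (c t) (B t)) :
    F.CarlesonBound (fun J => ∫⁻ t, c t J ∂ρ) fun I => ∫⁻ t, B t I ∂ρ := fun I =>
  (lintegral_tsum fun J : {J : F.lattice // (J : Set X) ⊆ I} => hc J).symm.trans_le
    (lintegral_mono_ae (h.mono fun _ ht => ht I))

theorem sum_le_sumBelow (c : F.lattice → ℝ≥0∞) {I : Set X} {s : Finset F.lattice}
    (hs : ∀ J ∈ s, (J : Set X) ⊆ I) : ∑ J ∈ s, c J ≤ F.sumBelow c I := by
  rw [sumBelow_eq_tsum_indicator]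
  exact (Finset.sum_congr rfl fun J hJ => (indicator_of_mem (hs J hJ) c).symm).trans_le
    (ENNReal.sum_le_tsum s)

end SumBelow

section Cover

variable {F}

theorem exists_pairwiseDisjoint_cover (s : Finset F.lattice) :
    ∃ m ⊆ s, (m : Set F.lattice).PairwiseDisjoint (fun I => (I : Set X)) ∧
      ∀ J ∈ s, ∃ I ∈ m, J ≤ I := by
  classical
  refine ⟨s.filter fun I => Maximal (· ∈ s) I, Finset.filter_subset _ _, ?_, ?_⟩
  · intro I hI J hJ hne
    simp only [Finset.coe_filter, mem_ofPred_eq] at hI hJ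
    refine Set.disjoint_iff_inter_eq_empty.2 (not_nonempty_iff_eq_empty.1 fun hIJ => hne ?_)
    rcases F.subset_or_subset_of_inter_nonempty I.2 J.2 hIJ with h | h
    · exact hI.2.eq_of_le hJ.1 h
    · exact (hJ.2.eq_of_le hI.1 h).symm
  · intro J hJ
    obtain ⟨I, hJI, hI⟩ := s.exists_le_maximal hJ
    exact ⟨I, Finset.mem_filter.2 ⟨hI.1, hI⟩, hJI⟩

theorem sum_measure_le_measure_biUnion {m s : Finset F.lattice} (hms : m ⊆ s)
    (hm : (m : Set F.lattice).PairwiseDisjoint (fun I => (I : Set X))) (ν : Measure X) :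
    ∑ I ∈ m, ν I ≤ ν (⋃ J ∈ s, J) := by
  rw [← measure_biUnion_finset hm fun I _ => F.measurableSet_of_mem_lattice I.2]
  exact measure_mono (biUnion_subset_biUnion_left hms)

theorem sum_le_measure_biUnion {c : F.lattice → ℝ≥0∞} {ν : Measure X} {s : Finset F.lattice}
    (h : ∀ I ∈ s, F.sumBelow c I ≤ ν I) : ∑ J ∈ s, c J ≤ ν (⋃ J ∈ s, J) := by
  classical
  obtain ⟨m, hms, hdisj, hcov⟩ := exists_pairwiseDisjoint_cover s
  choose! g hg hgs using hcov
  calc ∑ J ∈ s, c J = ∑ I ∈ m, ∑ J ∈ s with g J = I, c J :=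
        (Finset.sum_fiberwise_of_maps_to hg c).symm
    _ ≤ ∑ I ∈ m, ν I := by
        refine Finset.sum_le_sum fun I hI => (sum_le_sumBelow c fun J hJ => ?_).trans (h I (hms hI))
        obtain ⟨hJs, rfl⟩ := Finset.mem_filter.1 hJ
        exact hgs J hJs
    _ ≤ ν (⋃ J ∈ s, J) := sum_measure_le_measure_biUnion hms hdisj ν

theorem sumBelow_indicator_le {c : F.lattice → ℝ≥0∞} {ν : Measure X} {G : Set F.lattice}
    (hc : ∀ J ∈ G, F.sumBelow c J ≤ ν J) {I : F.lattice} {B : ℝ≥0∞}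
    (hB : ∀ s : Finset F.lattice, (∀ J ∈ s, (J : Set X) ⊆ I ∧ J ∈ G) → ν (⋃ J ∈ s, J) ≤ B) :
    F.sumBelow (G.indicator c) I ≤ B := by
  classical
  rw [sumBelow_eq_tsum_indicator, ENNReal.tsum_eq_iSup_sum]
  refine iSup_le fun s => ?_
  rw [indicator_indicator]
  simp only [indicator_apply]
  rw [← Finset.sum_filter]
  have hs : ∀ J ∈ s.filter (· ∈ {J : F.lattice | (J : Set X) ⊆ I} ∩ G), (J : Set X) ⊆ I ∧ J ∈ G :=
    fun J hJ => (Finset.mem_filter.1 hJ).2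
  exact (sum_le_measure_biUnion fun J hJ => hc J (hs J hJ).2).trans (hB _ hs)

theorem CarlesonBound.tsum_le_measure_univ {c : F.lattice → ℝ≥0∞} {ν : Measure X}
    (h : F.CarlesonBound c ν) : ∑' J, c J ≤ ν univ := by
  rw [ENNReal.tsum_eq_iSup_sum]
  exact iSup_le fun s =>
    (sum_le_measure_biUnion fun I _ => h I).trans (measure_mono (subset_univ _))

theorem measure_biUnion_le_of_forall_le {ν ρ : Measure X} {s : Finset F.lattice}
    (h : ∀ J ∈ s, ν J ≤ ρ J) : ν (⋃ J ∈ s, J) ≤ ρ (⋃ J ∈ s, J) := by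
  obtain ⟨m, hms, hdisj, hcov⟩ := exists_pairwiseDisjoint_cover s
  calc ν (⋃ J ∈ s, J) ≤ ν (⋃ I ∈ m, I) := by
        refine measure_mono (iUnion₂_subset fun J hJ => ?_)
        obtain ⟨I, hI, hJI⟩ := hcov J hJ
        exact Subset.trans hJI (subset_biUnion_of_mem (u := fun I : F.lattice => (I : Set X)) hI)
    _ ≤ ∑ I ∈ m, ν I := measure_biUnion_finset_le _ _
    _ ≤ ∑ I ∈ m, ρ I := Finset.sum_le_sum fun I hI => h I (hms hI)
    _ ≤ ρ (⋃ J ∈ s, J) := sum_measure_le_measure_biUnion hms hdisj ρ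

end Cover

end AtomicFiltration

section CauchySchwarz

theorem lintegral_mul_sq_le {Y : Type*} [MeasurableSpace Y] {ρ : Measure Y} {a b : Y → ℝ≥0∞}
    (ha : AEMeasurable a ρ) (hb : AEMeasurable b ρ) :
    (∫⁻ y, a y * b y ∂ρ) ^ 2 ≤ (∫⁻ y, a y ^ 2 ∂ρ) * ∫⁻ y, b y ^ 2 ∂ρ := by
  have h := ENNReal.lintegral_mul_le_Lp_mul_Lq ρ Real.HolderConjugate.two_two ha hb
  simp only [Pi.mul_apply, ENNReal.rpow_two] at h
  rw [← ENNReal.mul_rpow_of_nonneg _ _ (by norm_num)] at h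
  calc (∫⁻ y, a y * b y ∂ρ) ^ 2
      ≤ (((∫⁻ y, a y ^ 2 ∂ρ) * ∫⁻ y, b y ^ 2 ∂ρ) ^ (1 / 2 : ℝ)) ^ 2 := by gcongr
    _ = _ := by rw [← ENNReal.rpow_two, ← ENNReal.rpow_mul]; norm_num

theorem lintegral_sq_le_lintegral_sq_div_mul {Y : Type*} [MeasurableSpace Y] {ρ : Measure Y}
    {a b : Y → ℝ≥0∞} (ha : AEMeasurable a ρ) (hb : AEMeasurable b ρ)
    (hab : ∀ y, b y = 0 → a y = 0) (hb' : ∀ y, b y ≠ ∞) :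
    (∫⁻ y, a y ∂ρ) ^ 2 ≤ (∫⁻ y, a y ^ 2 / b y ∂ρ) * ∫⁻ y, b y ∂ρ := by
  have hsq : ∀ y, (b y ^ (1 / 2 : ℝ)) ^ 2 = b y := fun y => by
    rw [← ENNReal.rpow_two, ← ENNReal.rpow_mul]; norm_num
  have hcancel : ∀ y, a y / b y ^ (1 / 2 : ℝ) * b y ^ (1 / 2 : ℝ) = a y := fun y => by
    rcases eq_or_ne (b y) 0 with h0 | h0
    · simp [hab y h0]
    · refine ENNReal.div_mul_cancel ?_ ?_
      · simp [ENNReal.rpow_eq_zero_iff, h0, hb' y]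
      · simp [ENNReal.rpow_eq_top_iff, h0, hb' y]
  have hdiv : ∀ y, (a y / b y ^ (1 / 2 : ℝ)) ^ 2 = a y ^ 2 / b y := fun y => by
    rw [div_eq_mul_inv, mul_pow, ← ENNReal.inv_pow, hsq, ← div_eq_mul_inv]
  simpa only [Pi.div_apply, hcancel, hdiv, hsq] using
    lintegral_mul_sq_le (ha.div (hb.pow_const (1 / 2 : ℝ))) (hb.pow_const (1 / 2 : ℝ))

theorem tsum_mul_sq_le {ι : Type*} (a b : ι → ℝ≥0∞) :
    (∑' i, a i * b i) ^ 2 ≤ (∑' i, a i ^ 2) * ∑' i, b i ^ 2 := by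
  let _ : MeasurableSpace ι := ⊤
  simpa only [lintegral_count] using
    lintegral_mul_sq_le (ρ := Measure.count) measurable_from_top.aemeasurable
      measurable_from_top.aemeasurable (a := a) (b := b)

theorem tsum_sq_le_tsum_sq_div_mul {ι : Type*} {a b : ι → ℝ≥0∞}
    (hab : ∀ i, b i = 0 → a i = 0) (hb : ∀ i, b i ≠ ∞) :
    (∑' i, a i) ^ 2 ≤ (∑' i, a i ^ 2 / b i) * ∑' i, b i := by
  let _ : MeasurableSpace ι := ⊤
  simpa only [lintegral_count] using
    lintegral_sq_le_lintegral_sq_div_mul (ρ := Measure.count) measurable_from_top.aemeasurable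
      measurable_from_top.aemeasurable hab hb

theorem setLIntegral_sq_le {Y : Type*} [MeasurableSpace Y] {ρ : Measure Y} {f : Y → ℝ≥0∞}
    (hf : AEMeasurable f ρ) (s : Set Y) :
    (∫⁻ y in s, f y ∂ρ) ^ 2 ≤ (∫⁻ y in s, f y ^ 2 ∂ρ) * ρ s := by
  simpa using lintegral_mul_sq_le hf.restrict (aemeasurable_const (b := (1 : ℝ≥0∞)))

end CauchySchwarz

section CarlesonEmbedding

theorem div_sq_add_four_div_le {c m N : ℝ≥0∞} (hN : N ≠ ∞) (h : c + m ≤ N) :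
    c / N ^ 2 + 4 / (N + (c + m)) ≤ 4 / (N + m) := by
  have hm : m ≠ ∞ := ne_top_of_le_ne_top hN (le_add_self.trans h)
  have hc : c ≠ ∞ := ne_top_of_le_ne_top hN (le_self_add.trans h)
  rcases eq_or_ne N 0 with rfl | hN0
  · obtain ⟨rfl, rfl⟩ := add_eq_zero.1 (nonpos_iff_eq_zero.1 h)
    simp
  lift N to ℝ≥0 using hN
  lift c to ℝ≥0 using hc
  lift m to ℝ≥0 using hm
  have hNpos : 0 < N := pos_iff_ne_zero.2 (by simpa using hN0)
  have key : c / N ^ 2 + 4 / (N + (c + m)) ≤ 4 / (N + m) := by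
    replace h : (c : ℝ) + m ≤ N := mod_cast h
    have : (0 : ℝ) < N := mod_cast hNpos
    rw [← NNReal.coe_le_coe]
    push_cast
    calc (c : ℝ) / N ^ 2 + 4 / (N + (c + m))
        = 4 * c / ((2 * N) * (2 * N)) + 4 / (N + (c + m)) := by field_simp; ring
      _ ≤ 4 * c / ((N + m) * (N + (c + m))) + 4 / (N + (c + m)) := by
          gcongr <;> linarith [c.coe_nonneg, m.coe_nonneg]
      _ = 4 / (N + m) := by field_simp; ring
  have := ENNReal.coe_le_coe.2 key
  rwa [ENNReal.coe_add, ENNReal.coe_div (by positivity), ENNReal.coe_div (by positivity),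
    ENNReal.coe_div (by positivity), ENNReal.coe_pow, ENNReal.coe_add, ENNReal.coe_add,
    ENNReal.coe_add] at this

namespace AtomicFiltration

variable {X : Type*} [MeasurableSpace X] {μ : Measure X} {F : AtomicFiltration μ}
  {ν : Measure X} {c : F.lattice → ℝ≥0∞} {f : X → ℝ≥0∞}

variable (F) in
/-- The subtracted part of the Bellman function
`4 (∫_I f² dν - (∫_I f dν)² / (ν(I) + ∑_{J ⊆ I} c_J))` of the Carleson embedding theorem. -/
def bellmanDefect (ν : Measure X) (c : F.lattice → ℝ≥0∞) (f : X → ℝ≥0∞) (I : Set X) : ℝ≥0∞ :=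
  4 / (ν I + F.sumBelow c I) * (∫⁻ x in I, f x ∂ν) ^ 2

theorem mul_setLAverage_sq (a : ℝ≥0∞) (I : Set X) :
    a * (⨍⁻ x in I, f x ∂ν) ^ 2 = a / ν I ^ 2 * (∫⁻ x in I, f x ∂ν) ^ 2 := by
  rw [setLAverage_eq, div_eq_mul_inv, div_eq_mul_inv, mul_pow, ENNReal.inv_pow]
  ring

theorem CarlesonBound.mul_laverage_sq_add_bellmanDefect_le_setLIntegral
    (hc : F.CarlesonBound c ν) (hf : AEMeasurable f ν) (I : F.lattice) (hI : ν I ≠ ∞) :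
    c I * (⨍⁻ x in I, f x ∂ν) ^ 2 + F.bellmanDefect ν c f I ≤ 4 * ∫⁻ x in I, f x ^ 2 ∂ν := by
  have hbellman := div_sq_add_four_div_le hI ((add_zero (F.sumBelow c I)).trans_le (hc I))
  rw [add_zero, add_zero] at hbellman
  rw [mul_setLAverage_sq, bellmanDefect, ← add_mul]
  calc (c I / ν I ^ 2 + 4 / (ν I + F.sumBelow c I)) * (∫⁻ x in I, f x ∂ν) ^ 2
      ≤ 4 / ν I * (∫⁻ x in I, f x ∂ν) ^ 2 := by
        gcongr
        exact le_trans (by gcongr; exact le_sumBelow c I) hbellman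
    _ = 4 * ((∫⁻ x in I, f x ∂ν) ^ 2 / ν I) := by simp only [div_eq_mul_inv]; ring
    _ ≤ 4 * ∫⁻ x in I, f x ^ 2 ∂ν := by
        gcongr
        exact ENNReal.div_le_of_le_mul (setLIntegral_sq_le hf I)

theorem CarlesonBound.mul_laverage_sq_add_bellmanDefect_le_tsum (hν : ∀ I ∈ F.lattice, ν I ≠ ∞)
    (hc : F.CarlesonBound c ν) {I : F.lattice} (hI : (I : Set X) ∉ F.children I) :
    c I * (⨍⁻ x in I, f x ∂ν) ^ 2 + F.bellmanDefect ν c f I ≤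
      ∑' K : F.children I, F.bellmanDefect ν c f K := by
  set D : F.children I → ℝ≥0∞ := fun K => ν K + F.sumBelow c K with hD
  have hD0 : ∀ K, D K = 0 → ∫⁻ x in (K : Set X), f x ∂ν = 0 := fun K h =>
    setLIntegral_measure_zero _ _ (add_eq_zero.1 h).1
  have hDtop : ∀ K, D K ≠ ∞ := fun K => by
    have hK := F.mem_lattice_of_mem_children K.2
    exact ENNReal.add_ne_top.2 ⟨hν K hK, ne_top_of_le_ne_top (hν K hK) (hc ⟨K, hK⟩)⟩
  have hDsum : ∑' K, D K = ν I + ∑' K : F.children I, F.sumBelow c K := by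
    rw [ENNReal.tsum_add, F.tsum_measure_children I.2]
  have hsum := sumBelow_eq_add_tsum_children hI c
  rw [mul_setLAverage_sq, bellmanDefect, ← add_mul, hsum]
  calc (c I / ν I ^ 2 + 4 / (ν I + (c I + ∑' K : F.children I, F.sumBelow c K))) *
        (∫⁻ x in I, f x ∂ν) ^ 2
      ≤ 4 / (∑' K, D K) * (∫⁻ x in I, f x ∂ν) ^ 2 := by
        rw [hDsum]
        gcongr
        exact div_sq_add_four_div_le (hν I I.2) (hsum ▸ hc I)
    _ = 4 * ((∑' K : F.children I, ∫⁻ x in (K : Set X), f x ∂ν) ^ 2 / ∑' K, D K) := by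
        rw [F.tsum_lintegral_children I.2]
        simp only [div_eq_mul_inv]
        ring
    _ ≤ 4 * ∑' K : F.children I, (∫⁻ x in (K : Set X), f x ∂ν) ^ 2 / D K := by
        gcongr
        exact ENNReal.div_le_of_le_mul (tsum_sq_le_tsum_sq_div_mul hD0 hDtop)
    _ = ∑' K : F.children I, F.bellmanDefect ν c f K := by
        rw [← ENNReal.tsum_mul_left]
        refine tsum_congr fun K => ?_
        simp only [bellmanDefect, hD, div_eq_mul_inv]
        ring

theorem CarlesonBound.tsum_mul_laverage_sq_le_of_one (hν : ∀ I ∈ F.lattice, ν I ≠ ∞)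
    (hc : F.CarlesonBound c ν) (hf : AEMeasurable f ν) :
    ∑' I : F.lattice, c I * (⨍⁻ x in I, f x ∂ν) ^ 2 ≤ 4 * ∫⁻ x, f x ^ 2 ∂ν := by
  rcases eq_or_ne (∫⁻ x, f x ^ 2 ∂ν) ∞ with htop | htop
  · simp [htop]
  set R : Set X → ℝ≥0∞ := fun I => 4 * ∫⁻ x in I, f x ^ 2 ∂ν
  set P : Set X → ℝ≥0∞ := F.bellmanDefect ν c f
  have hleaf : ∀ I : F.lattice, c I * (⨍⁻ x in I, f x ∂ν) ^ 2 + P I ≤ R I := fun I =>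
    hc.mul_laverage_sq_add_bellmanDefect_le_setLIntegral hf I (hν I I.2)
  have hPR : ∀ I : F.lattice, P I ≤ R I := fun I => le_add_self.trans (hleaf I)
  have hPtop : ∀ I : F.lattice, P I ≠ ∞ := fun I => ne_top_of_le_ne_top
    (ENNReal.mul_ne_top (by simp) (ne_top_of_le_ne_top htop (setLIntegral_le_lintegral I _)))
    (hPR I)
  have hcarleson : F.CarlesonBound (fun I => c I * (⨍⁻ x in I, f x ∂ν) ^ 2)
      fun I => R I - P I := by
    refine carlesonBound_of_superadditive
      (fun I => ENNReal.le_sub_of_add_le_right (hPtop I) (hleaf I))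
      fun I hI => ENNReal.le_sub_of_add_le_right (hPtop I) ?_
    calc c I * (⨍⁻ x in I, f x ∂ν) ^ 2 + ∑' K : F.children I, (R K - P K) + P I
        = c I * (⨍⁻ x in I, f x ∂ν) ^ 2 + P I + ∑' K : F.children I, (R K - P K) := by ring
      _ ≤ ∑' K : F.children I, P K + ∑' K : F.children I, (R K - P K) := by
          gcongr
          exact hc.mul_laverage_sq_add_bellmanDefect_le_tsum hν hI
      _ = ∑' K : F.children I, R K := by
          rw [← ENNReal.tsum_add]
          exact tsum_congr fun K =>
            add_tsub_cancel_of_le (hPR ⟨K, F.mem_lattice_of_mem_children K.2⟩)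
      _ = R I := by rw [ENNReal.tsum_mul_left, F.tsum_lintegral_children I.2]
  set ρ : Measure X := (4 : ℝ≥0∞) • ν.withDensity fun x => f x ^ 2
  have hρ : F.CarlesonBound (fun I => c I * (⨍⁻ x in I, f x ∂ν) ^ 2) ρ := fun I => by
    rw [Measure.smul_apply, withDensity_apply _ (F.measurableSet_of_mem_lattice I.2)]
    exact (hcarleson I).trans tsub_le_self
  simpa [ρ] using hρ.tsum_le_measure_univ

theorem CarlesonBound.tsum_mul_laverage_sq_le (hν : ∀ I ∈ F.lattice, ν I ≠ ∞) {C : ℝ≥0}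
    (hc : F.CarlesonBound c fun I => C * ν I) (hf : AEMeasurable f ν) :
    ∑' I : F.lattice, c I * (⨍⁻ x in I, f x ∂ν) ^ 2 ≤ 4 * C * ∫⁻ x, f x ^ 2 ∂ν := by
  rcases eq_or_ne C 0 with rfl | hC
  · have hc0 : ∀ I, c I = 0 := fun I => by simpa using hc.le I
    simp [hc0]
  have havg : ∀ I : Set X, ⨍⁻ x in I, f x ∂((C : ℝ≥0∞) • ν) = ⨍⁻ x in I, f x ∂ν := fun I => by
    rw [setLAverage_eq, setLAverage_eq, Measure.restrict_smul, lintegral_smul_measure,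
      Measure.smul_apply, smul_eq_mul, smul_eq_mul,
      ENNReal.mul_div_mul_left _ _ (by simpa using hC) (by simp)]
  have h := CarlesonBound.tsum_mul_laverage_sq_le_of_one (ν := (C : ℝ≥0∞) • ν) (c := c)
    (fun I hI => ENNReal.mul_ne_top ENNReal.coe_ne_top (hν I hI)) hc (hf.smul_measure _)
  simpa only [havg, lintegral_smul_measure, smul_eq_mul, mul_assoc] using h

end AtomicFiltration

end CarlesonEmbedding

section Entropy

theorem psiZero_eq {s : ℝ} (hs : 0 ≤ s) : psiZero s = s + Real.negMulLog s := by
  rcases hs.eq_or_lt with rfl | hs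
  · simp [psiZero]
  · rw [psiZero, Real.log_div (Real.exp_pos 1).ne' hs.ne', Real.log_exp, Real.negMulLog]
    ring

theorem le_psiZero {s : ℝ} (hs : 0 ≤ s) (hs1 : s ≤ 1) : s ≤ psiZero s := by
  rw [psiZero_eq hs]
  linarith [Real.negMulLog_nonneg hs hs1]

theorem negMulLog_le_psiZero {s : ℝ} (hs : 0 ≤ s) : Real.negMulLog s ≤ psiZero s := by
  rw [psiZero_eq hs]
  linarith

theorem lintegral_ofReal_min_one_div {p : ℝ} (hp : 0 ≤ p) (hp1 : p ≤ 1) :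
    ∫⁻ t in Ioc (0 : ℝ) 1, ENNReal.ofReal (min 1 (p / t)) = ENNReal.ofReal (psiZero p) := by
  rcases hp.eq_or_lt with rfl | hp
  · simp [psiZero]
  have hsmall : ∫⁻ t in Ioc 0 p, ENNReal.ofReal (min 1 (p / t)) = ENNReal.ofReal p := by
    rw [setLIntegral_congr_fun (g := 1) measurableSet_Ioc fun t ht => by
      simp [min_eq_left ((one_le_div ht.1).2 ht.2)]]
    simp
  have hlarge : ∫⁻ t in Ioc p 1, ENNReal.ofReal (min 1 (p / t)) =
      ENNReal.ofReal (Real.negMulLog p) := by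
    rw [setLIntegral_congr_fun (g := fun t => ENNReal.ofReal (p / t)) measurableSet_Ioc fun t ht =>
        by rw [min_eq_right ((div_le_one (hp.trans ht.1)).2 ht.1.le)],
      ← ofReal_integral_eq_lintegral_ofReal, ← intervalIntegral.integral_of_le hp1]
    · simp_rw [div_eq_mul_inv]
      rw [intervalIntegral.integral_const_mul, integral_inv_of_pos hp one_pos, one_div,
        Real.log_inv, Real.negMulLog, neg_mul, mul_neg]
    · refine (ContinuousOn.integrableOn_Icc ?_).mono_set Ioc_subset_Icc_self
      exact continuousOn_const.div continuousOn_id fun t ht => (hp.trans_le ht.1).ne'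
    · exact (ae_restrict_iff' measurableSet_Ioc).2 (Eventually.of_forall fun t ht =>
        div_nonneg hp.le (hp.trans ht.1).le)
  rw [← Ioc_union_Ioc_eq_Ioc hp.le hp1,
    lintegral_union measurableSet_Ioc (Ioc_disjoint_Ioc_of_le le_rfl), hsmall, hlarge,
    ← ENNReal.ofReal_add hp.le (Real.negMulLog_nonneg hp.le hp1), psiZero_eq hp.le]

theorem lintegral_indicator_Iio {d : ℝ} (hd1 : d ≤ 1) :
    ∫⁻ t in Ioc (0 : ℝ) 1, (Iio d).indicator 1 t = ENNReal.ofReal d := by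
  have h : Iio d ∩ Ioc 0 1 = Ioo 0 d := by
    ext t
    simp only [mem_inter_iff, mem_Iio, mem_Ioc, mem_Ioo]
    exact ⟨fun h => ⟨h.2.1, h.1⟩, fun h => ⟨h.2, h.1, h.2.le.trans hd1⟩⟩
  rw [lintegral_indicator_one measurableSet_Iio, Measure.restrict_apply measurableSet_Iio, h,
    Real.volume_Ioo, sub_zero]

/-- A pointwise form of Pinsker's inequality: it bounds `m log (m / p) - m + p` from below, with
the quotient under the logarithm expanded to admit `m = 0`. -/
theorem negMulLog_add_sq_div_le {m p : ℝ} (hm : 0 ≤ m) (hp : 0 < p) :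
    Real.negMulLog m + (m - p) ^ 2 / (2 * (m + p)) + m ≤ m * (-Real.log p) + p := by
  rcases hm.eq_or_lt with rfl | hm
  · have : (0 - p) ^ 2 / (2 * (0 + p)) = p / 2 := by field_simp; ring
    simp only [Real.negMulLog_zero, this]
    linarith
  set y := √(m / p)
  have hy : 0 < y := Real.sqrt_pos.2 (div_pos hm hp)
  have hmy : m = p * y ^ 2 := by
    rw [Real.sq_sqrt (div_pos hm hp).le]
    field_simp
  have hlogm : Real.log m = Real.log p + 2 * Real.log y := by
    rw [hmy, Real.log_mul hp.ne' (pow_pos hy 2).ne', Real.log_pow]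
    norm_num
  have hhellinger : (m - p) ^ 2 / (2 * (m + p)) ≤ p * (y - 1) ^ 2 := by
    rw [div_le_iff₀ (by positivity), hmy]
    nlinarith [mul_nonneg (sq_nonneg p) (pow_nonneg (sq_nonneg (y - 1)) 2)]
  have hlog : p * y ^ 2 - p * y ≤ m * Real.log y := by
    calc p * y ^ 2 - p * y = m * (1 - y⁻¹) := by rw [hmy]; field_simp
      _ ≤ m * Real.log y := by gcongr; exact Real.one_sub_inv_le_log_of_pos hy
  rw [Real.negMulLog, hlogm]
  nlinarith

end Entropy

/-- The density `|K ∩ E| / |K|` of `E` in `K`. -/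
def density {X : Type*} [MeasurableSpace X] (μ : Measure X) (E K : Set X) : ℝ :=
  μ.real (K ∩ E) / μ.real K

section Density

variable {X : Type*} [MeasurableSpace X] {μ : Measure X}

theorem density_nonneg (μ : Measure X) (E K : Set X) : 0 ≤ density μ E K :=
  div_nonneg measureReal_nonneg measureReal_nonneg

theorem density_eq_zero {E K : Set X} (h : μ (K ∩ E) = 0) : density μ E K = 0 := by
  simp [density, Measure.real, h]

namespace AtomicFiltration

variable {F : AtomicFiltration μ}

theorem density_le_one {K : Set X} (hK : K ∈ F.lattice) (E : Set X) : density μ E K ≤ 1 :=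
  div_le_one_of_le₀ (measureReal_mono inter_subset_left (F.measure_lt_top_of_mem_lattice hK).ne)
    measureReal_nonneg

theorem measure_mul_density {K : Set X} (hK : K ∈ F.lattice) (E : Set X) :
    μ K * ENNReal.ofReal (density μ E K) = μ (K ∩ E) := by
  have hKtop := (F.measure_lt_top_of_mem_lattice hK).ne
  have hKE : μ (K ∩ E) ≠ ∞ := ne_top_of_le_ne_top hKtop (measure_mono inter_subset_left)
  rw [density, ENNReal.ofReal_div_of_pos (F.measureReal_pos_of_mem_lattice hK), Measure.real,
    Measure.real, ENNReal.ofReal_toReal hKtop, ENNReal.ofReal_toReal hKE,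
    ENNReal.mul_div_cancel (F.measure_pos_of_mem_lattice hK).ne' hKtop]

theorem tsum_measure_mul_density_children {I : Set X} (hI : I ∈ F.lattice) (E : Set X) :
    ∑' K : F.children I, μ (K : Set X) * ENNReal.ofReal (density μ E K) = μ (I ∩ E) := by
  rw [← Measure.restrict_apply (F.measurableSet_of_mem_lattice hI), ← F.tsum_measure_children hI]
  refine tsum_congr fun K => ?_
  rw [Measure.restrict_apply (F.measurableSet_child K),
    measure_mul_density (F.mem_lattice_of_mem_children K.2)]

end AtomicFiltration

end Density

section CarlesonRestrict

namespace AtomicFiltration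

variable {X : Type*} [MeasurableSpace X] {μ : Measure X} {F : AtomicFiltration μ}

theorem CarlesonBound.sumBelow_indicator_density_le {c : F.lattice → ℝ≥0∞}
    (hc : F.CarlesonBound c μ) (E : Set X) {t : ℝ} (ht : 0 < t) (I : F.lattice) :
    F.sumBelow ({J : F.lattice | t < density μ E J}.indicator c) I ≤
      μ I * ENNReal.ofReal (min 1 (density μ E I / t)) := by
  refine sumBelow_indicator_le (fun J _ => hc J) fun s hs => ?_
  have hsI : ⋃ J ∈ s, (J : Set X) ⊆ I := iUnion₂_subset fun J hJ => (hs J hJ).1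
  rw [ENNReal.ofReal_min, ENNReal.ofReal_one, mul_min, mul_one]
  refine le_min (measure_mono hsI) ?_
  have hlevel : ∀ J ∈ s, μ J ≤ (ENNReal.ofReal t⁻¹ • μ.restrict E) J := fun J hJ => by
    rw [Measure.smul_apply, Measure.restrict_apply (F.measurableSet_of_mem_lattice J.2),
      ← measure_mul_density J.2, smul_eq_mul, mul_left_comm, ← ENNReal.ofReal_mul (by positivity)]
    refine le_mul_of_one_le_right' (ENNReal.one_le_ofReal.2 ?_)
    rw [inv_mul_eq_div]
    exact (one_le_div ht).2 (hs J hJ).2.le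
  calc μ (⋃ J ∈ s, J) ≤ (ENNReal.ofReal t⁻¹ • μ.restrict E) (⋃ J ∈ s, J) :=
        measure_biUnion_le_of_forall_le hlevel
    _ ≤ (ENNReal.ofReal t⁻¹ • μ.restrict E) I := measure_mono hsI
    _ = μ I * ENNReal.ofReal (density μ E I / t) := by
        rw [Measure.smul_apply, Measure.restrict_apply (F.measurableSet_of_mem_lattice I.2),
          ← measure_mul_density I.2, smul_eq_mul, mul_left_comm,
          ← ENNReal.ofReal_mul (by positivity), inv_mul_eq_div]

theorem CarlesonBound.mul_measure_inter {a : F.lattice → ℝ≥0∞}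
    (ha : F.CarlesonBound (fun J => a J * μ J) μ) (E : Set X) :
    F.CarlesonBound (fun J => a J * μ (J ∩ E))
      fun I => μ I * ENNReal.ofReal (psiZero (density μ E I)) := by
  have hlayer : ∀ J : F.lattice, a J * μ (J ∩ E) =
      ∫⁻ t in Ioc (0 : ℝ) 1, {J : F.lattice | t < density μ E J}.indicator
        (fun J => a J * μ J) J := fun J => by
    have hind : ∀ t : ℝ, {J : F.lattice | t < density μ E J}.indicator (fun J => a J * μ J) J =
        a J * μ J * (Iio (density μ E J)).indicator 1 t := fun t => by simp [indicator_apply]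
    simp only [hind]
    rw [lintegral_const_mul _ (measurable_one.indicator measurableSet_Iio),
      lintegral_indicator_Iio (density_le_one J.2 E), mul_assoc, measure_mul_density J.2]
  have hmajorant : ∀ I : F.lattice, ∫⁻ t in Ioc (0 : ℝ) 1,
      μ I * ENNReal.ofReal (min 1 (density μ E I / t)) =
      μ I * ENNReal.ofReal (psiZero (density μ E I)) := fun I => by
    rw [lintegral_const_mul _ (by fun_prop),
      lintegral_ofReal_min_one_div (density_nonneg μ E I) (density_le_one I.2 E)]
  have h := CarlesonBound.lintegral (F := F) (ρ := volume.restrict (Ioc (0 : ℝ) 1))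
    (c := fun t => {J : F.lattice | t < density μ E J}.indicator fun J => a J * μ J)
    (B := fun t I => μ I * ENNReal.ofReal (min 1 (density μ E I / t)))
    (fun J => (measurable_const.indicator measurableSet_Iio).aemeasurable)
    ((ae_restrict_mem measurableSet_Ioc).mono fun t ht => ha.sumBelow_indicator_density_le E ht.1)
  exact h.mono (fun J => (hlayer J).le) fun I => (hmajorant I).le

end AtomicFiltration

end CarlesonRestrict

section SetDiffNorm

namespace AtomicFiltration

variable {X : Type*} [MeasurableSpace X] {μ : Measure X} (F : AtomicFiltration μ)

/-- The `L¹` norm of the martingale difference `Δ_I 1_E`. -/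
def setDiffNorm (I E : Set X) : ℝ≥0∞ :=
  ∑' K : F.children I, μ (K : Set X) * ‖density μ E K - density μ E I‖ₑ

/-- The Pearson-type divergence `∑_{K ∈ ch(I)} |K| (m_K - m_I)² / (2 (m_K + m_I))` of the densities
`m` of `E`, through which the entropy controls `setDiffNorm`. -/
def setDivergence (I E : Set X) : ℝ≥0∞ :=
  ∑' K : F.children I, μ (K : Set X) * ENNReal.ofReal
    ((density μ E K - density μ E I) ^ 2 / (2 * (density μ E K + density μ E I)))

variable {F}

theorem setDivergence_add_entropy_le {I : Set X} (hI : I ∈ F.lattice) (E : Set X) :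
    F.setDivergence I E +
      ∑' K : F.children I, μ (K : Set X) * ENNReal.ofReal (Real.negMulLog (density μ E K)) ≤
    μ I * ENNReal.ofReal (Real.negMulLog (density μ E I)) := by
  have hIE : μ (I ∩ E) ≠ ∞ :=
    ne_top_of_le_ne_top (F.measure_lt_top_of_mem_lattice hI).ne (measure_mono inter_subset_left)
  rcases (density_nonneg μ E I).eq_or_lt with hp | hp
  · have hK : ∀ K : F.children I, density μ E K = 0 := fun K => density_eq_zero
      (measure_mono_null (inter_subset_inter_left E (F.subset_of_mem_children K.2))
        (by rw [← measure_mul_density hI, ← hp]; simp))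
    simp [setDivergence, hK, ← hp]
  set p := density μ E I
  set m : F.children I → ℝ := fun K => density μ E K
  set d : F.children I → ℝ := fun K => (m K - p) ^ 2 / (2 * (m K + p))
  have hlog : 0 ≤ -Real.log p := neg_nonneg.2 (Real.log_nonpos hp.le (density_le_one hI E))
  have hchild : ∀ K : F.children I,
      μ (K : Set X) * ENNReal.ofReal (Real.negMulLog (m K)) + μ (K : Set X) * ENNReal.ofReal (d K) +
        μ (K : Set X) * ENNReal.ofReal (m K) ≤
      μ (K : Set X) * ENNReal.ofReal (m K) * ENNReal.ofReal (-Real.log p) +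
        μ (K : Set X) * ENNReal.ofReal p := fun K => by
    have hm : 0 ≤ m K := density_nonneg μ E K
    have hent : 0 ≤ Real.negMulLog (m K) :=
      Real.negMulLog_nonneg hm (density_le_one (F.mem_lattice_of_mem_children K.2) E)
    have hd : 0 ≤ d K := by positivity
    rw [mul_assoc, ← mul_add, ← mul_add, ← mul_add, ← ENNReal.ofReal_mul hm,
      ← ENNReal.ofReal_add hent hd, ← ENNReal.ofReal_add (add_nonneg hent hd) hm,
      ← ENNReal.ofReal_add (mul_nonneg hm hlog) hp.le]
    exact mul_le_mul_right (ENNReal.ofReal_le_ofReal (negMulLog_add_sq_div_le hm hp)) _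
  have hsum := ENNReal.tsum_le_tsum hchild
  rw [ENNReal.tsum_add, ENNReal.tsum_add, ENNReal.tsum_add, ENNReal.tsum_mul_right,
    ENNReal.tsum_mul_right, tsum_measure_mul_density_children hI, F.tsum_measure_children hI,
    measure_mul_density hI, ENNReal.add_le_add_iff_right hIE] at hsum
  calc F.setDivergence I E + _ = _ := add_comm _ _
    _ ≤ μ (I ∩ E) * ENNReal.ofReal (-Real.log p) := hsum
    _ = μ I * ENNReal.ofReal (Real.negMulLog p) := by
        rw [← measure_mul_density hI, mul_assoc, ← ENNReal.ofReal_mul hp.le, Real.negMulLog,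
          mul_neg, neg_mul]

theorem mul_enorm_sq_div {c : ℝ≥0∞} (hc : c ≠ 0) (hc' : c ≠ ∞) {a b : ℝ} (hb : 0 ≤ b)
    (hab : b = 0 → a = 0) :
    (c * ‖a‖ₑ) ^ 2 / (c * ENNReal.ofReal b) = c * ENNReal.ofReal (a ^ 2 / b) := by
  rcases hb.eq_or_lt with rfl | hb
  · simp [hab rfl]
  rw [mul_pow, Real.enorm_eq_ofReal_abs, ← ENNReal.ofReal_pow (abs_nonneg a), sq_abs, sq, mul_assoc,
    ENNReal.mul_div_mul_left _ _ hc hc', mul_div_assoc, ENNReal.ofReal_div_of_pos hb]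

theorem setDiffNorm_sq_le {I : Set X} (hI : I ∈ F.lattice) (E : Set X) :
    F.setDiffNorm I E ^ 2 ≤ F.setDivergence I E * (4 * μ (I ∩ E)) := by
  set p := density μ E I
  set m : F.children I → ℝ := fun K => density μ E K
  have hm : ∀ K, 0 ≤ m K := fun K => density_nonneg μ E K
  have hp : 0 ≤ p := density_nonneg μ E I
  set w : F.children I → ℝ≥0∞ := fun K => μ (K : Set X) * ENNReal.ofReal (2 * (m K + p))
  have hμ : ∀ K : F.children I, μ (K : Set X) ≠ 0 ∧ μ (K : Set X) ≠ ∞ := fun K =>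
    ⟨(F.measure_pos_of_mem_lattice (F.mem_lattice_of_mem_children K.2)).ne',
      (F.measure_lt_top_of_mem_lattice (F.mem_lattice_of_mem_children K.2)).ne⟩
  have hw : ∑' K, w K = 4 * μ (I ∩ E) := by
    have hsplit : ∀ K, w K = 2 * (μ (K : Set X) * ENNReal.ofReal (m K)) +
        2 * (μ (K : Set X) * ENNReal.ofReal p) := fun K => by
      rw [← mul_add, ← mul_add, ← ENNReal.ofReal_add (hm K) hp, mul_left_comm]
      simp only [w, ENNReal.ofReal_mul zero_le_two, ENNReal.ofReal_ofNat]
    rw [tsum_congr hsplit, ENNReal.tsum_add, ENNReal.tsum_mul_left, ENNReal.tsum_mul_left,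
      ENNReal.tsum_mul_right, tsum_measure_mul_density_children hI, F.tsum_measure_children hI,
      measure_mul_density hI]
    ring
  have hmp : ∀ K, 2 * (m K + p) = 0 → m K - p = 0 := fun K h => by linarith [hm K]
  have hdiv : ∀ K : F.children I, (μ (K : Set X) * ‖m K - p‖ₑ) ^ 2 / w K =
      μ (K : Set X) * ENNReal.ofReal ((m K - p) ^ 2 / (2 * (m K + p))) := fun K =>
    mul_enorm_sq_div (hμ K).1 (hμ K).2 (by linarith [hm K]) (hmp K)
  have hw0 : ∀ K, w K = 0 → μ (K : Set X) * ‖m K - p‖ₑ = 0 := fun K hK => by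
    have hle : 2 * (m K + p) ≤ 0 :=
      ENNReal.ofReal_eq_zero.1 ((mul_eq_zero.1 hK).resolve_left (hμ K).1)
    simp [hmp K (by linarith [hm K])]
  have hCS := tsum_sq_le_tsum_sq_div_mul hw0 fun K =>
    ENNReal.mul_ne_top (hμ K).2 ENNReal.ofReal_ne_top
  rwa [tsum_congr hdiv, hw] at hCS

theorem carlesonBound_setDiffNorm_sq (E : Set X) :
    F.CarlesonBound (fun J => F.setDiffNorm J E ^ 2 / (4 * μ (J ∩ E)))
      fun I => μ I * ENNReal.ofReal (psiZero (density μ E I)) := by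
  have hstep : ∀ I : F.lattice, F.setDiffNorm I E ^ 2 / (4 * μ (I ∩ E)) +
      ∑' K : F.children I, μ (K : Set X) * ENNReal.ofReal (Real.negMulLog (density μ E K)) ≤
      μ I * ENNReal.ofReal (Real.negMulLog (density μ E I)) := fun I =>
    le_trans (by gcongr; exact ENNReal.div_le_of_le_mul (setDiffNorm_sq_le I.2 E))
      (setDivergence_add_entropy_le I.2 E)
  have h := carlesonBound_of_superadditive
    (B := fun K => μ K * ENNReal.ofReal (Real.negMulLog (density μ E K)))
    (fun J => le_self_add.trans (hstep J)) fun J _ => hstep J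
  refine h.mono (fun _ => le_rfl) fun I => ?_
  gcongr
  exact negMulLog_le_psiZero (density_nonneg μ E I)

end AtomicFiltration

end SetDiffNorm

namespace IsPenalty

variable {α : ℝ → ℝ}

theorem mul_pos (hα : IsPenalty α) {t : ℝ} (ht : 1 ≤ t) : 0 < t * α t :=
  _root_.mul_pos (by linarith) (hα.pos t ht)

theorem antitoneOn_one_div (hα : IsPenalty α) : AntitoneOn (fun t => 1 / (t * α t)) (Ici 1) :=
  fun _ hs _ ht hst => one_div_le_one_div_of_le (hα.mul_pos hs) (hα.mono hs ht hst)

theorem integral_nonneg (hα : IsPenalty α) : 0 ≤ ∫ t in Ioi (1 : ℝ), 1 / (t * α t) :=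
  setIntegral_nonneg measurableSet_Ioi fun _ ht => (one_div_pos.2 (hα.mul_pos (le_of_lt ht))).le

theorem penaltyConst_pos (hα : IsPenalty α) : 0 < penaltyConst α :=
  add_pos_of_pos_of_nonneg (one_div_pos.2 (hα.pos 1 le_rfl)) hα.integral_nonneg

theorem one_div_le_penaltyConst (hα : IsPenalty α) {t : ℝ} (ht : 1 ≤ t) :
    1 / (t * α t) ≤ penaltyConst α := by
  have h := hα.antitoneOn_one_div (mem_Ici.2 le_rfl) (mem_Ici.2 ht) ht
  simp only [one_mul] at h
  exact h.trans (le_add_of_nonneg_right hα.integral_nonneg)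

theorem ofReal_mul_le_setLIntegral (hα : IsPenalty α) {a b : ℝ} (ha : 1 ≤ a) (hab : a ≤ b) :
    ENNReal.ofReal (1 / (b * α b) * (b - a)) ≤
      ∫⁻ t in Ioc a b, ENNReal.ofReal (1 / (t * α t)) := by
  have hb : 0 ≤ 1 / (b * α b) := (one_div_pos.2 (hα.mul_pos (ha.trans hab))).le
  rw [ENNReal.ofReal_mul hb, ← Real.volume_Ioc, ← setLIntegral_const]
  exact setLIntegral_mono' measurableSet_Ioc fun t ht => ENNReal.ofReal_le_ofReal
    (hα.antitoneOn_one_div (ha.trans ht.1.le) (ha.trans hab) ht.2)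

theorem tsum_setLIntegral_Ioc_le (hα : IsPenalty α) :
    ∑' k : ℕ, ∫⁻ t in Ioc ((2 : ℝ) ^ k) (2 ^ (k + 1)), ENNReal.ofReal (1 / (t * α t)) ≤
      ENNReal.ofReal (∫ t in Ioi (1 : ℝ), 1 / (t * α t)) := by
  have hdisj : Pairwise (Function.onFun Disjoint fun k : ℕ => Ioc ((2 : ℝ) ^ k) (2 ^ (k + 1))) :=
    (pow_right_mono₀ one_le_two).pairwise_disjoint_on_Ioc_succ
  rw [← lintegral_iUnion (fun _ => measurableSet_Ioc) hdisj,
    ofReal_integral_eq_lintegral_ofReal hα.integrable ((ae_restrict_mem measurableSet_Ioi).mono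
      fun t ht => (one_div_pos.2 (hα.mul_pos (le_of_lt ht))).le)]
  exact lintegral_mono_set (iUnion_subset fun k t ht => (one_le_pow₀ one_le_two).trans_lt ht.1)

theorem tsum_dyadic_le (hα : IsPenalty α) :
    ∑' k : ℕ, ENNReal.ofReal (1 / ((2 : ℝ) ^ k * α (2 ^ k)) * 2 ^ (k + 1)) ≤
      ENNReal.ofReal (4 * penaltyConst α) := by
  have hα1 : 0 ≤ 1 / α 1 := (one_div_pos.2 (hα.pos 1 le_rfl)).le
  have hsucc : ∀ k : ℕ,
      ENNReal.ofReal (1 / ((2 : ℝ) ^ (k + 1) * α (2 ^ (k + 1))) * 2 ^ (k + 1 + 1)) ≤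
        4 * ∫⁻ t in Ioc ((2 : ℝ) ^ k) (2 ^ (k + 1)), ENNReal.ofReal (1 / (t * α t)) := fun k => by
    calc _ = 4 * ENNReal.ofReal
          (1 / ((2 : ℝ) ^ (k + 1) * α (2 ^ (k + 1))) * (2 ^ (k + 1) - 2 ^ k)) := by
            rw [← ENNReal.ofReal_ofNat 4, ← ENNReal.ofReal_mul (by norm_num)]
            ring_nf
      _ ≤ _ := by
            gcongr
            exact hα.ofReal_mul_le_setLIntegral (one_le_pow₀ one_le_two)
              (pow_le_pow_right₀ one_le_two k.le_succ)
  rw [tsum_eq_zero_add' ENNReal.summable]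
  calc _ ≤ ENNReal.ofReal (1 / α 1 * 2) +
        4 * ENNReal.ofReal (∫ t in Ioi (1 : ℝ), 1 / (t * α t)) := by
          refine add_le_add (by simp) ((ENNReal.tsum_le_tsum hsucc).trans ?_)
          rw [ENNReal.tsum_mul_left]
          gcongr
          exact hα.tsum_setLIntegral_Ioc_le
    _ ≤ ENNReal.ofReal (4 * penaltyConst α) := by
          rw [← ENNReal.ofReal_ofNat 4, ← ENNReal.ofReal_mul (by norm_num),
            ← ENNReal.ofReal_add (by positivity) (mul_nonneg (by norm_num) hα.integral_nonneg)]
          refine ENNReal.ofReal_le_ofReal ?_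
          rw [penaltyConst]
          linarith

end IsPenalty

theorem measurable_psiZero : Measurable psiZero := by
  unfold psiZero
  fun_prop

/-- The ratio `u*_I / u_I` of the `L log L` norm and the average of `u`, the argument of the penalty
`α` in `entropyBump`. It is meaningful if `u*_I < ∞` and `u_I ≠ 0`. -/
def entropyRatio {X : Type*} [MeasurableSpace X] (μ : Measure X) (I : Set X) (u : X → ℝ) : ℝ :=
  (llogl μ I u).toReal / ⨍ x in I, u x ∂μ

section LayerCake

variable {X : Type*} [MeasurableSpace X] {μ : Measure X}

theorem measurable_measure_inter (I : Set X) (u : X → ℝ) :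
    Measurable fun t : ℝ => μ (I ∩ {x | t < u x}) :=
  Antitone.measurable fun _ _ hst =>
    measure_mono (inter_subset_inter_right I fun _ hx => lt_of_le_of_lt hst hx)

theorem measurable_density (I : Set X) (u : X → ℝ) :
    Measurable fun t : ℝ => density μ {x | t < u x} I :=
  (measurable_measure_inter I u).ennreal_toReal.div_const _

theorem measure_mul_llogl (I : Set X) (u : X → ℝ) :
    μ I * llogl μ I u =
      ∫⁻ t in Ioi (0 : ℝ), μ I * ENNReal.ofReal (psiZero (density μ {x | t < u x} I)) :=
  (lintegral_const_mul _ (measurable_psiZero.comp (measurable_density I u)).ennreal_ofReal).symm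

namespace AtomicFiltration

variable {F : AtomicFiltration μ} {u : X → ℝ}

theorem measurable_setDiffNorm (I : Set X) (u : X → ℝ) :
    Measurable fun t : ℝ => F.setDiffNorm I {x | t < u x} :=
  Measurable.tsum fun K =>
    ((measurable_density (K : Set X) u).sub (measurable_density I u)).enorm.const_mul _

theorem measure_mul_ofReal_average {I : Set X} (hI : I ∈ F.lattice) (f : X → ℝ) :
    μ I * ENNReal.ofReal (⨍ x in I, f x ∂μ) = ENNReal.ofReal (∫ x in I, f x ∂μ) := by
  have h := F.measureReal_pos_of_mem_lattice hI
  rw [setAverage_eq, smul_eq_mul, ENNReal.ofReal_mul (inv_nonneg.2 h.le), ← mul_assoc,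
    ENNReal.ofReal_inv_of_pos h, Measure.real,
    ENNReal.ofReal_toReal (F.measure_lt_top_of_mem_lattice hI).ne,
    ENNReal.mul_inv_cancel (F.measure_pos_of_mem_lattice hI).ne'
      (F.measure_lt_top_of_mem_lattice hI).ne, one_mul]

namespace IsWeight

theorem average_nonneg (hu : F.IsWeight u) (I : Set X) : 0 ≤ ⨍ x in I, u x ∂μ := by
  rw [setAverage_eq]
  exact smul_nonneg (inv_nonneg.2 measureReal_nonneg) (integral_nonneg hu.nonneg)

theorem weighted_apply (hu : F.IsWeight u) {I : Set X} (hI : I ∈ F.lattice) :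
    weighted μ u I = ENNReal.ofReal (∫ x in I, u x ∂μ) := by
  rw [weighted, withDensity_apply _ (F.measurableSet_of_mem_lattice hI),
    ofReal_integral_eq_lintegral_ofReal (hu.integrableOn I hI) (Eventually.of_forall hu.nonneg)]

theorem weighted_ne_top (hu : F.IsWeight u) {I : Set X} (hI : I ∈ F.lattice) :
    weighted μ u I ≠ ∞ := by
  rw [hu.weighted_apply hI]
  exact ENNReal.ofReal_ne_top

theorem weighted_eq_mul_average (hu : F.IsWeight u) {I : Set X} (hI : I ∈ F.lattice) :
    weighted μ u I = μ I * ENNReal.ofReal (⨍ x in I, u x ∂μ) := by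
  rw [hu.weighted_apply hI, measure_mul_ofReal_average hI]

theorem weighted_eq_lintegral (hu : F.IsWeight u) {I : Set X} (hI : I ∈ F.lattice) :
    weighted μ u I = ∫⁻ t in Ioi (0 : ℝ), μ (I ∩ {x | t < u x}) := by
  rw [weighted, withDensity_apply _ (F.measurableSet_of_mem_lattice hI),
    lintegral_eq_lintegral_meas_lt _ (Eventually.of_forall hu.nonneg) hu.measurable.aemeasurable]
  refine lintegral_congr fun t => ?_
  rw [Measure.restrict_apply (measurableSet_lt measurable_const hu.measurable), inter_comm]

theorem weighted_le_mul_llogl (hu : F.IsWeight u) {I : Set X} (hI : I ∈ F.lattice) :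
    weighted μ u I ≤ μ I * llogl μ I u := by
  rw [hu.weighted_eq_lintegral hI, measure_mul_llogl]
  refine lintegral_mono fun t => ?_
  rw [← measure_mul_density hI]
  gcongr
  exact le_psiZero (density_nonneg _ _ _) (density_le_one hI _)

theorem ofReal_average_eq_lintegral (hu : F.IsWeight u) {I : Set X} (hI : I ∈ F.lattice) :
    ENNReal.ofReal (⨍ x in I, u x ∂μ) =
      ∫⁻ t in Ioi (0 : ℝ), ENNReal.ofReal (density μ {x | t < u x} I) := by
  refine (ENNReal.mul_right_inj (F.measure_pos_of_mem_lattice hI).ne'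
    (F.measure_lt_top_of_mem_lattice hI).ne).1 ?_
  rw [← hu.weighted_eq_mul_average hI, hu.weighted_eq_lintegral hI,
    ← lintegral_const_mul _ (measurable_density I u).ennreal_ofReal]
  exact lintegral_congr fun t => (measure_mul_density hI _).symm

theorem integrableOn_density (hu : F.IsWeight u) {I : Set X} (hI : I ∈ F.lattice) :
    IntegrableOn (fun t : ℝ => density μ {x | t < u x} I) (Ioi 0) := by
  refine ⟨(measurable_density I u).aestronglyMeasurable, ?_⟩
  rw [hasFiniteIntegral_iff_ofReal (Eventually.of_forall fun t => density_nonneg _ _ _),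
    ← hu.ofReal_average_eq_lintegral hI]
  exact ENNReal.ofReal_lt_top

theorem average_eq_integral_density (hu : F.IsWeight u) {I : Set X} (hI : I ∈ F.lattice) :
    ⨍ x in I, u x ∂μ = ∫ t in Ioi (0 : ℝ), density μ {x | t < u x} I := by
  rw [integral_eq_lintegral_of_nonneg_ae (Eventually.of_forall fun t => density_nonneg _ _ _)
    (measurable_density I u).aestronglyMeasurable, ← hu.ofReal_average_eq_lintegral hI,
    ENNReal.toReal_ofReal (hu.average_nonneg I)]

theorem carlesonBound_mul_weighted (hu : F.IsWeight u) {a : F.lattice → ℝ≥0∞}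
    (ha : F.CarlesonBound (fun J => a J * μ J) μ) :
    F.CarlesonBound (fun J => a J * weighted μ u J) fun I => μ I * llogl μ I u := by
  have hm : ∀ J : F.lattice, Measurable fun t : ℝ => μ (J ∩ {x | t < u x}) := fun J =>
    measurable_measure_inter J u
  refine (CarlesonBound.lintegral (ρ := volume.restrict (Ioi 0))
    (fun J => ((hm J).const_mul (a J)).aemeasurable)
    (Eventually.of_forall fun t => ha.mul_measure_inter {x | t < u x})).mono
    (fun J => ?_) fun I => (measure_mul_llogl I u).ge
  rw [hu.weighted_eq_lintegral J.2, lintegral_const_mul _ (hm J)]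

end IsWeight

end AtomicFiltration

end LayerCake

section DiffNorm

namespace AtomicFiltration

variable {X : Type*} [MeasurableSpace X] {μ : Measure X} (F : AtomicFiltration μ)

/-- The `L¹` norm of the martingale difference `Δ_I f`. -/
def diffNorm (I : Set X) (f : X → ℝ) : ℝ≥0∞ :=
  ∑' K : F.children I, μ (K : Set X) * ‖(⨍ x in (K : Set X), f x ∂μ) - ⨍ x in I, f x ∂μ‖ₑ

variable {F} {u : X → ℝ}

theorem IsWeight.diffNorm_le_lintegral (hu : F.IsWeight u) {I : Set X} (hI : I ∈ F.lattice) :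
    F.diffNorm I u ≤ ∫⁻ t in Ioi (0 : ℝ), F.setDiffNorm I {x | t < u x} := by
  have hm : ∀ K : F.children I, Measurable fun t : ℝ =>
      ‖density μ {x | t < u x} (K : Set X) - density μ {x | t < u x} I‖ₑ := fun K =>
    ((measurable_density _ u).sub (measurable_density _ u)).enorm
  simp only [setDiffNorm]
  rw [lintegral_tsum fun K => ((hm K).const_mul _).aemeasurable]
  refine ENNReal.tsum_le_tsum fun K => ?_
  have hK := F.mem_lattice_of_mem_children K.2
  rw [lintegral_const_mul _ (hm K), hu.average_eq_integral_density hI,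
    hu.average_eq_integral_density hK,
    ← integral_sub (hu.integrableOn_density hK) (hu.integrableOn_density hI)]
  gcongr
  exact enorm_integral_le_lintegral_enorm _

theorem IsWeight.diffNorm_sq_div_le_lintegral (hu : F.IsWeight u) {I : Set X} (hI : I ∈ F.lattice) :
    F.diffNorm I u ^ 2 / (4 * weighted μ u I) ≤
      ∫⁻ t in Ioi (0 : ℝ), F.setDiffNorm I {x | t < u x} ^ 2 / (4 * μ (I ∩ {x | t < u x})) := by
  have hfin : ∀ t, 4 * μ (I ∩ {x | t < u x}) ≠ ∞ := fun t =>
    ENNReal.mul_ne_top (by norm_num) (ne_top_of_le_ne_top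
      (F.measure_lt_top_of_mem_lattice hI).ne (measure_mono inter_subset_left))
  have hzero : ∀ t, 4 * μ (I ∩ {x | t < u x}) = 0 → F.setDiffNorm I {x | t < u x} = 0 :=
    fun t ht => by
      have h := setDiffNorm_sq_le (F := F) hI {x | t < u x}
      rwa [ht, mul_zero, nonpos_iff_eq_zero, sq_eq_zero_iff] at h
  refine ENNReal.div_le_of_le_mul ?_
  rw [hu.weighted_eq_lintegral hI, ← lintegral_const_mul _ (measurable_measure_inter I u)]
  exact (pow_le_pow_left' (hu.diffNorm_le_lintegral hI) 2).trans
    (lintegral_sq_le_lintegral_sq_div_mul (measurable_setDiffNorm I u).aemeasurable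
      ((measurable_measure_inter I u).const_mul 4).aemeasurable hzero hfin)

theorem IsWeight.carlesonBound_diffNorm_sq (hu : F.IsWeight u) :
    F.CarlesonBound (fun J => F.diffNorm J u ^ 2 / (4 * weighted μ u J))
      fun I => μ I * llogl μ I u := by
  have hm : ∀ J : F.lattice, Measurable fun t : ℝ =>
      F.setDiffNorm J {x | t < u x} ^ 2 / (4 * μ (J ∩ {x | t < u x})) := fun J =>
    ((measurable_setDiffNorm (F := F) J u).pow_const 2).div
      ((measurable_measure_inter J u).const_mul 4)
  have h := CarlesonBound.lintegral (ρ := volume.restrict (Ioi (0 : ℝ)))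
    (fun J => (hm J).aemeasurable)
    (Eventually.of_forall fun t => carlesonBound_setDiffNorm_sq (F := F) {x | t < u x})
  exact h.mono (fun J => hu.diffNorm_sq_div_le_lintegral J.2) fun I => (measure_mul_llogl I u).ge

end AtomicFiltration

end DiffNorm

section EntropyBump

namespace AtomicFiltration

variable {X : Type*} [MeasurableSpace X] {μ : Measure X} {F : AtomicFiltration μ}
  {u : X → ℝ} {α : ℝ → ℝ}

namespace IsWeight

theorem measure_mul_llogl_eq (hu : F.IsWeight u) {J : Set X} (hJ : J ∈ F.lattice)
    (h0 : weighted μ u J ≠ 0) (hfin : llogl μ J u ≠ ∞) :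
    μ J * llogl μ J u = ENNReal.ofReal (entropyRatio μ J u) * weighted μ u J := by
  have hpos : 0 < ⨍ x in J, u x ∂μ := by
    refine lt_of_le_of_ne (hu.average_nonneg J) fun h => h0 ?_
    simp [hu.weighted_eq_mul_average hJ, ← h]
  rw [hu.weighted_eq_mul_average hJ, mul_left_comm, entropyRatio,
    ← ENNReal.ofReal_mul (by positivity), div_mul_cancel₀ _ hpos.ne', ENNReal.ofReal_toReal hfin]

theorem one_le_entropyRatio (hu : F.IsWeight u) {J : Set X} (hJ : J ∈ F.lattice)
    (h0 : weighted μ u J ≠ 0) (hfin : llogl μ J u ≠ ∞) : 1 ≤ entropyRatio μ J u := by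
  have h := hu.weighted_le_mul_llogl hJ
  rw [hu.measure_mul_llogl_eq hJ h0 hfin] at h
  by_contra! hlt
  refine h.not_gt ?_
  nth_rw 2 [← one_mul (weighted μ u J)]
  exact (ENNReal.mul_lt_mul_iff_left h0 (hu.weighted_ne_top hJ)).2 (ENNReal.ofReal_lt_one.2 hlt)

theorem measure_mul_entropyBump (hu : F.IsWeight u) (α : ℝ → ℝ) {J : Set X} (hJ : J ∈ F.lattice)
    (h0 : weighted μ u J ≠ 0) (hfin : llogl μ J u ≠ ∞) :
    μ J * entropyBump μ α J u =
      ENNReal.ofReal (entropyRatio μ J u * α (entropyRatio μ J u)) * weighted μ u J := by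
  have h1 := hu.one_le_entropyRatio hJ h0 hfin
  rw [entropyBump, if_neg hfin, ← entropyRatio, mul_left_comm,
    hu.measure_mul_llogl_eq hJ h0 hfin, ENNReal.ofReal_mul (by linarith)]
  ring

end IsWeight

variable (F) in
/-- The atoms with positive `u`-measure on which the ratio `u*_I / u_I` is finite and lies in
`[2 ^ j, 2 ^ (j + 1))`. -/
def entropyLevel (u : X → ℝ) (j : ℕ) : Set F.lattice :=
  {J | weighted μ u J ≠ 0 ∧ llogl μ J u ≠ ∞ ∧ entropyRatio μ J u ∈ Ico (2 ^ j) (2 ^ (j + 1))}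

theorem CarlesonBound.sumBelow_entropyLevel_le (hu : F.IsWeight u) {c : F.lattice → ℝ≥0∞}
    {L : ℝ≥0∞} (hc : F.CarlesonBound c fun I => L * (μ I * llogl μ I u)) (j : ℕ) (I : F.lattice) :
    F.sumBelow ((F.entropyLevel u j).indicator c) I ≤
      ENNReal.ofReal (2 ^ (j + 1)) * L * weighted μ u I := by
  refine sumBelow_indicator_le (ν := (ENNReal.ofReal (2 ^ (j + 1)) * L) • weighted μ u)
    (fun J hJ => (hc J).trans ?_) fun s hs => measure_mono (iUnion₂_subset fun J hJ => (hs J hJ).1)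
  obtain ⟨h0, hfin, -, hlt⟩ := hJ
  dsimp only
  rw [hu.measure_mul_llogl_eq J.2 h0 hfin, Measure.smul_apply, smul_eq_mul,
    mul_comm (ENNReal.ofReal (2 ^ (j + 1))), mul_assoc]
  gcongr

theorem IsWeight.div_entropyBump_le (hu : F.IsWeight u) (hα : IsPenalty α) (d : ℝ≥0∞) {j : ℕ}
    {J : F.lattice} (hJ : J ∈ F.entropyLevel u j) :
    d / (μ J * entropyBump μ α J u) ≤
      ENNReal.ofReal (1 / ((2 : ℝ) ^ j * α (2 ^ j))) * (d / weighted μ u J) := by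
  obtain ⟨h0, hfin, hle, -⟩ := hJ
  have hj : (1 : ℝ) ≤ 2 ^ j := one_le_pow₀ one_le_two
  have hmono : (2 : ℝ) ^ j * α (2 ^ j) ≤ entropyRatio μ J u * α (entropyRatio μ J u) :=
    hα.mono hj (hj.trans hle) hle
  rw [hu.measure_mul_entropyBump α J.2 h0 hfin]
  calc d / (ENNReal.ofReal (entropyRatio μ J u * α (entropyRatio μ J u)) * weighted μ u J)
      ≤ d / (ENNReal.ofReal ((2 : ℝ) ^ j * α (2 ^ j)) * weighted μ u J) := by gcongr
    _ = ENNReal.ofReal (1 / ((2 : ℝ) ^ j * α (2 ^ j))) * (d / weighted μ u J) := by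
        rw [one_div, ENNReal.ofReal_inv_of_pos (hα.mul_pos hj), div_eq_mul_inv, div_eq_mul_inv,
          ENNReal.mul_inv (Or.inr (hu.weighted_ne_top J.2)) (Or.inr h0)]
        ring

theorem IsWeight.div_entropyBump_le_tsum (hu : F.IsWeight u) (hα : IsPenalty α)
    {d : F.lattice → ℝ≥0∞} (hd : ∀ J : F.lattice, weighted μ u J = 0 → d J = 0) (J : F.lattice) :
    d J / (μ J * entropyBump μ α J u) ≤ ∑' j : ℕ, ENNReal.ofReal (1 / ((2 : ℝ) ^ j * α (2 ^ j))) *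
      (F.entropyLevel u j).indicator (fun J => d J / weighted μ u J) J := by
  by_cases h0 : weighted μ u J = 0
  · simp [hd J h0]
  by_cases hfin : llogl μ J u = ∞
  · simp [entropyBump, hfin, (F.measure_pos_of_mem_lattice J.2).ne']
  obtain ⟨j, hj⟩ := exists_nat_pow_near (hu.one_le_entropyRatio J.2 h0 hfin) one_lt_two
  have hJ : J ∈ F.entropyLevel u j := ⟨h0, hfin, hj⟩
  refine (hu.div_entropyBump_le hα (d J) hJ).trans (le_trans ?_ (ENNReal.le_tsum j))
  rw [indicator_of_mem hJ]

theorem CarlesonBound.div_entropyBump (hu : F.IsWeight u) (hα : IsPenalty α)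
    {d : F.lattice → ℝ≥0∞} {L : ℝ≥0∞} (hd0 : ∀ J : F.lattice, weighted μ u J = 0 → d J = 0)
    (hd : F.CarlesonBound (fun J => d J / weighted μ u J) fun I => L * (μ I * llogl μ I u)) :
    F.CarlesonBound (fun J => d J / (μ J * entropyBump μ α J u))
      fun I => ENNReal.ofReal (4 * penaltyConst α) * L * weighted μ u I := by
  intro I
  set q : ℕ → ℝ := fun j => 1 / ((2 : ℝ) ^ j * α (2 ^ j))
  have hq : ∀ j, 0 ≤ q j := fun j => (one_div_pos.2 (hα.mul_pos (one_le_pow₀ one_le_two))).le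
  calc F.sumBelow (fun J => d J / (μ J * entropyBump μ α J u)) I
      ≤ F.sumBelow (fun J => ∑' j, ENNReal.ofReal (q j) *
          (F.entropyLevel u j).indicator (fun J => d J / weighted μ u J) J) I :=
        ENNReal.tsum_le_tsum fun J : {J : F.lattice // (J : Set X) ⊆ I} =>
          hu.div_entropyBump_le_tsum hα hd0 J
    _ = ∑' j, ENNReal.ofReal (q j) *
          F.sumBelow ((F.entropyLevel u j).indicator fun J => d J / weighted μ u J) I := by
        simp only [sumBelow]
        rw [ENNReal.tsum_comm]
        simp only [ENNReal.tsum_mul_left]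
    _ ≤ ∑' j, ENNReal.ofReal (q j) * (ENNReal.ofReal (2 ^ (j + 1)) * L * weighted μ u I) := by
        gcongr with j
        exact hd.sumBelow_entropyLevel_le hu j I
    _ = (∑' j, ENNReal.ofReal (q j * 2 ^ (j + 1))) * L * weighted μ u I := by
        simp only [ENNReal.ofReal_mul (hq _), ← mul_assoc, ENNReal.tsum_mul_right]
    _ ≤ ENNReal.ofReal (4 * penaltyConst α) * L * weighted μ u I := by
        gcongr
        exact hα.tsum_dyadic_le

end AtomicFiltration

end EntropyBump

theorem ennreal_add_sq_le (a b : ℝ≥0∞) : (a + b) ^ 2 ≤ 2 * a ^ 2 + 2 * b ^ 2 := by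
  have h := ENNReal.rpow_add_le_mul_rpow_add_rpow a b (one_le_two (α := ℝ))
  norm_num at h
  rwa [mul_add] at h

section SetAverage

variable {X : Type*} [MeasurableSpace X] {ν : Measure X} {I : Set X}

theorem integral_sub_sq_eq_add_average [IsFiniteMeasure ν] {f : X → ℝ} (hf : MemLp f 2 ν) (a : ℝ) :
    ∫ x, (f x - a) ^ 2 ∂ν =
      ∫ x, (f x - ⨍ z, f z ∂ν) ^ 2 ∂ν + ν.real univ * ((⨍ z, f z ∂ν) - a) ^ 2 := by
  set c := ⨍ z, f z ∂ν
  have hexpand : ∀ x, (f x - a) ^ 2 = (f x - c) ^ 2 + (2 * (c - a) * (f x - c) + (c - a) ^ 2) :=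
    fun x => by ring
  have hsq : Integrable (fun x => (f x - c) ^ 2) ν := (hf.sub (memLp_const c)).integrable_sq
  have hlin : Integrable (fun x => 2 * (c - a) * (f x - c)) ν :=
    ((hf.integrable (by norm_num)).sub (integrable_const c)).const_mul _
  simp_rw [hexpand]
  have hrem : Integrable (fun x => 2 * (c - a) * (f x - c) + (c - a) ^ 2) ν :=
    hlin.add (integrable_const _)
  rw [integral_add hsq hrem, integral_add hlin (integrable_const _),
    integral_const_mul, integral_sub_average, integral_const, smul_eq_mul]
  ring

theorem lintegral_enorm_sub_sq_eq_add_average [IsFiniteMeasure ν] {f : X → ℝ} (hf : MemLp f 2 ν)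
    (a : ℝ) : ∫⁻ x, ‖f x - a‖ₑ ^ 2 ∂ν =
      ∫⁻ x, ‖f x - ⨍ z, f z ∂ν‖ₑ ^ 2 ∂ν + ν univ * ‖(⨍ z, f z ∂ν) - a‖ₑ ^ 2 := by
  have hsq : ∀ r : ℝ, ‖r‖ₑ ^ 2 = ENNReal.ofReal (r ^ 2) := fun r => by
    rw [Real.enorm_eq_ofReal_abs, ← ENNReal.ofReal_pow (abs_nonneg r), sq_abs]
  have hofReal : ∀ b : ℝ, ∫⁻ x, ENNReal.ofReal ((f x - b) ^ 2) ∂ν =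
      ENNReal.ofReal (∫ x, (f x - b) ^ 2 ∂ν) := fun b =>
    (ofReal_integral_eq_lintegral_ofReal (hf.sub (memLp_const b)).integrable_sq
      (Eventually.of_forall fun x => sq_nonneg _)).symm
  simp_rw [hsq]
  rw [hofReal, hofReal, integral_sub_sq_eq_add_average hf a,
    ENNReal.ofReal_add (integral_nonneg fun x => sq_nonneg _) (by positivity),
    ENNReal.ofReal_mul measureReal_nonneg, ofReal_measureReal]

theorem integrableOn_of_memLp_two {f : X → ℝ} (hf : MemLp f 2 ν) (hI : ν I ≠ ∞) :
    IntegrableOn f I ν :=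
  have : IsFiniteMeasure (ν.restrict I) := isFiniteMeasure_restrict.2 hI
  (hf.restrict I).integrable one_le_two

theorem measureReal_mul_setAverage (hI : ν I ≠ ∞) (f : X → ℝ) :
    ν.real I * ⨍ x in I, f x ∂ν = ∫ x in I, f x ∂ν := by
  have : IsFiniteMeasure (ν.restrict I) := isFiniteMeasure_restrict.2 hI
  simpa [measureReal_restrict_apply_univ] using measure_smul_average (ν.restrict I) f

theorem measure_mul_enorm (hI : ν I ≠ ∞) (r : ℝ) : ν I * ‖r‖ₑ = ‖ν.real I * r‖ₑ := by
  rw [enorm_mul, Real.enorm_of_nonneg measureReal_nonneg, ofReal_measureReal hI]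

end SetAverage

namespace AtomicFiltration

variable {X : Type*} [MeasurableSpace X] {μ : Measure X} {F : AtomicFiltration μ}
  {u : X → ℝ} {α : ℝ → ℝ} {f : X → ℝ}

section SqDiff

variable {ν : Measure X}

variable (F) in
/-- The square `∑_{K ∈ ch(I)} |⟨f⟩_K - ⟨f⟩_I|² ν(K)` of the `L²(ν)` norm of the martingale
difference of `f` at `I`, with averages taken with respect to `ν`. -/
def sqDiff (ν : Measure X) (I : Set X) (f : X → ℝ) : ℝ≥0∞ :=
  ∑' K : F.children I, ν K * ‖(⨍ x in K, f x ∂ν) - ⨍ x in I, f x ∂ν‖ₑ ^ 2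

/-- The unnormalized variance `∫_I |f - ⟨f⟩_I|² dν`. -/
def localVariance (ν : Measure X) (I : Set X) (f : X → ℝ) : ℝ≥0∞ :=
  ∫⁻ x in I, ‖f x - ⨍ z in I, f z ∂ν‖ₑ ^ 2 ∂ν

theorem setLIntegral_enorm_sub_sq_eq (hf : MemLp f 2 ν) {I : Set X} (hI : ν I ≠ ∞) (a : ℝ) :
    ∫⁻ x in I, ‖f x - a‖ₑ ^ 2 ∂ν =
      localVariance ν I f + ν I * ‖(⨍ z in I, f z ∂ν) - a‖ₑ ^ 2 := by
  have : IsFiniteMeasure (ν.restrict I) := isFiniteMeasure_restrict.2 hI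
  simpa [localVariance] using lintegral_enorm_sub_sq_eq_add_average (hf.restrict I) a

theorem localVariance_le (hf : MemLp f 2 ν) {I : Set X} (hI : ν I ≠ ∞) :
    localVariance ν I f ≤ ∫⁻ x in I, ‖f x‖ₑ ^ 2 ∂ν := by
  have h := setLIntegral_enorm_sub_sq_eq hf hI 0
  simp only [sub_zero] at h
  exact h ▸ le_self_add

theorem sqDiff_add_tsum_localVariance (hν : ∀ I ∈ F.lattice, ν I ≠ ∞) (hf : MemLp f 2 ν)
    {I : Set X} (hI : I ∈ F.lattice) :
    F.sqDiff ν I f + ∑' K : F.children I, localVariance ν K f = localVariance ν I f := by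
  rw [sqDiff, ← ENNReal.tsum_add, localVariance, ← F.tsum_lintegral_children hI]
  refine tsum_congr fun K => ?_
  rw [setLIntegral_enorm_sub_sq_eq hf (hν K (F.mem_lattice_of_mem_children K.2)), add_comm]

theorem tsum_sqDiff_le (hν : ∀ I ∈ F.lattice, ν I ≠ ∞) (hf : MemLp f 2 ν) :
    ∑' I : F.lattice, F.sqDiff ν I f ≤ ∫⁻ x, ‖f x‖ₑ ^ 2 ∂ν := by
  have hvar : F.CarlesonBound (fun I => F.sqDiff ν I f) fun I => localVariance ν I f :=
    carlesonBound_of_superadditive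
      (fun I => le_self_add.trans (sqDiff_add_tsum_localVariance hν hf I.2).le)
      fun I _ => (sqDiff_add_tsum_localVariance hν hf I.2).le
  have henergy : F.CarlesonBound (fun I => F.sqDiff ν I f) (ν.withDensity fun x => ‖f x‖ₑ ^ 2) :=
    hvar.mono (fun _ => le_rfl) fun I => by
      rw [withDensity_apply _ (F.measurableSet_of_mem_lattice I.2)]
      exact localVariance_le hf (hν I I.2)
  simpa using henergy.tsum_le_measure_univ

theorem tsum_measure_mul_enorm_sub_sq_le (ν : Measure X) {I : Set X} (hI : I ∈ F.lattice)
    (f : X → ℝ) :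
    (∑' K : F.children I, ν K * ‖(⨍ x in K, f x ∂ν) - ⨍ x in I, f x ∂ν‖ₑ) ^ 2 ≤
      ν I * F.sqDiff ν I f := by
  have hsq : ∀ r : ℝ≥0∞, (r ^ (1 / 2 : ℝ)) ^ 2 = r := fun r => by
    rw [← ENNReal.rpow_two, ← ENNReal.rpow_mul]; norm_num
  have h := tsum_mul_sq_le (fun K : F.children I => ν (K : Set X) ^ (1 / 2 : ℝ))
    fun K => ν (K : Set X) ^ (1 / 2 : ℝ) * ‖(⨍ x in K, f x ∂ν) - ⨍ x in I, f x ∂ν‖ₑ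
  simp only [mul_pow, hsq] at h
  simp only [← mul_assoc, ← sq, hsq] at h
  rwa [F.tsum_measure_children hI ν] at h

end SqDiff

namespace IsWeight

theorem setIntegral_mul (hu : F.IsWeight u) (f : X → ℝ) {I : Set X} (hI : MeasurableSet I) :
    ∫ x in I, f x * u x ∂μ = ∫ x in I, f x ∂(weighted μ u) := by
  rw [weighted, setIntegral_withDensity_eq_setIntegral_toReal_smul hu.measurable.ennreal_ofReal
    (Eventually.of_forall fun x => ENNReal.ofReal_lt_top) f hI]
  simp only [ENNReal.toReal_ofReal (hu.nonneg _), smul_eq_mul, mul_comm]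

theorem integral_mul (hu : F.IsWeight u) (f : X → ℝ) :
    ∫ x, f x * u x ∂μ = ∫ x, f x ∂(weighted μ u) := by
  simpa using hu.setIntegral_mul f MeasurableSet.univ

theorem integrableOn_mul (hu : F.IsWeight u) (hf : MemLp f 2 (weighted μ u)) {I : Set X}
    (hI : I ∈ F.lattice) : IntegrableOn (fun x => f x * u x) I μ := by
  have h := integrableOn_of_memLp_two hf (hu.weighted_ne_top hI)
  rw [IntegrableOn, weighted, restrict_withDensity (F.measurableSet_of_mem_lattice hI),
    integrable_withDensity_iff_integrable_smul' hu.measurable.ennreal_ofReal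
      (Eventually.of_forall fun x => ENNReal.ofReal_lt_top)] at h
  simpa only [IntegrableOn, ENNReal.toReal_ofReal (hu.nonneg _), smul_eq_mul, mul_comm] using h

theorem weighted_real (hu : F.IsWeight u) {I : Set X} (hI : I ∈ F.lattice) :
    (weighted μ u).real I = μ.real I * ⨍ x in I, u x ∂μ := by
  rw [measureReal_mul_setAverage (F.measure_lt_top_of_mem_lattice hI).ne, Measure.real,
    hu.weighted_apply hI, ENNReal.toReal_ofReal (integral_nonneg hu.nonneg)]

theorem measureReal_mul_average_mul (hu : F.IsWeight u) (f : X → ℝ) {I : Set X}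
    (hI : I ∈ F.lattice) : μ.real I * ⨍ x in I, f x * u x ∂μ =
      (weighted μ u).real I * ⨍ x in I, f x ∂(weighted μ u) := by
  rw [measureReal_mul_setAverage (F.measure_lt_top_of_mem_lattice hI).ne,
    measureReal_mul_setAverage (hu.weighted_ne_top hI),
    hu.setIntegral_mul f (F.measurableSet_of_mem_lattice hI)]

theorem measure_mul_enorm_average_mul (hu : F.IsWeight u) (f : X → ℝ) {I : Set X}
    (hI : I ∈ F.lattice) : μ I * ‖⨍ x in I, f x * u x ∂μ‖ₑ =
      weighted μ u I * ‖⨍ x in I, f x ∂(weighted μ u)‖ₑ := by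
  rw [measure_mul_enorm (F.measure_lt_top_of_mem_lattice hI).ne,
    hu.measureReal_mul_average_mul f hI, ← measure_mul_enorm (hu.weighted_ne_top hI)]

theorem average_mul (hu : F.IsWeight u) (f : X → ℝ) {I : Set X} (hI : I ∈ F.lattice) :
    ⨍ x in I, f x * u x ∂μ = (⨍ x in I, u x ∂μ) * ⨍ x in I, f x ∂(weighted μ u) := by
  refine mul_left_cancel₀ (F.measureReal_pos_of_mem_lattice hI).ne' ?_
  rw [hu.measureReal_mul_average_mul f hI, hu.weighted_real hI, mul_assoc]

theorem diffNorm_mul_le (hu : F.IsWeight u) {I : Set X} (hI : I ∈ F.lattice) (f : X → ℝ) :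
    F.diffNorm I (fun x => f x * u x) ≤
      ∑' K : F.children I, weighted μ u K *
        ‖(⨍ x in K, f x ∂(weighted μ u)) - ⨍ x in I, f x ∂(weighted μ u)‖ₑ +
      ‖⨍ x in I, f x ∂(weighted μ u)‖ₑ * F.diffNorm I u := by
  set c : Set X → ℝ := fun K => ⨍ x in K, f x ∂(weighted μ u)
  rw [diffNorm, diffNorm, ← ENNReal.tsum_mul_left, ← ENNReal.tsum_add]
  refine ENNReal.tsum_le_tsum fun K => ?_
  have hK := F.mem_lattice_of_mem_children K.2
  have hμK := (F.measure_lt_top_of_mem_lattice hK).ne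
  rw [mul_left_comm, ← enorm_mul (c I), measure_mul_enorm hμK, measure_mul_enorm hμK,
    measure_mul_enorm (hu.weighted_ne_top hK), hu.average_mul f hK, hu.average_mul f hI,
    hu.weighted_real hK]
  refine le_of_eq_of_le (congrArg _ ?_) (enorm_add_le _ _)
  ring

theorem diffNorm_mul_eq_zero (hu : F.IsWeight u) {I : Set X} (hI : I ∈ F.lattice)
    (h : weighted μ u I = 0) (f : X → ℝ) : F.diffNorm I (fun x => f x * u x) = 0 := by
  have havg : ∀ K ∈ F.lattice, K ⊆ I → ⨍ x in K, f x * u x ∂μ = 0 := fun K hK hKI => by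
    rw [hu.average_mul f hK]
    simp [Measure.restrict_eq_zero.2 (measure_mono_null hKI h)]
  refine ENNReal.tsum_eq_zero.2 fun K => ?_
  rw [havg I hI subset_rfl, havg K (F.mem_lattice_of_mem_children K.2)
    (F.subset_of_mem_children K.2)]
  simp

theorem diffNorm_mul_sq_le (hu : F.IsWeight u) {I : Set X} (hI : I ∈ F.lattice) (f : X → ℝ) :
    F.diffNorm I (fun x => f x * u x) ^ 2 ≤
      2 * (weighted μ u I * F.sqDiff (weighted μ u) I f) +
      2 * (F.diffNorm I u ^ 2 * ‖⨍ x in I, f x ∂(weighted μ u)‖ₑ ^ 2) := by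
  refine (pow_le_pow_left' (hu.diffNorm_mul_le hI f) 2).trans
    ((ennreal_add_sq_le _ _).trans ?_)
  rw [mul_pow, mul_comm (F.diffNorm I u ^ 2)]
  gcongr
  exact tsum_measure_mul_enorm_sub_sq_le _ hI f

theorem weighted_div_le (hu : F.IsWeight u) (hα : IsPenalty α) {I : Set X} (hI : I ∈ F.lattice) :
    weighted μ u I / (μ I * entropyBump μ α I u) ≤ ENNReal.ofReal (penaltyConst α) := by
  rcases eq_or_ne (weighted μ u I) 0 with h0 | h0
  · simp [h0]
  by_cases hfin : llogl μ I u = ∞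
  · simp [entropyBump, hfin, (F.measure_pos_of_mem_lattice hI).ne']
  have h1 := hu.one_le_entropyRatio hI h0 hfin
  rw [hu.measure_mul_entropyBump α hI h0 hfin]
  refine ENNReal.div_le_of_le_mul ?_
  rw [← mul_assoc, ← ENNReal.ofReal_mul hα.penaltyConst_pos.le]
  refine le_mul_of_one_le_left' (ENNReal.one_le_ofReal.2 ?_)
  exact (div_le_iff₀ (hα.mul_pos h1)).1 (hα.one_div_le_penaltyConst h1)

theorem carlesonBound_diffNorm_sq_div_entropyBump (hu : F.IsWeight u) (hα : IsPenalty α) :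
    F.CarlesonBound (fun J => F.diffNorm J u ^ 2 / (μ J * entropyBump μ α J u))
      fun I => ENNReal.ofReal (4 * penaltyConst α) * 4 * weighted μ u I := by
  refine CarlesonBound.div_entropyBump hu hα (fun J h0 => ?_) fun I => ?_
  · have := hu.diffNorm_mul_eq_zero J.2 h0 fun _ => 1
    simp only [one_mul] at this
    simp [this]
  have hfour : ∀ J : F.lattice, F.diffNorm J u ^ 2 / weighted μ u J =
      4 * (F.diffNorm J u ^ 2 / (4 * weighted μ u J)) := fun J => by
    rw [← mul_div_assoc, ENNReal.mul_div_mul_left _ _ (by simp) (by simp)]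
  have h := hu.carlesonBound_diffNorm_sq I
  simp only [sumBelow, hfour, ENNReal.tsum_mul_left] at h ⊢
  gcongr

theorem tsum_diffNorm_mul_sq_div_le (hu : F.IsWeight u) (hα : IsPenalty α)
    (hf : MemLp f 2 (weighted μ u)) :
    ∑' J : F.lattice, F.diffNorm J (fun x => f x * u x) ^ 2 / (μ J * entropyBump μ α J u) ≤
      ENNReal.ofReal (130 * penaltyConst α) * ∫⁻ x, ‖f x‖ₑ ^ 2 ∂(weighted μ u) := by
  set ν := weighted μ u
  have hν : ∀ I ∈ F.lattice, ν I ≠ ∞ := fun I hI => hu.weighted_ne_top hI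
  have hsplit : ∀ J : F.lattice,
      F.diffNorm J (fun x => f x * u x) ^ 2 / (μ J * entropyBump μ α J u) ≤
        2 * (ENNReal.ofReal (penaltyConst α) * F.sqDiff ν J f) +
        2 * (F.diffNorm J u ^ 2 / (μ J * entropyBump μ α J u) * (⨍⁻ x in J, ‖f x‖ₑ ∂ν) ^ 2) :=
    fun J => by
    calc _ ≤ (2 * (ν J * F.sqDiff ν J f) + 2 * (F.diffNorm J u ^ 2 * ‖⨍ x in J, f x ∂ν‖ₑ ^ 2)) /
          (μ J * entropyBump μ α J u) := by
          gcongr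
          exact hu.diffNorm_mul_sq_le J.2 f
      _ = 2 * (ν J / (μ J * entropyBump μ α J u) * F.sqDiff ν J f) +
          2 * (F.diffNorm J u ^ 2 / (μ J * entropyBump μ α J u) * ‖⨍ x in J, f x ∂ν‖ₑ ^ 2) := by
          simp only [div_eq_mul_inv]
          ring
      _ ≤ _ := by
          gcongr
          · exact hu.weighted_div_le hα J.2
          · exact enorm_integral_le_lintegral_enorm _
  refine (ENNReal.tsum_le_tsum hsplit).trans ?_
  rw [ENNReal.tsum_add, ENNReal.tsum_mul_left, ENNReal.tsum_mul_left, ENNReal.tsum_mul_left]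
  calc _ ≤ 2 * (ENNReal.ofReal (penaltyConst α) * ∫⁻ x, ‖f x‖ₑ ^ 2 ∂ν) +
        2 * (4 * (ENNReal.ofReal (4 * penaltyConst α) * 4) * ∫⁻ x, ‖f x‖ₑ ^ 2 ∂ν) := by
        gcongr
        · exact tsum_sqDiff_le hν hf
        · exact CarlesonBound.tsum_mul_laverage_sq_le (C := (4 * penaltyConst α).toNNReal * 4) hν
            (hu.carlesonBound_diffNorm_sq_div_entropyBump hα) hf.aestronglyMeasurable.enorm
    _ = _ := by
        rw [ENNReal.ofReal_mul (by norm_num), ENNReal.ofReal_mul (by norm_num)]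
        norm_num
        ring

theorem carlesonBound_mul_weighted_sq_div_entropyBump (hu : F.IsWeight u) (hα : IsPenalty α)
    {a : F.lattice → ℝ≥0∞} (ha : F.CarlesonBound (fun J => a J * μ J) μ) :
    F.CarlesonBound (fun J => a J * weighted μ u J ^ 2 / (μ J * entropyBump μ α J u))
      fun I => ENNReal.ofReal (4 * penaltyConst α) * 1 * weighted μ u I := by
  refine CarlesonBound.div_entropyBump hu hα (fun J h0 => by simp [h0]) ?_
  refine (hu.carlesonBound_mul_weighted ha).mono (fun J => ?_) fun I => (one_mul _).ge
  rw [sq, mul_div_assoc]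
  gcongr
  exact ENNReal.div_le_of_le_mul le_rfl

theorem tsum_mul_average_mul_sq_div_le (hu : F.IsWeight u) (hα : IsPenalty α)
    {a : F.lattice → ℝ≥0∞} (ha : F.CarlesonBound (fun J => a J * μ J) μ)
    (hf : MemLp f 2 (weighted μ u)) :
    ∑' J : F.lattice,
        a J * (μ J * ‖⨍ x in J, f x * u x ∂μ‖ₑ) ^ 2 / (μ J * entropyBump μ α J u) ≤
      ENNReal.ofReal (16 * penaltyConst α) * ∫⁻ x, ‖f x‖ₑ ^ 2 ∂(weighted μ u) := by
  refine (ENNReal.tsum_le_tsum fun J => ?_).trans <|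
    (CarlesonBound.tsum_mul_laverage_sq_le (C := (4 * penaltyConst α).toNNReal * 1)
      (fun I hI => hu.weighted_ne_top hI) (hu.carlesonBound_mul_weighted_sq_div_entropyBump hα ha)
      hf.aestronglyMeasurable.enorm).trans_eq ?_
  · rw [hu.measure_mul_enorm_average_mul f J.2, mul_pow, ← mul_assoc, ENNReal.mul_div_right_comm]
    gcongr
    exact enorm_integral_le_lintegral_enorm _
  · change 4 * (ENNReal.ofReal (4 * penaltyConst α) * 1) * _ = _
    rw [ENNReal.ofReal_mul (by norm_num), ENNReal.ofReal_mul (by norm_num)]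
    norm_num
    ring

end IsWeight

end AtomicFiltration

section MartingaleDifference

namespace AtomicFiltration

variable {X : Type*} [MeasurableSpace X] {μ : Measure X} {F : AtomicFiltration μ}
  {I : Set X} {t H f : X → ℝ}

theorem expect_of_mem {x : X} (hx : x ∈ I) (f : X → ℝ) : F.expect I f x = ⨍ y in I, f y ∂μ :=
  indicator_of_mem hx _

theorem expect_of_notMem {x : X} (hx : x ∉ I) (f : X → ℝ) : F.expect I f x = 0 :=
  indicator_of_notMem hx _

theorem mdiff_of_mem (K : F.children I) {x : X} (hx : x ∈ (K : Set X)) (f : X → ℝ) :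
    F.mdiff I f x = (⨍ y in (K : Set X), f y ∂μ) - ⨍ y in I, f y ∂μ := by
  rw [mdiff, expect_of_mem (F.subset_of_mem_children K.2 hx), tsum_eq_single K, expect_of_mem hx]
  intro J hJ
  exact expect_of_notMem (fun hxJ =>
    Set.disjoint_left.1 (F.pairwise_disjoint_children I hJ) hxJ hx) f

theorem mdiff_of_notMem {x : X} (hx : x ∉ I) (f : X → ℝ) : F.mdiff I f x = 0 := by
  rw [mdiff, expect_of_notMem hx, sub_zero]
  exact (tsum_congr fun K : F.children I =>
    expect_of_notMem (fun hxK => hx (F.subset_of_mem_children K.2 hxK)) f).trans tsum_zero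

variable (F) in
/-- A function supported on `I` and constant on the children of `I`. -/
structure IsChildConst (I : Set X) (t : X → ℝ) : Prop where
  eq_of_mem : ∀ K ∈ F.children I, ∀ x ∈ K, ∀ y ∈ K, t x = t y
  eq_zero : ∀ x ∉ I, t x = 0

namespace IsChildConst

theorem const_mul (ht : F.IsChildConst I t) (a : ℝ) : F.IsChildConst I fun x => a * t x where
  eq_of_mem K hK x hx y hy := by simp only [ht.eq_of_mem K hK x hx y hy]
  eq_zero x hx := by simp only [ht.eq_zero x hx, mul_zero]

theorem tsum {ι : Type*} {t : ι → X → ℝ} (ht : ∀ i, F.IsChildConst I (t i)) :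
    F.IsChildConst I fun x => ∑' i, t i x where
  eq_of_mem K hK x hx y hy := tsum_congr fun i => (ht i).eq_of_mem K hK x hx y hy
  eq_zero x hx := (tsum_congr fun i => (ht i).eq_zero x hx).trans tsum_zero

theorem indicator_eq (ht : F.IsChildConst I t) : I.indicator t = t :=
  indicator_eq_self.2 fun x hx => by_contra fun h => hx (ht.eq_zero x h)

theorem measurable (ht : F.IsChildConst I t) (hI : I ∈ F.lattice) : Measurable t := by
  intro S hS
  have h : t ⁻¹' S ∩ I = ⋃ K ∈ {K : F.children I | (K : Set X) ⊆ t ⁻¹' S}, (K : Set X) := by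
    refine subset_antisymm (fun x ⟨hxS, hxI⟩ => ?_) (iUnion₂_subset fun K hK =>
      subset_inter hK (F.subset_of_mem_children K.2))
    obtain ⟨K, hK, hxK⟩ := F.exists_mem_children_mem hI hxI
    exact mem_biUnion (x := (⟨K, hK⟩ : F.children I))
      (fun y hy => by rwa [mem_preimage, ht.eq_of_mem K hK y hy x hxK]) hxK
  rw [← ht.indicator_eq, indicator_preimage, Set.ite, h]
  exact (MeasurableSet.biUnion (to_countable _) fun K _ => F.measurableSet_child K).union
    ((measurable_zero hS).diff (F.measurableSet_of_mem_lattice hI))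

theorem setIntegral_eq (ht : F.IsChildConst I t) (H : X → ℝ) :
    ∫ x in I, t x * H x ∂μ = ∫ x, t x * H x ∂μ :=
  setIntegral_eq_integral_of_forall_compl_eq_zero fun x hx => by rw [ht.eq_zero x hx, zero_mul]

theorem lintegral_enorm_eq (ht : F.IsChildConst I t) :
    ∫⁻ x, ‖t x‖ₑ ∂μ = ∫⁻ x in I, ‖t x‖ₑ ∂μ :=
  (setLIntegral_eq_of_support_subset fun x hx =>
    by_contra fun h => hx (by simp [ht.eq_zero x h])).symm

theorem average_mul (ht : F.IsChildConst I t) (K : F.children I) {x : X} (hx : x ∈ (K : Set X))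
    (H : X → ℝ) : ⨍ y in (K : Set X), t y * H y ∂μ = t x * ⨍ y in (K : Set X), H y ∂μ := by
  rw [setAverage_eq, setAverage_eq, setIntegral_congr_fun (F.measurableSet_child K)
    fun y hy => by simp only [ht.eq_of_mem K K.2 y hy x hx]; rfl, integral_const_mul, smul_eq_mul,
    smul_eq_mul, mul_left_comm]

end IsChildConst

theorem isChildConst_mdiff (I : Set X) (f : X → ℝ) : F.IsChildConst I (F.mdiff I f) where
  eq_of_mem K hK x hx y hy := by rw [mdiff_of_mem ⟨K, hK⟩ hx, mdiff_of_mem ⟨K, hK⟩ hy]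
  eq_zero x hx := mdiff_of_notMem hx f

theorem lintegral_enorm_mdiff (hI : I ∈ F.lattice) (f : X → ℝ) :
    ∫⁻ x, ‖F.mdiff I f x‖ₑ ∂μ = F.diffNorm I f := by
  rw [(isChildConst_mdiff I f).lintegral_enorm_eq, ← F.tsum_lintegral_children hI, diffNorm]
  refine tsum_congr fun K => ?_
  rw [setLIntegral_congr_fun (F.measurableSet_child K) fun x hx => by rw [mdiff_of_mem K hx],
    setLIntegral_const, mul_comm]

theorem measure_mul_enorm_average_le (hI : I ∈ F.lattice) (f : X → ℝ) :
    μ I * ‖⨍ x in I, f x ∂μ‖ₑ ≤ ∫⁻ x in I, ‖f x‖ₑ ∂μ := by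
  have hμI := (F.measure_lt_top_of_mem_lattice hI).ne
  rw [measure_mul_enorm hμI, measureReal_mul_setAverage hμI]
  exact enorm_integral_le_lintegral_enorm _

theorem diffNorm_le (hI : I ∈ F.lattice) (f : X → ℝ) :
    F.diffNorm I f ≤ 2 * ∫⁻ x in I, ‖f x‖ₑ ∂μ := by
  calc F.diffNorm I f
      ≤ ∑' K : F.children I, ((∫⁻ x in (K : Set X), ‖f x‖ₑ ∂μ) +
          μ (K : Set X) * ‖⨍ x in I, f x ∂μ‖ₑ) := by
        refine ENNReal.tsum_le_tsum fun K => (mul_le_mul_right enorm_sub_le _).trans ?_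
        rw [mul_add]
        gcongr
        exact measure_mul_enorm_average_le (F.mem_lattice_of_mem_children K.2) f
    _ = (∫⁻ x in I, ‖f x‖ₑ ∂μ) + μ I * ‖⨍ x in I, f x ∂μ‖ₑ := by
        rw [ENNReal.tsum_add, F.tsum_lintegral_children hI, ENNReal.tsum_mul_right,
          F.tsum_measure_children hI]
    _ ≤ 2 * ∫⁻ x in I, ‖f x‖ₑ ∂μ := by
        rw [two_mul]
        gcongr
        exact measure_mul_enorm_average_le hI f

theorem diffNorm_ne_top (hI : I ∈ F.lattice) (hf : IntegrableOn f I μ) : F.diffNorm I f ≠ ∞ :=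
  ne_top_of_le_ne_top (ENNReal.mul_ne_top (by norm_num) hf.2.ne) (diffNorm_le hI f)

theorem integrable_mdiff (hI : I ∈ F.lattice) (hf : IntegrableOn f I μ) :
    Integrable (F.mdiff I f) μ :=
  ⟨((isChildConst_mdiff I f).measurable hI).aestronglyMeasurable,
    (lintegral_enorm_mdiff hI f).trans_lt (diffNorm_ne_top hI hf).lt_top⟩

theorem integral_mdiff (hI : I ∈ F.lattice) (hf : IntegrableOn f I μ) :
    ∫ x, F.mdiff I f x ∂μ = 0 := by
  have : IsFiniteMeasure (μ.restrict I) := ⟨by simpa using F.measure_lt_top_of_mem_lattice hI⟩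
  have hsub : IntegrableOn (fun x => f x - ⨍ y in I, f y ∂μ) I μ := hf.sub (integrable_const _)
  have hchild : ∀ K : F.children I, ∫ x in (K : Set X), F.mdiff I f x ∂μ =
      ∫ x in (K : Set X), (f x - ⨍ y in I, f y ∂μ) ∂μ := by
    intro K
    have hK := (F.measure_lt_top_of_mem_lattice (F.mem_lattice_of_mem_children K.2)).ne
    rw [setIntegral_congr_fun (F.measurableSet_child K) fun x hx => mdiff_of_mem K hx f,
      integral_sub (hf.mono_set (F.subset_of_mem_children K.2)) (integrableOn_const hK),
      setIntegral_const, setIntegral_const, smul_sub, smul_eq_mul, measureReal_mul_setAverage hK]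
  have h := F.hasSum_integral_children hI (integrable_mdiff hI hf).integrableOn
  simp only [hchild] at h
  have hI0 := h.unique (F.hasSum_integral_children hI hsub)
  rw [integral_sub_average] at hI0
  simpa using ((isChildConst_mdiff I f).setIntegral_eq fun _ => 1).symm.trans (by simpa using hI0)

/-- The averaging `f ↦ ∑_{K ∈ ch(I)} 𝔼_K f` is self-adjoint and fixes `t`. -/
theorem IsChildConst.integral_mul_mdiff (ht : F.IsChildConst I t) (hI : I ∈ F.lattice)
    (hti : Integrable t μ) (ht0 : ∫ x, t x ∂μ = 0)
    (htH : IntegrableOn (fun x => t x * H x) I μ) :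
    ∫ x, t x * F.mdiff I H x ∂μ = ∫ x, t x * H x ∂μ := by
  have hμI := (F.measure_lt_top_of_mem_lattice hI).ne
  have hIm := F.measurableSet_of_mem_lattice hI
  have hind : Integrable (I.indicator fun _ => ⨍ y in I, t y * H y ∂μ) μ :=
    (integrableOn_const hμI).integrable_indicator hIm
  have hkey : ∀ x, t x * F.mdiff I H x = F.mdiff I (fun y => t y * H y) x +
      I.indicator (fun _ => ⨍ y in I, t y * H y ∂μ) x - (⨍ y in I, H y ∂μ) * t x := by
    intro x
    by_cases hx : x ∈ I
    · obtain ⟨K, hK, hxK⟩ := F.exists_mem_children_mem hI hx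
      rw [mdiff_of_mem ⟨K, hK⟩ hxK, mdiff_of_mem ⟨K, hK⟩ hxK, ht.average_mul ⟨K, hK⟩ hxK,
        indicator_of_mem hx]
      ring
    · simp [ht.eq_zero x hx, mdiff_of_notMem hx, hx]
  have hadd : Integrable (fun x => F.mdiff I (fun y => t y * H y) x +
      I.indicator (fun _ => ⨍ y in I, t y * H y ∂μ) x) μ := (integrable_mdiff hI htH).add hind
  simp only [hkey]
  rw [integral_sub hadd (hti.const_mul _), integral_add (integrable_mdiff hI htH) hind,
    integral_mdiff hI htH, integral_const_mul, ht0, integral_indicator hIm, setIntegral_const,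
    smul_eq_mul, measureReal_mul_setAverage hμI, ht.setIntegral_eq, mul_zero, zero_add, sub_zero]

variable (F) in
/-- A function supported on `I`, constant on the children of `I`, of mean zero and bounded by the
finite number `β`. All terms of the operators in question are of this kind, except for those of a
sparse operator. -/
structure IsHaarFn (I : Set X) (t : X → ℝ) (β : ℝ≥0∞) : Prop where
  isChildConst : F.IsChildConst I t
  enorm_le : ∀ x, ‖t x‖ₑ ≤ β
  ne_top : β ≠ ∞
  integral_eq_zero : ∫ x, t x ∂μ = 0

namespace IsHaarFn

variable {β : ℝ≥0∞}

theorem norm_le (ht : F.IsHaarFn I t β) (x : X) : ‖t x‖ ≤ β.toReal := by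
  simpa using ENNReal.toReal_mono ht.ne_top (ht.enorm_le x)

theorem memLp (ht : F.IsHaarFn I t β) (hI : I ∈ F.lattice) {ρ : Measure X} (hρ : ρ I ≠ ∞)
    (p : ℝ≥0∞) : MemLp t p ρ := by
  have : IsFiniteMeasure (ρ.restrict I) := ⟨by simpa using hρ.lt_top⟩
  rw [← ht.isChildConst.indicator_eq,
    memLp_indicator_iff_restrict (F.measurableSet_of_mem_lattice hI)]
  exact MemLp.of_bound (ht.isChildConst.measurable hI).aestronglyMeasurable _
    (Eventually.of_forall ht.norm_le)

theorem enorm_integral_mul_le (ht : F.IsHaarFn I t β) (hI : I ∈ F.lattice)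
    (hH : IntegrableOn H I μ) : ‖∫ x, t x * H x ∂μ‖ₑ ≤ β * F.diffNorm I H := by
  have hti : Integrable t μ :=
    memLp_one_iff_integrable.1 (ht.memLp hI (F.measure_lt_top_of_mem_lattice hI).ne 1)
  have htH : IntegrableOn (fun x => t x * H x) I μ :=
    hH.bdd_mul (ht.isChildConst.measurable hI).aestronglyMeasurable
      (Eventually.of_forall ht.norm_le)
  rw [← ht.isChildConst.integral_mul_mdiff hI hti ht.integral_eq_zero htH]
  calc ‖∫ x, t x * F.mdiff I H x ∂μ‖ₑ
      ≤ ∫⁻ x, ‖t x * F.mdiff I H x‖ₑ ∂μ := enorm_integral_le_lintegral_enorm _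
    _ ≤ ∫⁻ x, β * ‖F.mdiff I H x‖ₑ ∂μ := by
        gcongr with x
        rw [enorm_mul]
        gcongr
        exact ht.enorm_le x
    _ = β * F.diffNorm I H := by
        rw [lintegral_const_mul' _ _ ht.ne_top, lintegral_enorm_mdiff hI]

end IsHaarFn

end AtomicFiltration

end MartingaleDifference

section Terms

namespace AtomicFiltration

variable {X : Type*} [MeasurableSpace X] {μ : Measure X} {F : AtomicFiltration μ}

section DiffSpace

variable {I : F.lattice} {h : X → ℝ}

theorem isChildConst_of_mem_diffSpace (hh : h ∈ F.diffSpace I) : F.IsChildConst I h := by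
  obtain ⟨f, -, rfl⟩ := hh
  exact isChildConst_mdiff _ f

theorem integrable_of_mem_diffSpace (hh : h ∈ F.diffSpace I) : Integrable h μ := by
  obtain ⟨f, hf, rfl⟩ := hh
  exact integrable_mdiff I.2 (integrableOn_of_memLp_two hf (F.measure_lt_top_of_mem_lattice I.2).ne)

theorem integral_eq_zero_of_mem_diffSpace (hh : h ∈ F.diffSpace I) : ∫ x, h x ∂μ = 0 := by
  obtain ⟨f, hf, rfl⟩ := hh
  exact integral_mdiff I.2 (integrableOn_of_memLp_two hf (F.measure_lt_top_of_mem_lattice I.2).ne)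

theorem enorm_le_eLpNorm_top_of_mem_diffSpace (hh : h ∈ F.diffSpace I) (x : X) :
    ‖h x‖ₑ ≤ eLpNorm h ∞ μ := by
  have hc := isChildConst_of_mem_diffSpace hh
  by_cases hx : x ∈ (I : Set X)
  · obtain ⟨K, hK, hxK⟩ := F.exists_mem_children_mem I.2 hx
    by_contra hlt
    have hsub : K ⊆ {y | ¬ ‖h y‖ₑ ≤ eLpNorm h ∞ μ} := fun y hy => by
      rwa [mem_ofPred_eq, hc.eq_of_mem K hK y hy x hxK]
    exact (F.measure_pos_of_mem_lattice (F.mem_lattice_of_mem_children hK)).ne'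
      (measure_mono_null hsub (enorm_ae_le_eLpNormEssSup h μ))
  · simp [hc.eq_zero x hx]

theorem integral_mul_mdiff_indicator (hh : h ∈ F.diffSpace I) (K : F.children I) {x : X}
    (hx : x ∈ (K : Set X)) :
    ∫ y, h y * F.mdiff I ((K : Set X).indicator fun _ => 1) y ∂μ = μ.real (K : Set X) * h x := by
  have hc := isChildConst_of_mem_diffSpace hh
  have hmul : (fun y => h y * (K : Set X).indicator (fun _ => (1 : ℝ)) y) =
      (K : Set X).indicator h := by
    funext y
    by_cases hy : y ∈ (K : Set X) <;> simp [hy]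
  have hint : Integrable ((K : Set X).indicator h) μ :=
    (integrable_of_mem_diffSpace hh).indicator (F.measurableSet_child K)
  rw [hc.integral_mul_mdiff I.2 (integrable_of_mem_diffSpace hh)
    (integral_eq_zero_of_mem_diffSpace hh) (by rw [hmul]; exact hint.integrableOn), hmul,
    integral_indicator (F.measurableSet_child K),
    setIntegral_congr_fun (F.measurableSet_child K) fun y hy => hc.eq_of_mem K K.2 y hy x hx,
    setIntegral_const, smul_eq_mul]

end DiffSpace

variable {I : Set X} {U : Set X}

theorem diffNorm_indicator_le (hI : I ∈ F.lattice) (hU : MeasurableSet U) :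
    F.diffNorm I (U.indicator fun _ => 1) ≤ 2 * μ (I ∩ U) := by
  refine (diffNorm_le hI _).trans_eq ?_
  simp_rw [enorm_indicator_eq_indicator_enorm, enorm_one]
  rw [lintegral_indicator hU, setLIntegral_one, Measure.restrict_apply hU, inter_comm]

theorem average_indicator_compl {E : Set X} (hE : E ∈ F.lattice) (hU : MeasurableSet U) :
    ⨍ x in E, Uᶜ.indicator (fun _ => (1 : ℝ)) x ∂μ =
      1 - ⨍ x in E, U.indicator (fun _ => (1 : ℝ)) x ∂μ := by
  have hE0 := (F.measure_pos_of_mem_lattice hE).ne'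
  have hEt := (F.measure_lt_top_of_mem_lattice hE).ne
  have h1 : IntegrableOn (fun _ : X => (1 : ℝ)) E μ := integrableOn_const hEt
  calc ⨍ x in E, Uᶜ.indicator (fun _ => (1 : ℝ)) x ∂μ
      = ⨍ x in E, (1 - U.indicator (fun _ => (1 : ℝ)) x) ∂μ := by rw [indicator_compl]; rfl
    _ = (⨍ _ in E, (1 : ℝ) ∂μ) - ⨍ x in E, U.indicator (fun _ => (1 : ℝ)) x ∂μ := by
        simp only [setAverage_eq]
        rw [integral_sub h1 (h1.indicator hU), smul_sub]
    _ = 1 - ⨍ x in E, U.indicator (fun _ => (1 : ℝ)) x ∂μ := by rw [setAverage_const hE0 hEt]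

theorem diffNorm_indicator_compl (hI : I ∈ F.lattice) (hU : MeasurableSet U) :
    F.diffNorm I (Uᶜ.indicator fun _ => 1) = F.diffNorm I (U.indicator fun _ => 1) := by
  refine tsum_congr fun K => ?_
  rw [average_indicator_compl hI hU,
    average_indicator_compl (F.mem_lattice_of_mem_children K.2) hU, sub_sub_sub_cancel_left,
    enorm_sub_rev]

theorem mdiff_finsetSum {ι : Type*} (hI : I ∈ F.lattice) (s : Finset ι) {f : ι → X → ℝ}
    (hf : ∀ i, MemLp (f i) 2 μ) : F.mdiff I (∑ i ∈ s, f i) = ∑ i ∈ s, F.mdiff I (f i) := by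
  classical
  induction s using Finset.induction_on with
  | empty => simpa using F.mdiff_smul I 0 0
  | insert i s hi ih =>
    rw [Finset.sum_insert hi, Finset.sum_insert hi, ← ih,
      F.mdiff_add hI (hf i) (memLp_finsetSum' s fun j _ => hf j)]

namespace HaarShift

variable (T : F.HaarShift) (I : F.lattice)

theorem enorm_integral_op_mul_le (h g : F.diffSpace I) :
    ‖∫ x, (T.op I h : X → ℝ) x * (g : X → ℝ) x ∂μ‖ₑ ≤
      (μ (I : Set X))⁻¹ * (∫⁻ x, ‖(h : X → ℝ) x‖ₑ ∂μ) * ∫⁻ x, ‖(g : X → ℝ) x‖ₑ ∂μ := by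
  have habs : |∫ x, (T.op I h : X → ℝ) x * (g : X → ℝ) x ∂μ| ≤
      (μ.real (I : Set X))⁻¹ * (∫ x, |(h : X → ℝ) x| ∂μ) * ∫ x, |(g : X → ℝ) x| ∂μ := by
    refine abs_le'.2 ⟨T.bound I h g, ?_⟩
    simpa [integral_neg] using T.bound I h (-g)
  have hI0 := F.measureReal_pos_of_mem_lattice I.2
  have hIμ : ENNReal.ofReal (μ.real (I : Set X)) = μ I :=
    ofReal_measureReal (F.measure_lt_top_of_mem_lattice I.2).ne
  rw [Real.enorm_eq_ofReal_abs]
  refine (ENNReal.ofReal_le_ofReal habs).trans_eq ?_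
  simp_rw [← Real.norm_eq_abs]
  rw [ENNReal.ofReal_mul (by positivity), ENNReal.ofReal_mul (by positivity),
    ENNReal.ofReal_inv_of_pos hI0, hIμ,
    ofReal_integral_norm_eq_lintegral_enorm (integrable_of_mem_diffSpace h.2),
    ofReal_integral_norm_eq_lintegral_enorm (integrable_of_mem_diffSpace g.2)]

/-- Pairing with `Δ_I 1_K` recovers the value on the child `K`. -/
theorem enorm_op_le (h : F.diffSpace I) (x : X) :
    ‖(T.op I h : X → ℝ) x‖ₑ ≤ 2 / μ (I : Set X) * ∫⁻ y, ‖(h : X → ℝ) y‖ₑ ∂μ := by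
  by_cases hx : x ∈ (I : Set X)
  · obtain ⟨K, hK, hxK⟩ := F.exists_mem_children_mem I.2 hx
    have hKl := F.mem_lattice_of_mem_children hK
    have hK0 := (F.measure_pos_of_mem_lattice hKl).ne'
    have hKt := (F.measure_lt_top_of_mem_lattice hKl).ne
    have hpair := T.enorm_integral_op_mul_le I h ⟨_, F.mdiff_indicator_mem I hK⟩
    rw [integral_mul_mdiff_indicator (T.op I h).2 ⟨K, hK⟩ hxK, ← measure_mul_enorm hKt,
      lintegral_enorm_mdiff I.2] at hpair
    have hnorm : F.diffNorm I (K.indicator fun _ => 1) ≤ 2 * μ K := by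
      simpa [inter_eq_right.2 (F.subset_of_mem_children hK)] using
        diffNorm_indicator_le I.2 (F.measurableSet_of_mem_lattice hKl)
    rw [← ENNReal.mul_le_mul_iff_right hK0 hKt]
    calc μ K * ‖(T.op I h : X → ℝ) x‖ₑ
        ≤ (μ (I : Set X))⁻¹ * (∫⁻ y, ‖(h : X → ℝ) y‖ₑ ∂μ) * (2 * μ K) :=
          hpair.trans (mul_le_mul_right hnorm _)
      _ = μ K * (2 / μ (I : Set X) * ∫⁻ y, ‖(h : X → ℝ) y‖ₑ ∂μ) := by
          rw [div_eq_mul_inv]; ring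
  · simp [(isChildConst_of_mem_diffSpace (T.op I h).2).eq_zero x hx]

/-- The function `T_I (Δ_I 1_K)`, for a child `K` of `I`. -/
def opIndicator (K : F.children (I : Set X)) : X → ℝ :=
  T.op I ⟨F.mdiff I ((K : Set X).indicator fun _ => 1), F.mdiff_indicator_mem I K.2⟩

theorem opIndicator_mem_diffSpace (K : F.children (I : Set X)) :
    T.opIndicator I K ∈ F.diffSpace I :=
  (T.op I _).2

theorem sum_opIndicator_eq_op (s : Finset (F.children (I : Set X))) :
    ∃ h : F.diffSpace I, (h : X → ℝ) = F.mdiff I ((⋃ K ∈ s, (K : Set X)).indicator fun _ => 1) ∧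
      ∑ K ∈ s, T.opIndicator I K = T.op I h := by
  refine ⟨∑ K ∈ s, ⟨_, F.mdiff_indicator_mem I K.2⟩, ?_, ?_⟩
  · have hsum : ((⋃ K ∈ s, (K : Set X)).indicator fun _ => (1 : ℝ)) =
        ∑ K ∈ s, (K : Set X).indicator fun _ => 1 := by
      funext x
      rw [Finset.indicator_biUnion_apply _ _ fun K _ L _ h => F.pairwise_disjoint_children I h,
        Finset.sum_apply]
    rw [hsum, mdiff_finsetSum I.2 s fun K => memLp_indicator_const 2 (F.measurableSet_child K) 1
      (Or.inr (F.measure_lt_top_of_mem_lattice (F.mem_lattice_of_mem_children K.2)).ne)]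
    simp
  · rw [map_sum]
    simp [opIndicator]

theorem enorm_sum_opIndicator_le (s : Finset (F.children (I : Set X))) (x : X) :
    ‖∑ K ∈ s, T.opIndicator I K x‖ₑ ≤
      4 / μ (I : Set X) * ∑' K : {K : F.children (I : Set X) // K ∉ s}, μ (K : Set X) := by
  obtain ⟨h, hh, hsum⟩ := T.sum_opIndicator_eq_op I s
  have hU : MeasurableSet (⋃ K ∈ s, (K : Set X)) :=
    s.measurableSet_biUnion fun K _ => F.measurableSet_child K
  have hsub : (I : Set X) ∩ (⋃ K ∈ s, (K : Set X))ᶜ ⊆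
      ⋃ K : {K : F.children (I : Set X) // K ∉ s}, (K : Set X) := by
    rintro y ⟨hyI, hyU⟩
    obtain ⟨K, hK, hyK⟩ := F.exists_mem_children_mem I.2 hyI
    exact mem_iUnion.2 ⟨⟨⟨K, hK⟩, fun hs => hyU (mem_biUnion (x := (⟨K, hK⟩ : F.children I))
      hs hyK)⟩, hyK⟩
  calc ‖∑ K ∈ s, T.opIndicator I K x‖ₑ
      = ‖(T.op I h : X → ℝ) x‖ₑ := by rw [← hsum, Finset.sum_apply]
    _ ≤ 2 / μ (I : Set X) * F.diffNorm I ((⋃ K ∈ s, (K : Set X)).indicator fun _ => 1) := by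
        rw [← lintegral_enorm_mdiff I.2, ← hh]
        exact T.enorm_op_le I h x
    _ ≤ 2 / μ (I : Set X) *
          (2 * ∑' K : {K : F.children (I : Set X) // K ∉ s}, μ (K : Set X)) := by
        rw [← diffNorm_indicator_compl I.2 hU]
        gcongr
        refine (diffNorm_indicator_le I.2 hU.compl).trans ?_
        gcongr
        exact (measure_mono hsub).trans (measure_iUnion_le _)
    _ = _ := by
        rw [div_eq_mul_inv, div_eq_mul_inv, show (4 : ℝ≥0∞) = 2 * 2 by norm_num]
        ring

theorem enorm_opIndicator_le (K : F.children (I : Set X)) (x : X) :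
    ‖T.opIndicator I K x‖ₑ ≤ 4 / μ (I : Set X) * μ (K : Set X) := by
  refine (T.enorm_op_le I _ x).trans ?_
  rw [lintegral_enorm_mdiff I.2]
  refine (mul_le_mul_right (diffNorm_indicator_le I.2 (F.measurableSet_child K)) _).trans_eq ?_
  rw [inter_eq_right.2 (F.subset_of_mem_children K.2), div_eq_mul_inv, div_eq_mul_inv,
    show (4 : ℝ≥0∞) = 2 * 2 by norm_num]
  ring

/-- The partial sums are `-T_I (Δ_I 1_V)`, where `V` is the union of the remaining children. -/
theorem hasSum_opIndicator (x : X) :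
    HasSum (fun K : F.children (I : Set X) => T.opIndicator I K x) 0 := by
  have hI0 := (F.measure_pos_of_mem_lattice I.2).ne'
  have hsum : ∑' K : F.children (I : Set X), μ (K : Set X) ≠ ∞ := by
    rw [F.tsum_measure_children I.2]
    exact (F.measure_lt_top_of_mem_lattice I.2).ne
  have hlim := ENNReal.Tendsto.const_mul (ENNReal.tendsto_tsum_compl_atTop_zero hsum)
    (Or.inr (ENNReal.div_ne_top (by norm_num : (4 : ℝ≥0∞) ≠ ∞) hI0))
  rw [mul_zero] at hlim
  exact tendsto_zero_iff_enorm_tendsto_zero.2 (tendsto_of_tendsto_of_tendsto_of_le_of_le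
    tendsto_const_nhds hlim (fun _ => zero_le) fun s => T.enorm_sum_opIndicator_le I s x)

/-- The extension `∑_{K ∈ ch(I)} ⟨f⟩_K T_I (Δ_I 1_K)` of `T_I (Δ_I f)` to functions `f` which are
only integrable on `I`. -/
def extension (f : X → ℝ) : X → ℝ := fun x =>
  ∑' K : F.children (I : Set X), (⨍ y in (K : Set X), f y ∂μ) * T.opIndicator I K x

variable {f : X → ℝ}

theorem tsum_enorm_average_mul_le (f : X → ℝ) :
    ∑' K : F.children (I : Set X), ‖⨍ y in (K : Set X), f y ∂μ‖ₑ * μ (K : Set X) ≤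
      ∫⁻ x in (I : Set X), ‖f x‖ₑ ∂μ := by
  rw [← F.tsum_lintegral_children I.2]
  refine ENNReal.tsum_le_tsum fun K => ?_
  rw [mul_comm]
  exact measure_mul_enorm_average_le (F.mem_lattice_of_mem_children K.2) f

theorem summable_average_mul_opIndicator (hf : IntegrableOn f I μ) (x : X) :
    Summable fun K : F.children (I : Set X) =>
      (⨍ y in (K : Set X), f y ∂μ) * T.opIndicator I K x := by
  have hI0 := (F.measure_pos_of_mem_lattice I.2).ne'
  refine Summable.of_enorm (ne_top_of_le_ne_top (ENNReal.mul_ne_top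
    (ENNReal.div_ne_top (by norm_num : (4 : ℝ≥0∞) ≠ ∞) hI0)
    (ne_top_of_le_ne_top hf.2.ne (tsum_enorm_average_mul_le I f))) ?_)
  rw [← ENNReal.tsum_mul_left]
  refine ENNReal.tsum_le_tsum fun K => ?_
  rw [enorm_mul, mul_left_comm]
  gcongr
  exact T.enorm_opIndicator_le I K x

theorem enorm_extension_le (hf : IntegrableOn f I μ) (x : X) :
    ‖T.extension I f x‖ₑ ≤ 4 / μ (I : Set X) * F.diffNorm I f := by
  have hsum := (T.summable_average_mul_opIndicator I hf x).hasSum.sub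
    ((T.hasSum_opIndicator I x).mul_left (⨍ y in (I : Set X), f y ∂μ))
  simp only [mul_zero, sub_zero, ← sub_mul] at hsum
  rw [extension, ← hsum.tsum_eq]
  refine enorm_tsum_le_tsum_enorm.trans ?_
  rw [diffNorm, ← ENNReal.tsum_mul_left]
  refine ENNReal.tsum_le_tsum fun K => ?_
  rw [enorm_mul, ← mul_assoc, mul_comm]
  gcongr
  exact T.enorm_opIndicator_le I K x

theorem isChildConst_extension (f : X → ℝ) : F.IsChildConst I (T.extension I f) :=
  IsChildConst.tsum fun K =>
    (isChildConst_of_mem_diffSpace (T.opIndicator_mem_diffSpace I K)).const_mul _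

theorem integral_extension (hf : IntegrableOn f I μ) : ∫ x, T.extension I f x ∂μ = 0 := by
  have hI0 := (F.measure_pos_of_mem_lattice I.2).ne'
  have hIt := (F.measure_lt_top_of_mem_lattice I.2).ne
  have hmem := T.opIndicator_mem_diffSpace I
  have hnorm : ∀ K : F.children (I : Set X), ∫⁻ x, ‖T.opIndicator I K x‖ₑ ∂μ ≤
      4 / μ (I : Set X) * μ (K : Set X) * μ I := fun K => by
    rw [(isChildConst_of_mem_diffSpace (hmem K)).lintegral_enorm_eq, ← setLIntegral_const]
    exact lintegral_mono fun x => T.enorm_opIndicator_le I K x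
  have hfin : ∑' K : F.children (I : Set X),
      ∫⁻ x, ‖(⨍ y in (K : Set X), f y ∂μ) * T.opIndicator I K x‖ₑ ∂μ ≠ ∞ := by
    refine ne_top_of_le_ne_top (b := 4 / μ (I : Set X) * μ I * ∫⁻ x in (I : Set X), ‖f x‖ₑ ∂μ)
      (ENNReal.mul_ne_top (ENNReal.mul_ne_top (ENNReal.div_ne_top (by norm_num) hI0) hIt)
        hf.2.ne) ?_
    refine le_trans ?_ (mul_le_mul_right (tsum_enorm_average_mul_le I f) _)
    rw [← ENNReal.tsum_mul_left]
    refine ENNReal.tsum_le_tsum fun K => ?_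
    simp_rw [enorm_mul]
    rw [lintegral_const_mul' _ _ enorm_ne_top]
    refine (mul_le_mul_right (hnorm K) _).trans_eq ?_
    ring
  unfold extension
  rw [integral_tsum (fun K => ((integrable_of_mem_diffSpace (hmem K)).const_mul
    (⨍ y in (K : Set X), f y ∂μ)).aestronglyMeasurable) hfin]
  simp [integral_const_mul, integral_eq_zero_of_mem_diffSpace (hmem _)]

theorem isHaarFn_term (hf : IntegrableOn f I μ) :
    F.IsHaarFn I (T.term I f) (4 / μ (I : Set X) * F.diffNorm I f) := by
  have hne := ENNReal.mul_ne_top (ENNReal.div_ne_top (by norm_num : (4 : ℝ≥0∞) ≠ ∞)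
    (F.measure_pos_of_mem_lattice I.2).ne') (diffNorm_ne_top I.2 hf)
  by_cases h : F.mdiff I f ∈ F.diffSpace I
  · have hterm : T.term I f = T.op I ⟨F.mdiff I f, h⟩ := by rw [term, dif_pos h]
    have hmem : T.term I f ∈ F.diffSpace I := hterm ▸ (T.op I _).2
    refine ⟨isChildConst_of_mem_diffSpace hmem, fun x => ?_, hne,
      integral_eq_zero_of_mem_diffSpace hmem⟩
    rw [hterm]
    refine (T.enorm_op_le I _ x).trans ?_
    rw [lintegral_enorm_mdiff I.2]
    gcongr
    norm_num
  · have hterm : T.term I f = T.extension I f := by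
      rw [term, dif_neg h]
      rfl
    rw [hterm]
    exact ⟨T.isChildConst_extension I f, T.enorm_extension_le I hf, hne,
      T.integral_extension I hf⟩

end HaarShift

theorem isHaarFn_paraTerm (b : ∀ I : F.lattice, F.diffSpace I) (I : F.lattice)
    (hb : eLpNorm (b I : X → ℝ) ∞ μ ≠ ∞) (f : X → ℝ) :
    F.IsHaarFn I (F.paraTerm b I f)
      (‖⨍ x in (I : Set X), f x ∂μ‖ₑ * eLpNorm (b I : X → ℝ) ∞ μ) where
  isChildConst := (isChildConst_of_mem_diffSpace (b I).2).const_mul _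
  enorm_le x := by
    rw [paraTerm, enorm_mul]
    gcongr
    exact enorm_le_eLpNorm_top_of_mem_diffSpace (b I).2 x
  ne_top := ENNReal.mul_ne_top enorm_ne_top hb
  integral_eq_zero := by
    simp only [paraTerm]
    rw [integral_const_mul, integral_eq_zero_of_mem_diffSpace (b I).2, mul_zero]

end AtomicFiltration

end Terms

section SquareSummable

theorem tsum_sq_le_of_sq_le {ι : Type*} {z x y : ι → ℝ≥0∞} {A : ℝ≥0∞}
    (h : ∀ i, z i ^ 2 ≤ A * (x i * y i)) : (∑' i, z i) ^ 2 ≤ A * ((∑' i, x i) * ∑' i, y i) := by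
  have hsq : ∀ a : ℝ≥0∞, (a ^ (1 / 2 : ℝ)) ^ 2 = a := fun a => by
    rw [← ENNReal.rpow_two, ← ENNReal.rpow_mul]; norm_num
  have hz : ∀ i, z i ≤ (A * x i) ^ (1 / 2 : ℝ) * y i ^ (1 / 2 : ℝ) := fun i => by
    refine (ENNReal.pow_le_pow_left_iff two_ne_zero).1 ?_
    rw [mul_pow, hsq, hsq, mul_assoc]
    exact h i
  calc (∑' i, z i) ^ 2
      ≤ (∑' i, (A * x i) ^ (1 / 2 : ℝ) * y i ^ (1 / 2 : ℝ)) ^ 2 :=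
        pow_le_pow_left' (ENNReal.tsum_le_tsum hz) 2
    _ ≤ (∑' i, ((A * x i) ^ (1 / 2 : ℝ)) ^ 2) * ∑' i, (y i ^ (1 / 2 : ℝ)) ^ 2 :=
        tsum_mul_sq_le _ _
    _ = A * ((∑' i, x i) * ∑' i, y i) := by
        simp only [hsq]
        rw [ENNReal.tsum_mul_left, mul_assoc]

theorem summable_of_enorm_sum_sq_le {E ι : Type*} [NormedAddCommGroup E] [CompleteSpace E]
    {t : ι → E} {p : ι → ℝ≥0∞} (hp : ∑' i, p i ≠ ∞)
    (h : ∀ s : Finset ι, ‖∑ i ∈ s, t i‖ₑ ^ 2 ≤ ∑ i ∈ s, p i) : Summable t := by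
  rw [summable_iff_vanishing_norm]
  intro ε hε
  obtain ⟨s, hs⟩ := summable_iff_vanishing_norm.1 (ENNReal.summable_toReal hp) (ε ^ 2)
    (by positivity)
  refine ⟨s, fun r hr => lt_of_pow_lt_pow_left₀ 2 hε.le ?_⟩
  have hpr : ∀ i ∈ r, p i ≠ ∞ := fun i _ => ENNReal.ne_top_of_tsum_ne_top hp i
  have hnorm := ENNReal.toReal_mono (ENNReal.sum_ne_top.2 hpr) (h r)
  rw [ENNReal.toReal_pow, toReal_enorm, ENNReal.toReal_sum hpr] at hnorm
  exact hnorm.trans_lt ((le_abs_self _).trans_lt (hs r hr))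

variable {Y : Type*} [MeasurableSpace Y] {ρ : Measure Y} {ι : Type*} {t : ι → Y → ℝ}

theorem eLpNorm_two_sq (ρ : Measure Y) (g : Y → ℝ) : eLpNorm g 2 ρ ^ 2 = ∫⁻ y, ‖g y‖ₑ ^ 2 ∂ρ := by
  rw [eLpNorm_eq_lintegral_rpow_enorm_toReal (by norm_num) (by norm_num), ← ENNReal.rpow_two,
    ← ENNReal.rpow_mul]
  norm_num

theorem lintegral_enorm_sq_ne_top {g : Y → ℝ} (hg : MemLp g 2 ρ) : ∫⁻ y, ‖g y‖ₑ ^ 2 ∂ρ ≠ ∞ := by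
  rw [← eLpNorm_two_sq]
  exact ENNReal.pow_ne_top hg.2.ne

theorem lintegral_enorm_sq_eq_ofReal {g : Y → ℝ} (hg : MemLp g 2 ρ) :
    ∫⁻ y, ‖g y‖ₑ ^ 2 ∂ρ = ENNReal.ofReal (∫ y, g y ^ 2 ∂ρ) := by
  rw [ofReal_integral_eq_lintegral_ofReal hg.integrable_sq
    (Eventually.of_forall fun y => sq_nonneg _)]
  refine lintegral_congr fun y => ?_
  rw [Real.enorm_eq_ofReal_abs, ← ENNReal.ofReal_pow (abs_nonneg _), sq_abs]

theorem lintegral_enorm_sum_sq_le_of_pairing (ht : ∀ i, MemLp (t i) 2 ρ) {s : Finset ι} {B : ℝ≥0∞}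
    (h : ∀ g : Y → ℝ, MemLp g 2 ρ →
      (∑ i ∈ s, ‖∫ y, t i y * g y ∂ρ‖ₑ) ^ 2 ≤ B * ∫⁻ y, ‖g y‖ₑ ^ 2 ∂ρ) :
    ∫⁻ y, ‖∑ i ∈ s, t i y‖ₑ ^ 2 ∂ρ ≤ B := by
  obtain ⟨g, hsum⟩ : ∃ g : Y → ℝ, ∀ y, ∑ i ∈ s, t i y = g y := ⟨_, fun _ => rfl⟩
  have hg : MemLp g 2 ρ := by simpa only [hsum] using memLp_finsetSum s fun i _ => ht i
  have hle : ∫⁻ y, ‖g y‖ₑ ^ 2 ∂ρ ≤ ∑ i ∈ s, ‖∫ y, t i y * g y ∂ρ‖ₑ := by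
    have hpair : ∫ y, g y ^ 2 ∂ρ = ∑ i ∈ s, ∫ y, t i y * g y ∂ρ := by
      have hint : ∀ i ∈ s, Integrable (fun y => t i y * g y) ρ := fun i _ =>
        (ht i).integrable_mul hg
      simp only [← integral_finsetSum s hint, ← Finset.sum_mul, hsum, sq]
    rw [lintegral_enorm_sq_eq_ofReal hg,
      ← Real.enorm_of_nonneg (integral_nonneg fun y => sq_nonneg (g y)), hpair]
    exact enorm_sum_le _ _
  simp only [hsum]
  rcases eq_or_ne (∫⁻ y, ‖g y‖ₑ ^ 2 ∂ρ) 0 with h0 | h0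
  · exact h0.trans_le zero_le
  refine (ENNReal.mul_le_mul_iff_left h0 (lintegral_enorm_sq_ne_top hg)).1 ?_
  rw [← sq]
  exact (pow_le_pow_left' hle 2).trans (h g hg)

theorem exists_tendsto_of_lintegral_enorm_sum_sq_le (ht : ∀ i, MemLp (t i) 2 ρ) {p : ι → ℝ≥0∞}
    (hp : ∑' i, p i ≠ ∞) (h : ∀ s : Finset ι, ∫⁻ y, ‖∑ i ∈ s, t i y‖ₑ ^ 2 ∂ρ ≤ ∑ i ∈ s, p i) :
    ∃ g : Y → ℝ, MemLp g 2 ρ ∧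
      Tendsto (fun s : Finset ι => eLpNorm (fun y => g y - ∑ i ∈ s, t i y) 2 ρ) atTop (𝓝 0) ∧
      ∫⁻ y, ‖g y‖ₑ ^ 2 ∂ρ ≤ ∑' i, p i := by
  have hcoe : ∀ s : Finset ι, (∑ i ∈ s, (ht i).toLp (t i) : Lp ℝ 2 ρ) =ᵐ[ρ] ∑ i ∈ s, t i := by
    intro s
    filter_upwards [Lp.coeFn_finsetSum s fun i => (ht i).toLp (t i),
      (s.eventually_all).2 fun i _ => (ht i).coeFn_toLp] with y hsum hy
    rw [hsum, Finset.sum_apply, Finset.sum_apply]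
    exact Finset.sum_congr rfl hy
  have hnorm : ∀ s : Finset ι, ‖∑ i ∈ s, (ht i).toLp (t i)‖ₑ ^ 2 ≤ ∑ i ∈ s, p i := fun s => by
    rw [Lp.enorm_def, eLpNorm_congr_ae (hcoe s), eLpNorm_two_sq]
    simpa only [Finset.sum_apply] using h s
  obtain ⟨g, hg⟩ := summable_of_enorm_sum_sq_le hp hnorm
  have hlim : Tendsto (fun s : Finset ι => ∑ i ∈ s, (ht i).toLp (t i)) atTop (𝓝 g) := hg
  refine ⟨g, Lp.memLp g, ?_, ?_⟩
  · have hsub := ((tendsto_const_nhds (x := g)).sub hlim).enorm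
    rw [sub_self, enorm_zero] at hsub
    refine hsub.congr fun s => ?_
    rw [Lp.enorm_def]
    refine eLpNorm_congr_ae ?_
    filter_upwards [Lp.coeFn_sub g (∑ i ∈ s, (ht i).toLp (t i)), hcoe s] with y hy hys
    rw [hy, Pi.sub_apply, hys, Finset.sum_apply]
  · rw [← eLpNorm_two_sq, ← Lp.enorm_def]
    exact le_of_tendsto (((ENNReal.continuous_pow 2).tendsto _).comp hlim.enorm)
      (Eventually.of_forall fun s => (hnorm s).trans (ENNReal.sum_le_tsum s))

theorem exists_tendsto_of_pairing_sq_le (ht : ∀ i, MemLp (t i) 2 ρ) {p : ι → ℝ≥0∞}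
    (hp : ∑' i, p i ≠ ∞) {A C : ℝ≥0∞} (hA : A ≠ ∞) (hC : C ≠ ∞)
    (h : ∀ g : Y → ℝ, MemLp g 2 ρ → ∃ r : ι → ℝ≥0∞, ∑' i, r i ≤ C * ∫⁻ y, ‖g y‖ₑ ^ 2 ∂ρ ∧
      ∀ i, ‖∫ y, t i y * g y ∂ρ‖ₑ ^ 2 ≤ A * (p i * r i)) :
    ∃ g : Y → ℝ, MemLp g 2 ρ ∧
      Tendsto (fun s : Finset ι => eLpNorm (fun y => g y - ∑ i ∈ s, t i y) 2 ρ) atTop (𝓝 0) ∧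
      ∫⁻ y, ‖g y‖ₑ ^ 2 ∂ρ ≤ A * C * ∑' i, p i := by
  have hACp : ∑' i, A * C * p i ≠ ∞ := by
    rw [ENNReal.tsum_mul_left]
    exact ENNReal.mul_ne_top (ENNReal.mul_ne_top hA hC) hp
  rw [← ENNReal.tsum_mul_left]
  refine exists_tendsto_of_lintegral_enorm_sum_sq_le ht hACp fun s =>
    lintegral_enorm_sum_sq_le_of_pairing ht fun g hg => ?_
  obtain ⟨r, hr, hpair⟩ := h g hg
  calc (∑ i ∈ s, ‖∫ y, t i y * g y ∂ρ‖ₑ) ^ 2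
      = (∑' i : s, ‖∫ y, t i y * g y ∂ρ‖ₑ) ^ 2 := by
        rw [Finset.tsum_subtype s fun i => ‖∫ y, t i y * g y ∂ρ‖ₑ]
    _ ≤ A * ((∑' i : s, p i) * ∑' i : s, r i) := tsum_sq_le_of_sq_le fun i => hpair i
    _ ≤ A * ((∑ i ∈ s, p i) * (C * ∫⁻ y, ‖g y‖ₑ ^ 2 ∂ρ)) := by
        rw [Finset.tsum_subtype]
        gcongr
        exact (ENNReal.tsum_comp_le_tsum_of_injective Subtype.val_injective r).trans hr
    _ = (∑ i ∈ s, A * C * p i) * ∫⁻ y, ‖g y‖ₑ ^ 2 ∂ρ := by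
        rw [← Finset.mul_sum]
        ring

end SquareSummable

section Duality

theorem mul_div_sq_le_mul_sq_div_mul_sq_div {p r m a b A : ℝ≥0∞} (hm0 : m ≠ 0) (hmt : m ≠ ∞)
    (hab : a * b ≤ A) (hA : A ≠ ∞) (hp : p ^ 2 / (m * a) ≠ ∞) (hr : r ^ 2 / (m * b) ≠ ∞) :
    (p * r / m) ^ 2 ≤ A * (p ^ 2 / (m * a) * (r ^ 2 / (m * b))) := by
  rcases eq_or_ne a 0 with rfl | ha0
  · obtain rfl : p = 0 := by
      by_contra hp0
      exact hp (by rw [mul_zero, ENNReal.div_zero (pow_ne_zero 2 hp0)])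
    simp
  rcases eq_or_ne b 0 with rfl | hb0
  · obtain rfl : r = 0 := by
      by_contra hr0
      exact hr (by rw [mul_zero, ENNReal.div_zero (pow_ne_zero 2 hr0)])
    simp
  have hab' := ne_top_of_le_ne_top hA hab
  have hat : a ≠ ∞ := fun h => hab' (by rw [h, ENNReal.top_mul hb0])
  have hbt : b ≠ ∞ := fun h => hab' (by rw [h, ENNReal.mul_top ha0])
  calc (p * r / m) ^ 2
      = (p * r * m⁻¹) ^ 2 * ((a * a⁻¹) * (b * b⁻¹)) := by
        rw [ENNReal.mul_inv_cancel ha0 hat, ENNReal.mul_inv_cancel hb0 hbt, mul_one, mul_one,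
          div_eq_mul_inv]
    _ = (a * b) * (p ^ 2 / (m * a) * (r ^ 2 / (m * b))) := by
        simp only [div_eq_mul_inv]
        rw [ENNReal.mul_inv (Or.inl hm0) (Or.inl hmt), ENNReal.mul_inv (Or.inl hm0) (Or.inl hmt)]
        ring
    _ ≤ A * (p ^ 2 / (m * a) * (r ^ 2 / (m * b))) := by gcongr

namespace AtomicFiltration

variable {X : Type*} [MeasurableSpace X] {μ : Measure X} {F : AtomicFiltration μ}
  {u v : X → ℝ} {α : ℝ → ℝ}

theorem IsWeight.lintegral_enorm_sq_eq_ofReal_mul (hu : F.IsWeight u) {f : X → ℝ}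
    (hf : MemLp f 2 (weighted μ u)) :
    ∫⁻ x, ‖f x‖ₑ ^ 2 ∂(weighted μ u) = ENNReal.ofReal (∫ x, f x ^ 2 * u x ∂μ) := by
  rw [hu.integral_mul, lintegral_enorm_sq_eq_ofReal hf]

theorem twoWeightBound_of_pairing (hu : F.IsWeight u) (hv : F.IsWeight v) {A : ℝ≥0}
    (hA : ∀ I ∈ F.lattice, entropyBump μ α I u * entropyBump μ α I v ≤ A)
    {ι : Type*} {I : ι → F.lattice} {term : ι → (X → ℝ) → X → ℝ}
    (hmem : ∀ i f, IntegrableOn f (I i) μ → MemLp (term i f) 2 (weighted μ v))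
    {P R : ι → (X → ℝ) → ℝ≥0∞}
    (hpair : ∀ i f h, IntegrableOn f (I i) μ → IntegrableOn h (I i) μ →
      ‖∫ x, term i f x * h x ∂μ‖ₑ ≤ P i f * R i h / μ (I i : Set X))
    {C₁ C₂ : ℝ} (hC₁ : 0 ≤ C₁) (hC₂ : 0 ≤ C₂)
    (hP : ∀ f, MemLp f 2 (weighted μ u) →
      ∑' i, P i (fun x => f x * u x) ^ 2 / (μ (I i : Set X) * entropyBump μ α (I i) u) ≤
        ENNReal.ofReal C₁ * ∫⁻ x, ‖f x‖ₑ ^ 2 ∂(weighted μ u))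
    (hR : ∀ f, MemLp f 2 (weighted μ v) →
      ∑' i, R i (fun x => f x * v x) ^ 2 / (μ (I i : Set X) * entropyBump μ α (I i) v) ≤
        ENNReal.ofReal C₂ * ∫⁻ x, ‖f x‖ₑ ^ 2 ∂(weighted μ v)) :
    TwoWeightBound μ term u v (C₁ * C₂ * A) := by
  intro f hf
  have hfI := fun i => hu.integrableOn_mul hf (I i).2
  have hterm := fun i => hmem i _ (hfI i)
  have hfin : ∀ {C : ℝ} {w : X → ℝ} {g : X → ℝ}, MemLp g 2 (weighted μ w) →
      ENNReal.ofReal C * ∫⁻ x, ‖g x‖ₑ ^ 2 ∂(weighted μ w) ≠ ∞ := fun hg =>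
    ENNReal.mul_ne_top ENNReal.ofReal_ne_top (lintegral_enorm_sq_ne_top hg)
  have hp := ne_top_of_le_ne_top (hfin hf) (hP f hf)
  obtain ⟨g, hg, hlim, hbound⟩ := exists_tendsto_of_pairing_sq_le hterm hp
    (A := A) (C := ENNReal.ofReal C₂) ENNReal.coe_ne_top ENNReal.ofReal_ne_top
    fun g hg => ⟨_, hR g hg, fun i => by
      rw [← hv.integral_mul]
      simp_rw [mul_assoc]
      refine (pow_le_pow_left' (hpair i _ _ (hfI i) (hv.integrableOn_mul hg (I i).2)) 2).trans ?_
      exact mul_div_sq_le_mul_sq_div_mul_sq_div (F.measure_pos_of_mem_lattice (I i).2).ne'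
        (F.measure_lt_top_of_mem_lattice (I i).2).ne (hA (I i) (I i).2) ENNReal.coe_ne_top
        (ENNReal.ne_top_of_tsum_ne_top hp i)
        (ENNReal.ne_top_of_tsum_ne_top (ne_top_of_le_ne_top (hfin hg) (hR g hg)) i)⟩
  refine ⟨g, hg, hterm, hlim, ?_⟩
  have hnn : 0 ≤ ∫ x, f x ^ 2 * u x ∂μ :=
    integral_nonneg fun x => mul_nonneg (sq_nonneg _) (hu.nonneg x)
  refine (ENNReal.ofReal_le_ofReal_iff (by positivity)).1 ?_
  rw [← hv.lintegral_enorm_sq_eq_ofReal_mul hg, ENNReal.ofReal_mul (by positivity),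
    ← hu.lintegral_enorm_sq_eq_ofReal_mul hf, ENNReal.ofReal_mul (by positivity),
    ENNReal.ofReal_mul hC₁, ENNReal.ofReal_coe_nnreal]
  calc ∫⁻ x, ‖g x‖ₑ ^ 2 ∂(weighted μ v)
      ≤ A * ENNReal.ofReal C₂ *
          (ENNReal.ofReal C₁ * ∫⁻ x, ‖f x‖ₑ ^ 2 ∂(weighted μ u)) := by
        refine hbound.trans ?_
        gcongr
        exact hP f hf
    _ = ENNReal.ofReal C₁ * ENNReal.ofReal C₂ * A * ∫⁻ x, ‖f x‖ₑ ^ 2 ∂(weighted μ u) := by ring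

end AtomicFiltration

end Duality

namespace AtomicFiltration

variable {X : Type*} [MeasurableSpace X] {μ : Measure X} {F : AtomicFiltration μ}
  {u v : X → ℝ} {α : ℝ → ℝ}

section Sparse

/-- The part of `J` that is not covered by the members of the family `Q` strictly inside `J`. For a
sparse family these sets are disjoint and carry at least half of the measure of the members. -/
def uncovered (Q : Set F.lattice) (J : Set X) : Set X :=
  J \ ⋃ L ∈ {L ∈ Q | (L : Set X) ⊂ J}, (L : Set X)

theorem uncovered_subset (Q : Set F.lattice) (J : Set X) : uncovered Q J ⊆ J := sdiff_subset

theorem measurableSet_uncovered (Q : Set F.lattice) (J : F.lattice) :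
    MeasurableSet (uncovered Q (J : Set X)) :=
  (F.measurableSet_of_mem_lattice J.2).diff
    (MeasurableSet.biUnion (to_countable _) fun L _ => F.measurableSet_of_mem_lattice L.2)

theorem pairwiseDisjoint_uncovered (Q : Set F.lattice) :
    Q.PairwiseDisjoint fun J => uncovered Q (J : Set X) := by
  have of_ssubset : ∀ J ∈ Q, ∀ L : F.lattice, (J : Set X) ⊂ L →
      Disjoint (uncovered Q (J : Set X)) (uncovered Q (L : Set X)) := fun J hJ L hJL =>
    Set.disjoint_left.2 fun x hxJ hxL => hxL.2 (mem_biUnion ⟨hJ, hJL⟩ hxJ.1)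
  intro J hJ L hL hne
  have hne' : (J : Set X) ≠ L := fun h => hne (Subtype.ext h)
  by_cases hd : Disjoint (J : Set X) L
  · exact hd.mono (uncovered_subset Q J) (uncovered_subset Q L)
  · rcases F.subset_or_subset_of_inter_nonempty J.2 L.2
      (Set.not_disjoint_iff_nonempty_inter.1 hd) with h | h
    · exact of_ssubset J hJ L (h.ssubset_of_ne hne')
    · exact (of_ssubset L hL J (h.ssubset_of_ne hne'.symm)).symm

theorem IsSparse.half_measure_le_measure_uncovered {Q : Set F.lattice} (hQ : F.IsSparse Q)
    {J : F.lattice} (hJ : J ∈ Q) : 2⁻¹ * μ J ≤ μ (uncovered Q (J : Set X)) := by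
  calc 2⁻¹ * μ J = μ J - μ J / 2 := by
        rw [ENNReal.sub_half (F.measure_lt_top_of_mem_lattice J.2).ne, mul_comm, div_eq_mul_inv]
    _ ≤ μ J - μ (⋃ L ∈ {L ∈ Q | (L : Set X) ⊂ J}, (L : Set X)) := by
        gcongr
        exact hQ J hJ
    _ ≤ μ (uncovered Q (J : Set X)) := le_measure_sdiff

theorem IsSparse.carlesonBound {Q : Set F.lattice} (hQ : F.IsSparse Q) :
    F.CarlesonBound (fun J => Q.indicator (fun _ => 2⁻¹) J * μ J) μ := by
  intro I
  set S : Set F.lattice := {J | (J : Set X) ⊆ I} ∩ Q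
  calc F.sumBelow (fun J => Q.indicator (fun _ => 2⁻¹) J * μ J) I
      = F.sumBelow (Q.indicator fun J => 2⁻¹ * μ J) I := by
        congr 1
        exact funext fun J => (indicator_mul_left Q (fun _ => 2⁻¹) fun J : F.lattice => μ J).symm
    _ = ∑' J : S, 2⁻¹ * μ (J : F.lattice) := by
        rw [sumBelow_eq_tsum_indicator, indicator_indicator, ← tsum_subtype]
    _ ≤ ∑' J : S, μ (uncovered Q ((J : F.lattice) : Set X)) :=
        ENNReal.tsum_le_tsum fun J => hQ.half_measure_le_measure_uncovered J.2.2
    _ = μ (⋃ J ∈ S, uncovered Q (J : Set X)) :=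
        (measure_biUnion (to_countable S) ((pairwiseDisjoint_uncovered Q).subset inter_subset_right)
          fun J _ => measurableSet_uncovered Q J).symm
    _ ≤ μ I := measure_mono (iUnion₂_subset fun J hJ => (uncovered_subset Q J).trans hJ.1)

theorem IsSparse.tsum_average_mul_sq_div_le {Q : Set F.lattice} (hQ : F.IsSparse Q)
    (hu : F.IsWeight u) (hα : IsPenalty α) {f : X → ℝ} (hf : MemLp f 2 (weighted μ u)) :
    ∑' I : Q, (μ (I : F.lattice) * ‖⨍ x in (I : F.lattice), f x * u x ∂μ‖ₑ) ^ 2 /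
        (μ (I : F.lattice) * entropyBump μ α (I : F.lattice) u) ≤
      ENNReal.ofReal (32 * penaltyConst α) * ∫⁻ x, ‖f x‖ₑ ^ 2 ∂weighted μ u := by
  set a : F.lattice → ℝ≥0∞ := fun J => (μ J * ‖⨍ x in (J : Set X), f x * u x ∂μ‖ₑ) ^ 2 /
    (μ J * entropyBump μ α J u)
  calc ∑' I : Q, a I = ∑' J : F.lattice, 2 * (Q.indicator (fun _ => 2⁻¹) J * a J) := by
        rw [tsum_subtype Q a]
        refine tsum_congr fun J => ?_
        by_cases hJ : J ∈ Q
        · rw [indicator_of_mem hJ, indicator_of_mem hJ, ← mul_assoc,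
            ENNReal.mul_inv_cancel two_ne_zero ENNReal.ofNat_ne_top, one_mul]
        · simp [hJ]
    _ ≤ 2 * (ENNReal.ofReal (16 * penaltyConst α) * ∫⁻ x, ‖f x‖ₑ ^ 2 ∂weighted μ u) := by
        rw [ENNReal.tsum_mul_left]
        gcongr
        simpa only [a, mul_div_assoc] using hu.tsum_mul_average_mul_sq_div_le hα hQ.carlesonBound hf
    _ = ENNReal.ofReal (32 * penaltyConst α) * ∫⁻ x, ‖f x‖ₑ ^ 2 ∂weighted μ u := by
        rw [← mul_assoc, ← ENNReal.ofReal_ofNat 2, ← ENNReal.ofReal_mul zero_le_two]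
        ring_nf

theorem integral_sparseTerm_mul (I : F.lattice) (f h : X → ℝ) :
    ∫ x, F.sparseTerm I f x * h x ∂μ =
      (⨍ x in (I : Set X), f x ∂μ) * (μ.real I * ⨍ x in (I : Set X), h x ∂μ) := by
  rw [measureReal_mul_setAverage (F.measure_lt_top_of_mem_lattice I.2).ne, ← integral_const_mul,
    ← integral_indicator (F.measurableSet_of_mem_lattice I.2)]
  simp only [sparseTerm, expect, indicator_mul_left]

end Sparse

section Paraproduct

theorem IsNormalizedPara.carlesonBound {b : ∀ I : F.lattice, F.diffSpace I}
    (hb : F.IsNormalizedPara b) :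
    F.CarlesonBound (fun J => eLpNorm (b J : X → ℝ) ∞ μ ^ 2 * μ J) μ := by
  intro I
  have h := hb I
  rwa [mul_comm, ← div_eq_mul_inv, ENNReal.div_le_iff (F.measure_pos_of_mem_lattice I.2).ne'
    (F.measure_lt_top_of_mem_lattice I.2).ne, one_mul] at h

theorem IsNormalizedPara.eLpNorm_ne_top {b : ∀ I : F.lattice, F.diffSpace I}
    (hb : F.IsNormalizedPara b) (I : F.lattice) : eLpNorm (b I : X → ℝ) ∞ μ ≠ ∞ := by
  intro h
  refine (F.measure_lt_top_of_mem_lattice I.2).not_ge ((hb.carlesonBound.le I).trans' ?_)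
  simp [h, ENNReal.top_mul (F.measure_pos_of_mem_lattice I.2).ne']

end Paraproduct

section TwoWeight

variable {A : ℝ≥0}

theorem HaarShift.twoWeightBound (T : F.HaarShift) (hu : F.IsWeight u) (hv : F.IsWeight v)
    (hα : IsPenalty α) (hA : ∀ I ∈ F.lattice, entropyBump μ α I u * entropyBump μ α I v ≤ A) :
    TwoWeightBound μ T.term u v
      (16 * (130 * penaltyConst α) * (130 * penaltyConst α) * A) := by
  have hpos := hα.penaltyConst_pos
  refine twoWeightBound_of_pairing hu hv hA (I := fun I => I) (fun I f hf =>
      (T.isHaarFn_term I hf).memLp I.2 (hv.weighted_ne_top I.2) 2)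
    (P := fun I f => 4 * F.diffNorm I f) (R := fun I h => F.diffNorm I h)
    (fun I f h hf hh => ?_) (by positivity) (by positivity) (fun f hf => ?_)
    (fun h hh => hv.tsum_diffNorm_mul_sq_div_le hα hh)
  · refine ((T.isHaarFn_term I hf).enorm_integral_mul_le I.2 hh).trans_eq ?_
    simp only [div_eq_mul_inv]
    ring
  · have h16 : (4 : ℝ≥0∞) ^ 2 = ENNReal.ofReal 16 := by norm_num
    simp only [mul_pow, mul_div_assoc, ENNReal.tsum_mul_left]
    rw [h16, ENNReal.ofReal_mul (by norm_num : (0 : ℝ) ≤ 16), mul_assoc]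
    gcongr
    exact hu.tsum_diffNorm_mul_sq_div_le hα hf

theorem IsSparse.twoWeightBound {Q : Set F.lattice} (hQ : F.IsSparse Q)
    (hu : F.IsWeight u) (hv : F.IsWeight v) (hα : IsPenalty α)
    (hA : ∀ I ∈ F.lattice, entropyBump μ α I u * entropyBump μ α I v ≤ A) :
    TwoWeightBound μ (fun I : Q => F.sparseTerm I) u v
      ((32 * penaltyConst α) * (32 * penaltyConst α) * A) := by
  have hpos := hα.penaltyConst_pos
  refine twoWeightBound_of_pairing hu hv hA (I := fun I : Q => (I : F.lattice))
    (term := fun I => F.sparseTerm I) (fun I f _ =>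
      memLp_indicator_const 2 (F.measurableSet_of_mem_lattice I.1.2) _
        (Or.inr (hv.weighted_ne_top I.1.2)))
    (P := fun I f => μ (I : F.lattice) * ‖⨍ x in (I : F.lattice), f x ∂μ‖ₑ)
    (R := fun I h => μ (I : F.lattice) * ‖⨍ x in (I : F.lattice), h x ∂μ‖ₑ)
    (fun I f h _ _ => ?_) (by positivity) (by positivity)
    (fun f hf => hQ.tsum_average_mul_sq_div_le hu hα hf)
    (fun h hh => hQ.tsum_average_mul_sq_div_le hv hα hh)
  have hμ0 := (F.measure_pos_of_mem_lattice I.1.2).ne'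
  have hμt := (F.measure_lt_top_of_mem_lattice I.1.2).ne
  rw [integral_sparseTerm_mul, enorm_mul, ← measure_mul_enorm hμt, mul_assoc, mul_div_assoc,
    ENNReal.mul_div_cancel hμ0 hμt]

theorem IsNormalizedPara.twoWeightBound {b : ∀ I : F.lattice, F.diffSpace I}
    (hb : F.IsNormalizedPara b) (hu : F.IsWeight u) (hv : F.IsWeight v) (hα : IsPenalty α)
    (hA : ∀ I ∈ F.lattice, entropyBump μ α I u * entropyBump μ α I v ≤ A) :
    TwoWeightBound μ (F.paraTerm b) u v
      ((16 * penaltyConst α) * (130 * penaltyConst α) * A) := by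
  have hpos := hα.penaltyConst_pos
  have hHaar := fun I => isHaarFn_paraTerm b I (hb.eLpNorm_ne_top I)
  refine twoWeightBound_of_pairing hu hv hA (I := fun I => I) (fun I f _ =>
      (hHaar I f).memLp I.2 (hv.weighted_ne_top I.2) 2)
    (P := fun I f => eLpNorm (b I : X → ℝ) ∞ μ * (μ I * ‖⨍ x in (I : Set X), f x ∂μ‖ₑ))
    (R := fun I h => F.diffNorm I h)
    (fun I f h _ hh => ?_) (by positivity) (by positivity) (fun f hf => ?_)
    (fun h hh => hv.tsum_diffNorm_mul_sq_div_le hα hh)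
  · have hμ0 := (F.measure_pos_of_mem_lattice I.2).ne'
    have hμt := (F.measure_lt_top_of_mem_lattice I.2).ne
    refine ((hHaar I f).enorm_integral_mul_le I.2 hh).trans_eq ?_
    rw [← ENNReal.mul_div_cancel_right (b := μ I)
      (a := ‖⨍ x in (I : Set X), f x ∂μ‖ₑ * eLpNorm (b I : X → ℝ) ∞ μ * F.diffNorm I h) hμ0 hμt]
    ring_nf
  · simpa only [mul_pow _ (μ _ * _)] using
      hu.tsum_mul_average_mul_sq_div_le hα hb.carlesonBound hf

end TwoWeight

end AtomicFiltration

theorem TwoWeightBound.mono {X : Type*} [MeasurableSpace X] {μ : Measure X} {ι : Type*}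
    {term : ι → (X → ℝ) → X → ℝ} {u v : X → ℝ} {C C' : ℝ} (h : TwoWeightBound μ term u v C)
    (hu : ∀ x, 0 ≤ u x) (hC : C ≤ C') : TwoWeightBound μ term u v C' := by
  intro f hf
  obtain ⟨g, hg, hterm, hlim, hle⟩ := h f hf
  exact ⟨g, hg, hterm, hlim, hle.trans (mul_le_mul_of_nonneg_right hC
    (integral_nonneg fun x => mul_nonneg (sq_nonneg _) (hu x)))⟩

end

theorem mainTheorem1 : ∃ K : ℝ, 0 < K ∧
    ∀ (X : Type*) [MeasurableSpace X] (μ : Measure X) [SigmaFinite μ] (F : AtomicFiltration μ)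
      (α : ℝ → ℝ) (u v : X → ℝ) (A : ℝ≥0),
      IsPenalty α → F.IsWeight u → F.IsWeight v →
      (∀ I ∈ F.lattice, entropyBump μ α I u * entropyBump μ α I v ≤ A) →
      -- Haar shifts of complexity `1`
      (∀ T : F.HaarShift, TwoWeightBound μ T.term u v (K * A * penaltyConst α ^ 2)) ∧
      -- sparse operators
      (∀ Q : Set F.lattice, F.IsSparse Q →
        TwoWeightBound μ (fun I : Q => F.sparseTerm I) u v (K * A * penaltyConst α ^ 2)) ∧
      -- paraproducts normalized by the `L^∞` Carleson condition
      (∀ b : ∀ I : F.lattice, F.diffSpace I, F.IsNormalizedPara b →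
        TwoWeightBound μ (F.paraTerm b) u v (K * A * penaltyConst α ^ 2)) := by
  refine ⟨16 * 130 * 130, by norm_num, ?_⟩
  intro X _ μ _ F α u v A hα hu hv hA
  have hnn : (0 : ℝ) ≤ A * penaltyConst α ^ 2 := by positivity
  refine ⟨fun T => ?_, fun Q hQ => ?_, fun b hb => ?_⟩
  · exact (T.twoWeightBound hu hv hα hA).mono hu.nonneg (by nlinarith)
  · exact (hQ.twoWeightBound hu hv hα hA).mono hu.nonneg (by nlinarith)
  · exact (hb.twoWeightBound hu hv hα hA).mono hu.nonneg (by nlinarith)
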